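/- Fix a dimension $d$. A weighted point set is a finite set $P\subseteq\mathbb R^d$ of distinct points with positive integer weights; $|P|$ is its number of points. For $\Delta\ge 0$, a $\Delta$-translation of $P$ is a weighted point set obtained by moving every point of $P$ by distance at most $\Delta$; points that are moved to the same location are merged and their weights are added. $P^{<r}$ denotes the weighted set of those points of $P$ whose distance to the nearest other point of $P$ is less than $r$. A $\varphi$-decider for a function $f$ is a procedure that, given $r>0$ and $x$, returns a true statement of one of the forms "$f(x)<r$", "$f(x)>r$", "$f(x)\in[\alpha,\varphi\alpha]$", with an explicit $\alpha\in\mathbb R$ in the last case. A nice distance problem consists of a class of instances $(P,\Gamma)$, where $P$ is a weighted point set and $\Gamma$ is a context (the further parameters of the problem), and a function $f\ge 0$ on instances, such that: * (Degenerate sets) $f(P,\Gamma)=0$ if $|P|\le 1$. * (Lipschitz) If $(P,\Gamma)$ is an instance and $Q$ is a $\Delta$-translation of $P$, then $(Q,\Gamma)$ is an instance and $|f(P,\Gamma)-f(Q,\Gamma)|\le 2\Delta$. * (Prune) There is a context-update procedure running in $O(|P|)$ time which, for every instance with $0<f(P,\Gamma)<r$, computes from $r,P,\Gamma$ a context $\Gamma'$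 such that $(P^{<r},\Gamma')$ is an instance and $f(P^{<r},\Gamma')=f(P,\Gamma)$. It is a $\varphi$-NDP if moreover $f$ has a $\varphi$-decider running in $O(|P|)$ time on all instances $(P,\Gamma)$. The model of computation is a randomized real RAM with the arithmetic operations, square root, floor function, uniformly random integers from a given range, and constant-time hash tables (tables of real numbers indexed by tuples of integers), all at unit cost. The decider and the context-update procedure are black boxes whose running time is charged for each call, and contexts are accessed only through them. A $\varphi$-approximation of the value $v>0$ is a number $y$ with $v\le y\le\varphi v$. **Theorem.** (1) There is an algorithm which, given an instance $(P,\Gamma)$ with $|P|=n$ and $f(P,\Gamma)>0$ of a $\varphi$-NDP with $\varphi\ge 3/2$, computes a $\varphi$-approximation of $f(P,\Gamma)$ in expected $O(n)$ time. The output is always correct; only the running time is random. The constant depends only on $d$ and on the constants in the running times of the decider and of the context update. (2) Let $c\ge1$ be a constant, and suppose that $f$ has, for every $\varepsilon\in(0,1)$, a $(1+\varepsilon)$-decider with running time $O(n/\varepsilon^c)$ on instances with $n$ points (with a constant that does not depend on $\varepsilon$) instead of the $O(n)$-time $\varphi$-decider. Then there is an algorithm which, given $\varepsilon\in(0,1)$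 and an instance $(P,\Gamma)$ with $|P|=n$ and $f(P,\Gamma)>0$, computes a $(1+\varepsilon)$-approximation of $f(P,\Gamma)$ in expected $O(n/\varepsilon^c)$ time. The output is again always correct, and the constant depends only on $d$, $c$ and the constants in the running times of the procedures. -/

import Mathlib

open scoped ENNReal

universe u

noncomputable section

namespace NiceDistance

/-! ### Weighted point sets -/

/-- Points of `ℝ^d` with the Euclidean distance. -/
abbrev Pt (d : ℕ) : Type := EuclideanSpace ℝ (Fin d)

/-- A finite set of distinct points with positive integer weights: the underlying set is the
support of the function, and the weight of a point of the set is its value. -/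
abbrev WSet (d : ℕ) : Type := Pt d →₀ ℕ

/-- The number `|P|` of points (not the total weight). -/
def size {d : ℕ} (P : WSet d) : ℕ := P.support.card

/-- `Q` is a `Δ`-translation of `P`: every point of `P` is moved by at most `Δ`, and the weight of
each point of `Q` is the total weight of the points of `P` that are moved to it (weights being
positive, `Q.support` is exactly the image of `P.support`). -/
def IsTranslation {d : ℕ} (Δ : ℝ) (P Q : WSet d) : Prop :=
  ∃ g : Pt d → Pt d, (∀ p ∈ P.support, dist p (g p) ≤ Δ) ∧ Q = P.mapDomain g

open Classical in
/-- The weighted set of the `r`-close points of `P`: those whose distance to the nearest other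
point of `P` is smaller than `r`. -/
def closePts {d : ℕ} (P : WSet d) (r : ℝ) : WSet d :=
  P.filter fun p => ∃ q ∈ P.support, q ≠ p ∧ dist p q < r

/-- The list `L` enumerates the weighted set `P`: each point occurs once, with its weight. -/
def Enumerates {d : ℕ} (L : List (Pt d × ℕ)) (P : WSet d) : Prop :=
  (L.map Prod.fst).Nodup ∧ ∀ p w, (p, w) ∈ L ↔ p ∈ P.support ∧ P p = w

/-! ### Deciders and nice distance problems -/

/-- The possible answers of a decider that is asked about the value `v` at the threshold `r`. -/
inductive Answer : Type
  /-- "`v < r`" -/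
  | less
  /-- "`v > r`" -/
  | greater
  /-- "`v ∈ [α, φ α]`" -/
  | within (α : ℝ)

/-- The answer of a `φ`-decider at the threshold `r` is true of the value `v`. -/
def Answer.Correct (φ r v : ℝ) : Answer → Prop
  | .less => v < r
  | .greater => r < v
  | .within α => α ≤ v ∧ v ≤ φ * α

/-- A target function on pairs (weighted point set, context) with the Lipschitz property.
`Inst P Γ` says that the pair is an instance of the problem, i.e. that it lies in the domain of the
target function; the values of `f` elsewhere are irrelevant. -/
structure Problem (d : ℕ) (Ctx : Type u) where
  Inst : WSet d → Ctx → Prop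
  f : WSet d → Ctx → ℝ
  f_nonneg : ∀ P Γ, Inst P Γ → 0 ≤ f P Γ
  /-- The target is a distance determined by the point set: it vanishes if there are no two
  distinct points. -/
  f_eq_zero : ∀ P Γ, Inst P Γ → size P ≤ 1 → f P Γ = 0
  inst_translation : ∀ P Q Γ Δ, 0 ≤ Δ → Inst P Γ → IsTranslation Δ P Q → Inst Q Γ
  lipschitz : ∀ P Q Γ Δ, 0 ≤ Δ → Inst P Γ → IsTranslation Δ P Q → |f P Γ - f Q Γ| ≤ 2 * Δ

/-- The two procedures that come with a problem, as black boxes with their running times. The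
decider gets the accuracy `φ`, the threshold `r`, the points (as an array, so that its answer may
depend on the order in which they are stored) and the context; the context updater gets the radius
`r`, the points and the context. -/
structure Procedures (d : ℕ) (Ctx : Type u) where
  decider : (φ r : ℝ) → List (Pt d × ℕ) → Ctx → Answer
  deciderTime : (φ r : ℝ) → List (Pt d × ℕ) → Ctx → ℕ
  update : (r : ℝ) → List (Pt d × ℕ) → Ctx → Ctx
  updateTime : (r : ℝ) → List (Pt d × ℕ) → Ctx → ℕ

/-- Called with accuracy `φ`, the decider is a `φ`-decider for the target function whose running
time on `n` points is at most `T * n`. -/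
def HasDecider {d : ℕ} {Ctx : Type u} (N : Problem d Ctx) (O : Procedures d Ctx) (φ T : ℝ) :
    Prop :=
  ∀ P Γ L r, N.Inst P Γ → Enumerates L P → 0 < r →
    (O.decider φ r L Γ).Correct φ r (N.f P Γ) ∧ (O.deciderTime φ r L Γ : ℝ) ≤ T * size P

/-- Prune property, required only where the target is not zero: if `f (P, Γ) < r`, then restricting
to the `r`-close points and updating the context leaves the value of the target unchanged, and the
update takes time at most `T * n` on `n` points. -/
def HasPrune {d : ℕ} {Ctx : Type u} (N : Problem d Ctx) (O : Procedures d Ctx) (T : ℝ) : Prop :=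
  ∀ P Γ L r, N.Inst P Γ → Enumerates L P → 0 < N.f P Γ → N.f P Γ < r →
    N.Inst (closePts P r) (O.update r L Γ) ∧
    N.f (closePts P r) (O.update r L Γ) = N.f P Γ ∧
    (O.updateTime r L Γ : ℝ) ≤ T * size P

/-! ### The machine: a randomized real RAM with the floor function and hash tables

Programs are finite. The memory consists of registers holding real numbers, of tables of real
numbers that are indexed by tuples of integers and are accessed in constant time (arrays and hash
tables), and of registers holding contexts. Contexts are opaque: they can only be moved and handed
to the two procedures. -/

/-- Arithmetic expressions over the real registers. -/
inductive RExpr : Type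
  | const (q : ℚ)
  | reg (i : ℕ)
  | add (a b : RExpr)
  | sub (a b : RExpr)
  | mul (a b : RExpr)
  | div (a b : RExpr)
  | sqrt (a : RExpr)
  | floor (a : RExpr)

/-- The value of an expression (a division by zero yields zero, as does the square root of a
negative number). -/
def RExpr.val (ρ : ℕ → ℝ) : RExpr → ℝ
  | .const q => (q : ℝ)
  | .reg i => ρ i
  | .add a b => a.val ρ + b.val ρ
  | .sub a b => a.val ρ - b.val ρ
  | .mul a b => a.val ρ * b.val ρ
  | .div a b => a.val ρ / b.val ρ
  | .sqrt a => Real.sqrt (a.val ρ)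
  | .floor a => (⌊a.val ρ⌋ : ℝ)

/-- The number of steps that are charged for evaluating an expression. -/
def RExpr.cost : RExpr → ℕ
  | .const _ => 1
  | .reg _ => 1
  | .add a b => a.cost + b.cost + 1
  | .sub a b => a.cost + b.cost + 1
  | .mul a b => a.cost + b.cost + 1
  | .div a b => a.cost + b.cost + 1
  | .sqrt a => a.cost + 1
  | .floor a => a.cost + 1

/-- Programs. The numbers `x`, `z` name real registers, `a` names a table, `g`, `h` name context
registers. -/
inductive Cmd : Type
  | skip
  /-- `reg x := e` -/
  | set (x : ℕ) (e : RExpr)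
  /-- `reg x := table a [idx]`, the entries of `idx` being rounded down -/
  | load (x a : ℕ) (idx : List RExpr)
  /-- `table a [idx] := e`, the entries of `idx` being rounded down -/
  | store (a : ℕ) (idx : List RExpr) (e : RExpr)
  /-- `reg x :=` a uniformly random element of `{0, 1, …, ⌊e⌋}` -/
  | rand (x : ℕ) (e : RExpr)
  /-- `ctx h := ctx g` -/
  | moveCtx (g h : ℕ)
  /-- call the decider with accuracy `φ` and threshold `r` on the first `n` points stored in
  table `a` and on `ctx g`; the answer is returned in the registers `z` and `z + 1` -/
  | callDecider (φ r n : RExpr) (a g z : ℕ)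
  /-- `ctx h :=` the result of the context updater for the radius `r`, the first `n` points
  stored in table `a` and `ctx g` -/
  | callUpdate (r n : RExpr) (a g h : ℕ)
  | seq (c₁ c₂ : Cmd)
  /-- if `e₁ < e₂` then `c₁` else `c₂` -/
  | ite (e₁ e₂ : RExpr) (c₁ c₂ : Cmd)
  /-- while `e₁ < e₂` do `c` -/
  | loop (e₁ e₂ : RExpr) (c : Cmd)

/-- The contents of the memory. -/
structure Store (Ctx : Type u) where
  reg : ℕ → ℝ
  tab : ℕ → List ℤ → ℝ
  ctx : ℕ → Ctx

namespace Store

variable {Ctx : Type u}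

def setReg (s : Store Ctx) (x : ℕ) (v : ℝ) : Store Ctx :=
  { s with reg := Function.update s.reg x v }

def setTab (s : Store Ctx) (a : ℕ) (key : List ℤ) (v : ℝ) : Store Ctx :=
  { s with tab := Function.update s.tab a (Function.update (s.tab a) key v) }

def setCtx (s : Store Ctx) (h : ℕ) (Γ : Ctx) : Store Ctx :=
  { s with ctx := Function.update s.ctx h Γ }

/-- The key of a table entry that is denoted by a list of expressions. -/
def key (s : Store Ctx) (idx : List RExpr) : List ℤ :=
  idx.map fun e => ⌊e.val s.reg⌋

/-- The first `n` points stored in table `a`: the `k`-th coordinate of the `i`-th point is the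
entry `[i, k]`, and its weight is the entry `[i, d]`. -/
def points (d : ℕ) (s : Store Ctx) (a n : ℕ) : List (Pt d × ℕ) :=
  List.ofFn fun i : Fin n =>
    (WithLp.toLp 2 fun k : Fin d => s.tab a [(i : ℤ), ((k : ℕ) : ℤ)], ⌊s.tab a [(i : ℤ), (d : ℤ)]⌋₊)

/-- The answer of a decider is returned as `-1`, `1` or `0` in register `z`, and in the last case
the left endpoint `α` is returned in register `z + 1`. -/
def setAnswer (s : Store Ctx) (z : ℕ) : Answer → Store Ctx
  | .less => (s.setReg z (-1)).setReg (z + 1) 0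
  | .greater => (s.setReg z 1).setReg (z + 1) 0
  | .within α => (s.setReg z 0).setReg (z + 1) α

end Store

/-- A configuration: the commands that remain to be executed, first one first, and the memory.
The machine has halted when no command is left. -/
abbrev Config (Ctx : Type u) : Type u := List Cmd × Store Ctx

/-- One step of the machine. -/
def step {d : ℕ} {Ctx : Type u} (O : Procedures d Ctx) : Config Ctx → PMF (Config Ctx)
  | ([], s) => PMF.pure ([], s)
  | (.skip :: K, s) => PMF.pure (K, s)
  | (.set x e :: K, s) => PMF.pure (K, s.setReg x (e.val s.reg))
  | (.load x a idx :: K, s) => PMF.pure (K, s.setReg x (s.tab a (s.key idx)))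
  | (.store a idx e :: K, s) => PMF.pure (K, s.setTab a (s.key idx) (e.val s.reg))
  | (.rand x e :: K, s) =>
      (PMF.uniformOfFintype (Fin (⌊e.val s.reg⌋₊ + 1))).map fun i => (K, s.setReg x ((i : ℕ) : ℝ))
  | (.moveCtx g h :: K, s) => PMF.pure (K, s.setCtx h (s.ctx g))
  | (.callDecider φ r n a g z :: K, s) =>
      PMF.pure (K, s.setAnswer z
        (O.decider (φ.val s.reg) (r.val s.reg) (s.points d a ⌊n.val s.reg⌋₊) (s.ctx g)))
  | (.callUpdate r n a g h :: K, s) =>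
      PMF.pure (K, s.setCtx h
        (O.update (r.val s.reg) (s.points d a ⌊n.val s.reg⌋₊) (s.ctx g)))
  | (.seq c₁ c₂ :: K, s) => PMF.pure (c₁ :: c₂ :: K, s)
  | (.ite e₁ e₂ c₁ c₂ :: K, s) =>
      open Classical in
      PMF.pure (if e₁.val s.reg < e₂.val s.reg then (c₁ :: K, s) else (c₂ :: K, s))
  | (.loop e₁ e₂ c :: K, s) =>
      open Classical in
      PMF.pure (if e₁.val s.reg < e₂.val s.reg then (c :: .loop e₁ e₂ c :: K, s) else (K, s))

/-- The time that is charged for the next step: at least one unless the machine has halted, one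
more for each operation in the expressions involved, and the running time of the procedure in the
case of a procedure call. -/
def stepTime {d : ℕ} {Ctx : Type u} (O : Procedures d Ctx) : Config Ctx → ℕ
  | ([], _) => 0
  | (.skip :: _, _) => 1
  | (.set _ e :: _, _) => 1 + e.cost
  | (.load _ _ idx :: _, _) => 1 + (idx.map RExpr.cost).sum
  | (.store _ idx e :: _, _) => 1 + (idx.map RExpr.cost).sum + e.cost
  | (.rand _ e :: _, _) => 1 + e.cost
  | (.moveCtx _ _ :: _, _) => 1
  | (.callDecider φ r n a g _ :: _, s) => 1 + φ.cost + r.cost + n.cost +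
      O.deciderTime (φ.val s.reg) (r.val s.reg) (s.points d a ⌊n.val s.reg⌋₊) (s.ctx g)
  | (.callUpdate r n a g _ :: _, s) => 1 + r.cost + n.cost +
      O.updateTime (r.val s.reg) (s.points d a ⌊n.val s.reg⌋₊) (s.ctx g)
  | (.seq _ _ :: _, _) => 1
  | (.ite e₁ e₂ _ _ :: _, _) => 1 + e₁.cost + e₂.cost
  | (.loop e₁ e₂ _ :: _, _) => 1 + e₁.cost + e₂.cost

/-- The distribution of the configuration after `t` steps. -/
def run {d : ℕ} {Ctx : Type u} (O : Procedures d Ctx) : ℕ → Config Ctx → PMF (Config Ctx)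
  | 0, κ => PMF.pure κ
  | t + 1, κ => (step O κ).bind (run O t)

/-- The expected total time of a computation. As every step before halting is charged at least one
unit, it can be finite only if the machine halts with probability one. -/
def expectedTime {d : ℕ} {Ctx : Type u} (O : Procedures d Ctx) (κ : Config Ctx) : ℝ≥0∞ :=
  ∑' t : ℕ, ∑' κ' : Config Ctx, run O t κ κ' * (stepTime O κ' : ℝ≥0∞)

/-- The table that stores the points of a list in the format of `Store.points`. -/
def pointTable {d : ℕ} (L : List (Pt d × ℕ)) : List ℤ → ℝ
  | [.ofNat i, .ofNat k] =>
      match L[i]? with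
      | none => 0
      | some q => if h : k < d then q.1 ⟨k, h⟩ else if k = d then (q.2 : ℝ) else 0
  | _ => 0

/-- The initial memory: the number of points is in register `0`, the accuracy `φ` in register `1`,
the points are in table `0`, the context is in the context registers, and the rest is zero. -/
def inputStore {d : ℕ} {Ctx : Type u} (φ : ℝ) (L : List (Pt d × ℕ)) (Γ : Ctx) : Store Ctx where
  reg := fun x => if x = 0 then (L.length : ℝ) else if x = 1 then φ else 0
  tab := fun a => if a = 0 then pointTable L else fun _ => 0
  ctx := fun _ => Γ

/-- Run on the points `L` with context `Γ` and accuracy `φ`, the program takes expected time at most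
`B`, and every halting computation leaves in register `0` a number `y` with `v ≤ y ≤ φ v`. -/
def Approximates {d : ℕ} {Ctx : Type u} (prog : Cmd) (O : Procedures d Ctx) (φ : ℝ)
    (L : List (Pt d × ℕ)) (Γ : Ctx) (v B : ℝ) : Prop :=
  expectedTime O ([prog], inputStore φ L Γ) ≤ ENNReal.ofReal B ∧
  ∀ (t : ℕ) (s : Store Ctx), ([], s) ∈ (run O t ([prog], inputStore φ L Γ)).support →
    v ≤ s.reg 0 ∧ s.reg 0 ≤ φ * v

end NiceDistance

end

noncomputable section

namespace NiceDistance

/-! ### Expected running time -/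

section Semantics

variable {d : ℕ} {Ctx : Type u} (O : Procedures d Ctx)

/-! The algorithm is net-and-prune. It keeps a current weighted set, repeatedly picks a uniformly
random point `p` of it, computes the distance `r = δ p` to its nearest neighbour and asks the
decider about `r`. If the target is smaller than `r`, all points with nearest neighbour distance at
least `r` are pruned, which leaves the target unchanged. If it is even larger than `40 (d + 1) r`,
the points are moved to a net with mutual distances greater than `2 r`, which changes the target by
at most `8 (d + 1) r`. Otherwise the target lies between `r` and `40 (d + 1) r`, or the decider has
returned an interval, and the value is known up to a factor depending only on `d` and `φ`.

Expected time: pruning removes every `q` with `δ q ≥ δ p`, and the net removes at least half as many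
points as there are `q` with `δ q ≤ δ p`. So at least `rank p / 2` points disappear
(`size_closePts_add_rank_le`, `two_mul_card_add_rank_le`). The mean rank is at least `n / 6`
(`card_sq_le_sum_rank`), so a linear-time round loses `n / 12` points in expectation and the total
is linear (`Bd.mainLoop`). A round is linear because grids stored in hash tables reduce pruning and
netting to a bounded number of cell look-ups per point (`Det.prune`, `Det.net`).

Correctness: the invariant `Good` bounds the accumulated error by `8 (d + 1) m`, where `m` is a
lower bound for the distances of the current points, and by half the current target. Pruning affects
neither `m` nor the target. A net step at radius `r ≥ m` adds an error `8 (d + 1) r` but raises `m`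
to `2 r`, so the bound reproduces itself (`Good.net`).

A final search on the original input shrinks the interval to the desired ratio. With fixed accuracy
a number of queries depending only on `d` suffices (`Det.refineLoop_const`). With increasing
accuracy the relative width is at least halved each time and the query costs form a geometric sum
dominated by `n / ε ^ c` (`Det.refineLoop_acc`).

Memory layout. Registers: `0`, `1` input size and accuracy; `2` current size; `3` time stamp; `4`
nearest neighbour distance; `5`, `6` interval; `7` stop flag; from `8` on scratch, with `14`, `15`
for answers and point buffers at `16` and `17 + d`. Tables: `0` input, `1` current points, `2` grid,
`3` marks. Context `0` is current, context `1` is the original one. -/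

theorem expectedTime_eq (κ : Config Ctx) :
    expectedTime O κ = stepTime O κ + ∑' κ' : Config Ctx, step O κ κ' * expectedTime O κ' := by
  unfold expectedTime
  rw [tsum_eq_zero_add' ENNReal.summable]
  congr 1
  · rw [tsum_eq_single κ]
    · simp [run]
    · intro b hb
      simp [run, hb]
  · simp_rw [run, PMF.bind_apply, ← ENNReal.tsum_mul_right, ← ENNReal.tsum_mul_left]
    have h : ∀ (t : ℕ) (b : Config Ctx),
        ∑' i, step O κ i * run O t i b * (stepTime O b : ℝ≥0∞) =
          ∑' i, step O κ i * (run O t i b * (stepTime O b : ℝ≥0∞)) :=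
      fun t b => tsum_congr fun i => mul_assoc _ _ _
    simp_rw [h]
    rw [ENNReal.tsum_comm (α := Config Ctx)]
    refine tsum_congr fun t => ?_
    rw [ENNReal.tsum_comm]

/-- The computation from `κ` takes expected time at most `X`, and whenever it halts, the final
memory satisfies `Q`. -/
def Bd (Q : Store Ctx → Prop) (κ : Config Ctx) (X : ℝ) : Prop :=
  0 ≤ X ∧ expectedTime O κ ≤ ENNReal.ofReal X ∧
    ∀ (t : ℕ) (s : Store Ctx), ([], s) ∈ (run O t κ).support → Q s

variable {O} {Q : Store Ctx → Prop}

theorem Bd.mono {κ : Config Ctx} {X Y : ℝ} (h : Bd O Q κ X) (hXY : X ≤ Y) : Bd O Q κ Y :=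
  ⟨h.1.trans hXY, h.2.1.trans (ENNReal.ofReal_le_ofReal hXY), h.2.2⟩

theorem run_halted (t : ℕ) (s : Store Ctx) : run O t ([], s) = PMF.pure ([], s) := by
  induction t with
  | zero => rfl
  | succ t ih => simp [run, step, ih]

theorem Bd.halted {s : Store Ctx} (h : Q s) : Bd O Q ([], s) 0 := by
  refine ⟨le_rfl, ?_, ?_⟩
  · simp only [expectedTime, run_halted, ENNReal.ofReal_zero, nonpos_iff_eq_zero,
      ENNReal.tsum_eq_zero]
    intro t κ
    by_cases hκ : κ = ([], s)
    · subst hκ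
      simp [stepTime]
    · simp [hκ]
  · intro t s' hs'
    rw [run_halted] at hs'
    simp at hs'
    exact hs' ▸ h

theorem Bd.of_step {c : Cmd} {K : List Cmd} {s : Store Ctx} {κ : Config Ctx} {X : ℝ}
    (hstep : step O (c :: K, s) = PMF.pure κ) (h : Bd O Q κ X) :
    Bd O Q (c :: K, s) (stepTime O (c :: K, s) + X) := by
  refine ⟨add_nonneg (Nat.cast_nonneg _) h.1, ?_, ?_⟩
  · rw [expectedTime_eq, hstep, ENNReal.ofReal_add (Nat.cast_nonneg _) h.1, ENNReal.ofReal_natCast]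
    gcongr
    rw [tsum_eq_single κ]
    · simpa using h.2.1
    · intro b hb
      simp [hb]
  · intro t s' hs'
    cases t with
    | zero => simp [run] at hs'
    | succ t =>
      rw [run, hstep, PMF.pure_bind] at hs'
      exact h.2.2 t s' hs'

theorem step_rand (x : ℕ) (e : RExpr) (K : List Cmd) (s : Store Ctx) :
    step O (.rand x e :: K, s) = (PMF.uniformOfFintype (Fin (⌊e.val s.reg⌋₊ + 1))).bind
      fun i => PMF.pure (K, s.setReg x ((i : ℕ) : ℝ)) := by
  simp only [step, PMF.map, Function.comp_def]
  erw [PMF.bind_bind]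
  congr 1
  funext i
  erw [PMF.pure_bind]

/-- The only point where randomness enters: bounds for the individual outcomes are averaged.
Everything else in the program is deterministic. -/
theorem Bd.rand {x : ℕ} {e : RExpr} {K : List Cmd} {s : Store Ctx} {n : ℕ} {X : ℕ → ℝ}
    (hn : ⌊e.val s.reg⌋₊ + 1 = n) (h : ∀ i < n, Bd O Q (K, s.setReg x (i : ℝ)) (X i)) :
    Bd O Q (.rand x e :: K, s) (1 + e.cost + (∑ i ∈ Finset.range n, X i) / n) := by
  have hX : ∀ i ∈ Finset.range n, 0 ≤ X i := fun i hi => (h i (Finset.mem_range.1 hi)).1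
  have hS : 0 ≤ (∑ i ∈ Finset.range n, X i) / n :=
    div_nonneg (Finset.sum_nonneg hX) (Nat.cast_nonneg _)
  have hn0 : (0 : ℝ) < n := by exact_mod_cast (by omega : 0 < n)
  refine ⟨by positivity, ?_, ?_⟩
  · rw [expectedTime_eq, ENNReal.ofReal_add (by positivity) hS]
    refine add_le_add ?_ ?_
    · simp only [stepTime]
      rw [← ENNReal.ofReal_natCast]
      simp
    · rw [step_rand]
      calc _ = ∑ i : Fin (⌊e.val s.reg⌋₊ + 1), (n : ℝ≥0∞)⁻¹ *
            expectedTime O (K, s.setReg x ((i : ℕ) : ℝ)) := by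
              simp_rw [PMF.bind_apply, ← ENNReal.tsum_mul_right]
              rw [ENNReal.tsum_comm, tsum_fintype]
              refine Finset.sum_congr rfl fun i _ => ?_
              rw [tsum_eq_single (K, s.setReg x ((i : ℕ) : ℝ))]
              · simp [hn]
              · intro b hb
                simp [hb]
        _ = ∑ i ∈ Finset.range n, (n : ℝ≥0∞)⁻¹ * expectedTime O (K, s.setReg x (i : ℝ)) := by
              rw [← hn, Finset.sum_range]
        _ ≤ ∑ i ∈ Finset.range n, ENNReal.ofReal (X i / n) := by
              refine Finset.sum_le_sum fun i hi => ?_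
              rw [ENNReal.ofReal_div_of_pos hn0, ENNReal.ofReal_natCast, div_eq_mul_inv, mul_comm]
              gcongr
              exact (h i (Finset.mem_range.1 hi)).2.1
        _ = _ := by
              rw [← ENNReal.ofReal_sum_of_nonneg, Finset.sum_div]
              intro i hi
              exact div_nonneg (hX i hi) hn0.le
  · intro t s' hs'
    cases t with
    | zero => simp [run] at hs'
    | succ t =>
      rw [run, PMF.mem_support_bind_iff] at hs'
      obtain ⟨κ, hκ, hs'⟩ := hs'
      rw [step_rand, PMF.mem_support_bind_iff] at hκ
      obtain ⟨i, -, hi⟩ := hκ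
      obtain rfl := (PMF.mem_support_pure_iff _ _).1 hi
      exact (h i (hn ▸ i.2)).2.2 t s' hs'

end Semantics

/-! ### Execution without random choices -/

/-- The effect of a command without loops, random choices and procedure calls. -/
def Cmd.ev {Ctx : Type u} : Cmd → Store Ctx → Store Ctx
  | .set x e, s => s.setReg x (e.val s.reg)
  | .load x a idx, s => s.setReg x (s.tab a (s.key idx))
  | .store a idx e, s => s.setTab a (s.key idx) (e.val s.reg)
  | .moveCtx g h, s => s.setCtx h (s.ctx g)
  | .seq c₁ c₂, s => c₂.ev (c₁.ev s)
  | .ite e₁ e₂ c₁ c₂, s =>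
      open Classical in if e₁.val s.reg < e₂.val s.reg then c₁.ev s else c₂.ev s
  | _, s => s

/-- Commands without loops, random choices and procedure calls. -/
def Cmd.Simple : Cmd → Prop
  | .skip | .set _ _ | .load _ _ _ | .store _ _ _ | .moveCtx _ _ => True
  | .seq c₁ c₂ | .ite _ _ c₁ c₂ => c₁.Simple ∧ c₂.Simple
  | _ => False

/-- A bound on the time for executing a command without loops, random choices and calls. -/
def Cmd.cost : Cmd → ℕ
  | .set _ e => 1 + e.cost
  | .load _ _ idx => 1 + (idx.map RExpr.cost).sum
  | .store _ idx e => 1 + (idx.map RExpr.cost).sum + e.cost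
  | .seq c₁ c₂ => 1 + c₁.cost + c₂.cost
  | .ite e₁ e₂ c₁ c₂ => 1 + e₁.cost + e₂.cost + (c₁.cost + c₂.cost)
  | _ => 1

theorem ev_ite_pos {Ctx : Type u} {s : Store Ctx} {e₁ e₂ : RExpr} {c₁ c₂ : Cmd}
    (h : e₁.val s.reg < e₂.val s.reg) : (Cmd.ite e₁ e₂ c₁ c₂).ev s = c₁.ev s :=
  if_pos h

theorem ev_ite_neg {Ctx : Type u} {s : Store Ctx} {e₁ e₂ : RExpr} {c₁ c₂ : Cmd}
    (h : ¬ e₁.val s.reg < e₂.val s.reg) : (Cmd.ite e₁ e₂ c₁ c₂).ev s = c₂.ev s :=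
  if_neg h

section Det

variable {d : ℕ} {Ctx : Type u} (O : Procedures d Ctx)

/-- Started in `s`, the command `c` reaches in time at most `τ` and without random choices
a memory that satisfies `Q`. -/
def Det (c : Cmd) (s : Store Ctx) (τ : ℝ) (Q : Store Ctx → Prop) : Prop :=
  ∃ s', Q s' ∧ ∀ K R X, Bd O R (K, s') X → Bd O R (c :: K, s) (τ + X)

variable {O} {s : Store Ctx} {Q R : Store Ctx → Prop} {τ τ₁ τ₂ : ℝ} {c c₁ c₂ : Cmd}

theorem Det.mono (h : Det O c s τ₁ Q) (hτ : τ₁ ≤ τ₂) (hQ : ∀ s', Q s' → R s') :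
    Det O c s τ₂ R := by
  obtain ⟨s', hs', h⟩ := h
  exact ⟨s', hQ s' hs', fun K R X hX => (h K R X hX).mono (by gcongr)⟩

theorem Det.of_step {s' : Store Ctx} {t : ℕ} (hs' : Q s')
    (h : ∀ K, step O (c :: K, s) = PMF.pure (K, s'))
    (ht : ∀ K, stepTime O (c :: K, s) = t) : Det O c s t Q :=
  ⟨s', hs', fun K R X hX => by simpa [ht K] using Bd.of_step (h K) hX⟩

/-- Since `Det` quantifies over the commands that follow and over their time bound, composition is
mere substitution, and no expectation has to be computed for deterministic parts. -/
theorem Det.seq (h : Det O c₁ s τ₁ fun s₁ => Det O c₂ s₁ τ₂ Q) :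
    Det O (.seq c₁ c₂) s (1 + τ₁ + τ₂) Q := by
  obtain ⟨s₁, ⟨s₂, hs₂, h₂⟩, h₁⟩ := h
  refine ⟨s₂, hs₂, fun K R X hX => ?_⟩
  refine (Bd.of_step (by rw [step]) (h₁ _ _ _ (h₂ _ _ _ hX))).mono ?_
  simp only [stepTime]
  push_cast
  linarith

theorem Det.seq_of {R : Store Ctx → Prop} (h₁ : Det O c₁ s τ₁ R)
    (h₂ : ∀ s₁, R s₁ → Det O c₂ s₁ τ₂ Q) : Det O (.seq c₁ c₂) s (1 + τ₁ + τ₂) Q :=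
  Det.seq (h₁.mono le_rfl h₂)

theorem Det.ite {e₁ e₂ : RExpr} (h₁ : e₁.val s.reg < e₂.val s.reg → Det O c₁ s τ Q)
    (h₂ : ¬ e₁.val s.reg < e₂.val s.reg → Det O c₂ s τ Q) :
    Det O (.ite e₁ e₂ c₁ c₂) s (1 + e₁.cost + e₂.cost + τ) Q := by
  by_cases h : e₁.val s.reg < e₂.val s.reg
  · obtain ⟨s', hs', h'⟩ := h₁ h
    refine ⟨s', hs', fun K R X hX => ?_⟩
    refine (Bd.of_step (by rw [step, if_pos h]) (h' _ _ _ hX)).mono ?_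
    simp only [stepTime]
    push_cast
    linarith
  · obtain ⟨s', hs', h'⟩ := h₂ h
    refine ⟨s', hs', fun K R X hX => ?_⟩
    refine (Bd.of_step (by rw [step, if_neg h]) (h' _ _ _ hX)).mono ?_
    simp only [stepTime]
    push_cast
    linarith

theorem Det.loop_exit {e₁ e₂ : RExpr} (h : ¬ e₁.val s.reg < e₂.val s.reg) (hQ : Q s) :
    Det O (.loop e₁ e₂ c) s (1 + e₁.cost + e₂.cost) Q := by
  refine ⟨s, hQ, fun K R X hX => (Bd.of_step (by rw [step, if_neg h]) hX).mono ?_⟩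
  simp only [stepTime]
  push_cast
  exact le_rfl

theorem Det.loop_step {e₁ e₂ : RExpr} (h : e₁.val s.reg < e₂.val s.reg)
    (hc : Det O c s τ₁ fun s₁ => Det O (.loop e₁ e₂ c) s₁ τ₂ Q) :
    Det O (.loop e₁ e₂ c) s (1 + e₁.cost + e₂.cost + τ₁ + τ₂) Q := by
  obtain ⟨s₁, ⟨s₂, hs₂, h₂⟩, h₁⟩ := hc
  refine ⟨s₂, hs₂, fun K R X hX => ?_⟩
  refine (Bd.of_step (by rw [step, if_pos h]) (h₁ _ _ _ (h₂ _ _ _ hX))).mono ?_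
  simp only [stepTime]
  push_cast
  linarith

theorem Det.callDecider {φ r n : RExpr} {a g z : ℕ} {T : ℝ}
    (hT : (O.deciderTime (φ.val s.reg) (r.val s.reg) (s.points d a ⌊n.val s.reg⌋₊) (s.ctx g) : ℝ)
      ≤ T)
    (hQ : Q (s.setAnswer z
      (O.decider (φ.val s.reg) (r.val s.reg) (s.points d a ⌊n.val s.reg⌋₊) (s.ctx g)))) :
    Det O (.callDecider φ r n a g z) s (1 + φ.cost + r.cost + n.cost + T) Q :=
  (Det.of_step hQ (fun K => by rw [step]) fun K => by rw [stepTime]).mono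
    (by push_cast; linarith) fun _ h => h

theorem Det.callUpdate {r n : RExpr} {a g h : ℕ} {T : ℝ}
    (hT : (O.updateTime (r.val s.reg) (s.points d a ⌊n.val s.reg⌋₊) (s.ctx g) : ℝ) ≤ T)
    (hQ : Q (s.setCtx h (O.update (r.val s.reg) (s.points d a ⌊n.val s.reg⌋₊) (s.ctx g)))) :
    Det O (.callUpdate r n a g h) s (1 + r.cost + n.cost + T) Q :=
  (Det.of_step hQ (fun K => by rw [step]) fun K => by rw [stepTime]).mono
    (by push_cast; linarith) fun _ h => h

theorem Det.of_simple (hc : c.Simple) (hQ : Q (c.ev s)) : Det O c s c.cost Q := by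
  induction c generalizing s Q with
  | skip | set | load | store | moveCtx =>
    exact Det.of_step hQ (fun K => by simp [step, Cmd.ev]) fun K => by simp [stepTime, Cmd.cost]
  | rand | callDecider | callUpdate | loop => exact hc.elim
  | seq c₁ c₂ h₁ h₂ =>
    exact (Det.seq (h₁ hc.1 (h₂ hc.2 hQ))).mono (by simp [Cmd.cost]) fun _ h => h
  | ite e₁ e₂ c₁ c₂ h₁ h₂ =>
    refine (Det.ite (τ := c₁.cost + c₂.cost) (fun h => (h₁ (Q := Q) hc.1 ?_).mono (by simp) ?_)
      (fun h => (h₂ (Q := Q) hc.2 ?_).mono (by simp) ?_)).mono (by simp [Cmd.cost]) fun _ h => h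
    · simpa [Cmd.ev, h] using hQ
    · exact fun _ h => h
    · simpa [Cmd.ev, h] using hQ
    · exact fun _ h => h

/-- `for x = 0, …, (reg y) - 1 do c` -/
def countLoop (x y : ℕ) (c : Cmd) : Cmd :=
  .seq (.set x (.const 0))
    (.loop (.reg x) (.reg y) (.seq c (.set x (.add (.reg x) (.const 1)))))

/-- The invariant `J k` is stated for the moment when the counter has just been set to `k`. The
summand `12` generously covers the test, the increment and the initialization. -/
theorem Det.forLoop {x y n : ℕ} (hxy : x ≠ y) (hc : c.Simple) (J : ℕ → Store Ctx → Prop)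
    (hn : s.reg y = n) (h₀ : J 0 (s.setReg x 0))
    (h : ∀ k < n, ∀ s : Store Ctx, s.reg x = k → s.reg y = n → J k s →
      (c.ev s).reg x = k ∧ (c.ev s).reg y = n ∧ J (k + 1) ((c.ev s).setReg x (k + 1))) :
    Det O (countLoop x y c) s ((n + 1) * (c.cost + 12)) fun s' => s'.reg y = n ∧ J n s' := by
  have key : ∀ m k : ℕ, k + m = n → ∀ s : Store Ctx, s.reg x = k → s.reg y = n → J k s →
      Det O (.loop (.reg x) (.reg y) (.seq c (.set x (.add (.reg x) (.const 1))))) s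
        (3 + m * (c.cost + 12)) fun s' => s'.reg y = n ∧ J n s' := by
    intro m
    induction m with
    | zero =>
      rintro k hk s hx hy hJ
      obtain rfl : k = n := by omega
      refine (Det.loop_exit ?_ ⟨hy, hJ⟩).mono ?_ fun _ h => h
      · simp [RExpr.val, hx, hy]
      · norm_num [RExpr.cost]
    | succ m ih =>
      rintro k hk s hx hy hJ
      obtain ⟨h₁, h₂, h₃⟩ := h k (by omega) s hx hy hJ
      have hlt : RExpr.val s.reg (.reg x) < RExpr.val s.reg (.reg y) := by
        simp only [RExpr.val, hx, hy, Nat.cast_lt]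
        omega
      refine (Det.loop_step (τ₁ := 1 + c.cost + 4) (τ₂ := 3 + m * (c.cost + 12)) hlt
        (((Det.of_simple (O := O) (Q := fun s' => s' = (c.ev s).setReg x (k + 1))
          (c := .seq c (.set x (.add (.reg x) (.const 1)))) ⟨hc, trivial⟩ ?_).mono ?_ ?_))).mono
          ?_ fun _ h => h
      · simp [Cmd.ev, RExpr.val, h₁]
      · simp only [Cmd.cost, RExpr.cost]
        push_cast
        linarith
      · rintro s' rfl
        refine ih (k + 1) (by omega) _ ?_ ?_ h₃
        · simp [Store.setReg]
        · simpa [Store.setReg, Function.update_of_ne hxy.symm] using h₂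
      · simp only [RExpr.cost]
        push_cast
        linarith
  refine (Det.seq (τ₁ := 2) (τ₂ := 3 + n * (c.cost + 12)) ((Det.of_simple (O := O)
    (Q := fun s' => s' = s.setReg x 0) (c := .set x (.const 0)) trivial ?_).mono ?_ ?_)).mono
    ?_ fun _ h => h
  · simp [Cmd.ev, RExpr.val]
  · simp [Cmd.cost, RExpr.cost]
  · rintro s' rfl
    refine key n 0 (by omega) _ ?_ ?_ h₀
    · simp [Store.setReg]
    · simpa [Store.setReg, Function.update_of_ne hxy.symm] using hn
  · nlinarith [(Nat.cast_nonneg c.cost : (0 : ℝ) ≤ c.cost)]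

end Det

/-! ### Building blocks of programs -/

def seqs (l : List Cmd) : Cmd := l.foldr .seq .skip

section Blocks

variable {d : ℕ} {Ctx : Type u}

@[simp] theorem seqs_nil : seqs [] = .skip := rfl

@[simp] theorem seqs_cons (c : Cmd) (l : List Cmd) : seqs (c :: l) = .seq c (seqs l) := rfl

@[simp] theorem ev_skip (s : Store Ctx) : Cmd.skip.ev s = s := rfl

@[simp] theorem ev_seq (c₁ c₂ : Cmd) (s : Store Ctx) : (Cmd.seq c₁ c₂).ev s = c₂.ev (c₁.ev s) :=
  rfl

theorem ev_seqs_append (l₁ l₂ : List Cmd) (s : Store Ctx) :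
    (seqs (l₁ ++ l₂)).ev s = (seqs l₂).ev ((seqs l₁).ev s) := by
  induction l₁ generalizing s with
  | nil => rfl
  | cons c l ih => simp [ih]

/-- The two memories agree on the registers below `b`, the tables outside `A` and the contexts. -/
def Same (b : ℕ) (A : Set ℕ) (s s' : Store Ctx) : Prop :=
  (∀ x < b, s'.reg x = s.reg x) ∧ (∀ a ∉ A, s'.tab a = s.tab a) ∧ s'.ctx = s.ctx

theorem Same.refl (b : ℕ) (A : Set ℕ) (s : Store Ctx) : Same b A s s :=
  ⟨fun _ _ => rfl, fun _ _ => rfl, rfl⟩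

theorem Same.trans {b : ℕ} {A : Set ℕ} {s₁ s₂ s₃ : Store Ctx} (h : Same b A s₁ s₂)
    (h' : Same b A s₂ s₃) : Same b A s₁ s₃ :=
  ⟨fun x hx => (h'.1 x hx).trans (h.1 x hx), fun a ha => (h'.2.1 a ha).trans (h.2.1 a ha),
    h'.2.2.trans h.2.2⟩

theorem Same.mono {b b' : ℕ} {A A' : Set ℕ} {s₁ s₂ : Store Ctx} (h : Same b A s₁ s₂)
    (hb : b' ≤ b) (hA : A ⊆ A') : Same b' A' s₁ s₂ :=
  ⟨fun x hx => h.1 x (hx.trans_le hb), fun a ha => h.2.1 a fun h => ha (hA h), h.2.2⟩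

theorem Same.setReg {b x : ℕ} (A : Set ℕ) (s : Store Ctx) (v : ℝ) (hx : b ≤ x) :
    Same b A s (s.setReg x v) :=
  ⟨fun y hy => Function.update_of_ne (by omega) _ _, fun _ _ => rfl, rfl⟩

/-- The command modifies only registers from `b` on and tables in `A`. -/
def Cmd.Within (b : ℕ) (A : Set ℕ) : Cmd → Prop
  | .skip => True
  | .set x _ | .load x _ _ => b ≤ x
  | .store a _ _ => a ∈ A
  | .seq c₁ c₂ | .ite _ _ c₁ c₂ => c₁.Within b A ∧ c₂.Within b A
  | _ => False

theorem Cmd.Within.same {b : ℕ} {A : Set ℕ} {c : Cmd} (h : c.Within b A) (s : Store Ctx) :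
    Same b A s (c.ev s) := by
  induction c generalizing s with
  | skip => exact Same.refl _ _ _
  | set | load => exact Same.setReg _ _ _ h
  | store a =>
    exact ⟨fun _ _ => rfl, fun a' ha' => Function.update_of_ne (by rintro rfl; exact ha' h) _ _, rfl⟩
  | seq c₁ c₂ h₁ h₂ => exact (h₁ h.1 s).trans (h₂ h.2 _)
  | ite e₁ e₂ c₁ c₂ h₁ h₂ =>
    by_cases hlt : e₁.val s.reg < e₂.val s.reg
    · simpa [Cmd.ev, hlt] using h₁ h.1 s
    · simpa [Cmd.ev, hlt] using h₂ h.2 s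
  | _ => exact h.elim

theorem Cmd.Within.simple {b : ℕ} {A : Set ℕ} {c : Cmd} (h : c.Within b A) : c.Simple := by
  induction c with
  | seq c₁ c₂ h₁ h₂ => exact ⟨h₁ h.1, h₂ h.2⟩
  | ite e₁ e₂ c₁ c₂ h₁ h₂ => exact ⟨h₁ h.1, h₂ h.2⟩
  | skip | set | load | store => trivial
  | _ => exact h.elim

theorem Cmd.Within.mono {b b' : ℕ} {A : Set ℕ} {c : Cmd} (h : c.Within b A) (hb : b' ≤ b) :
    c.Within b' A := by
  induction c with
  | seq c₁ c₂ h₁ h₂ => exact ⟨h₁ h.1, h₂ h.2⟩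
  | ite e₁ e₂ c₁ c₂ h₁ h₂ => exact ⟨h₁ h.1, h₂ h.2⟩
  | set | load => exact hb.trans h
  | skip => trivial
  | store => exact h
  | _ => exact h.elim

theorem within_seqs {b : ℕ} {A : Set ℕ} {l : List Cmd} (h : ∀ c ∈ l, c.Within b A) :
    (seqs l).Within b A := by
  induction l with
  | nil => trivial
  | cons c l ih => exact ⟨h c (by simp), ih fun c' hc' => h c' (by simp [hc'])⟩

/-! ### Rows of a table -/

/-- Row `i` of the table stores the weighted point `q`. -/
def RowAt (T : List ℤ → ℝ) (i : ℕ) (q : Pt d × ℕ) : Prop :=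
  (∀ k : Fin d, T [(i : ℤ), ((k : ℕ) : ℤ)] = q.1 k) ∧ T [(i : ℤ), (d : ℤ)] = q.2

/-- The registers from `b` on store the weighted point `q`. -/
def BufAt (ρ : ℕ → ℝ) (b : ℕ) (q : Pt d × ℕ) : Prop :=
  (∀ k : Fin d, ρ (b + k) = q.1 k) ∧ ρ (b + d) = q.2

theorem BufAt.congr {ρ ρ' : ℕ → ℝ} {b : ℕ} {q : Pt d × ℕ} (h : BufAt ρ b q)
    (h' : ∀ x, b ≤ x → x ≤ b + d → ρ' x = ρ x) : BufAt ρ' b q :=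
  ⟨fun k => (h' _ (by omega) (by omega)).trans (h.1 k), (h' _ (by omega) (by omega)).trans h.2⟩

/-- Load row `reg y` of table `a` into the registers from `b` on. -/
def loadRow (d a y b : ℕ) : Cmd :=
  seqs ((List.range (d + 1)).map fun k => .load (b + k) a [.reg y, .const k])

theorem within_loadRow (a y : ℕ) {b b' : ℕ} (A : Set ℕ) (h : b' ≤ b) :
    (loadRow d a y b).Within b' A := by
  refine within_seqs fun c hc => ?_
  obtain ⟨k, -, rfl⟩ := List.mem_map.1 hc
  exact h.trans (Nat.le_add_right _ _)

/-- The condition `y < b` ensures that loading does not overwrite the register that holds the row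
number. -/
theorem ev_loadRow (a y b : ℕ) (s : Store Ctx) (hy : y < b) :
    (loadRow d a y b).ev s = { s with
      reg := fun x => if b ≤ x ∧ x ≤ b + d then s.tab a [⌊s.reg y⌋, ((x - b : ℕ) : ℤ)]
        else s.reg x } := by
  have key : ∀ m : ℕ, (seqs ((List.range m).map fun k => .load (b + k) a [.reg y, .const k])).ev s =
      { s with
      reg := fun x => if b ≤ x ∧ x < b + m then s.tab a [⌊s.reg y⌋, ((x - b : ℕ) : ℤ)]
        else s.reg x } := by
    intro m
    induction m with
    | zero =>
      have : ∀ x, ¬ (b ≤ x ∧ x < b + 0) := by omega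
      simp only [this]
      simp
    | succ m ih =>
      rw [List.range_succ, List.map_append, ev_seqs_append, ih]
      simp only [List.map_cons, List.map_nil, seqs_cons, seqs_nil, ev_seq, Cmd.ev,
        Store.setReg, Store.key, RExpr.val, Store.mk.injEq, and_true]
      funext x
      by_cases hx : x = b + m
      · subst hx
        have : ¬ (b ≤ y ∧ y < b + m) := by omega
        simp [this]
      · rw [Function.update_of_ne hx]
        have : (b ≤ x ∧ x < b + m) ↔ (b ≤ x ∧ x < b + (m + 1)) := by omega
        simp [this]
  rw [loadRow, key]
  simp only [← Nat.lt_add_one_iff, add_assoc]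

theorem ev_loadRow_tab (a y b : ℕ) (s : Store Ctx) (hy : y < b) :
    ((loadRow d a y b).ev s).tab = s.tab := by
  rw [ev_loadRow a y b s hy]

theorem ev_loadRow_reg (a y b : ℕ) (s : Store Ctx) (hy : y < b) {x : ℕ} (hx : x < b ∨ b + d < x) :
    ((loadRow d a y b).ev s).reg x = s.reg x := by
  rw [ev_loadRow a y b s hy]
  exact if_neg (by omega)

theorem ev_loadRow_buf (a y b : ℕ) (s : Store Ctx) (hy : y < b) {i : ℕ} {q : Pt d × ℕ}
    (hi : s.reg y = i) (hq : RowAt (s.tab a) i q) :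
    BufAt ((loadRow d a y b).ev s).reg b q := by
  rw [ev_loadRow a y b s hy]
  refine ⟨fun k => ?_, ?_⟩
  · have : b ≤ b + (k : ℕ) ∧ b + (k : ℕ) ≤ b + d := by omega
    simp only [this, and_self, if_true, hi]
    simpa using hq.1 k
  · simpa [hi] using hq.2

/-- Store the registers from `b` on in row `reg y` of table `a`. -/
def storeRow (d b y a : ℕ) : Cmd :=
  seqs ((List.range (d + 1)).map fun k : ℕ => .store a [.reg y, .const k] (.reg (b + k)))

theorem within_storeRow (b y : ℕ) {a b' : ℕ} {A : Set ℕ} (h : a ∈ A) :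
    (storeRow d b y a).Within b' A := by
  refine within_seqs fun c hc => ?_
  obtain ⟨k, -, rfl⟩ := List.mem_map.1 hc
  exact h

/-- The last clause is what permits rewriting a table in place: all other rows survive. -/
theorem ev_storeRow (d b y a : ℕ) (s : Store Ctx) {j : ℕ} (hj : s.reg y = j) :
    ((storeRow d b y a).ev s).reg = s.reg ∧ ((storeRow d b y a).ev s).ctx = s.ctx ∧
    (∀ a' ≠ a, ((storeRow d b y a).ev s).tab a' = s.tab a') ∧
    (∀ k ≤ d, ((storeRow d b y a).ev s).tab a [(j : ℤ), (k : ℤ)] = s.reg (b + k)) ∧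
    ∀ l, l.head? ≠ some (j : ℤ) → ((storeRow d b y a).ev s).tab a l = s.tab a l := by
  have key : ∀ m : ℕ, ∀ s', s' = (seqs ((List.range m).map fun k : ℕ =>
      .store a [.reg y, .const k] (.reg (b + k)))).ev s →
      s'.reg = s.reg ∧ s'.ctx = s.ctx ∧ (∀ a' ≠ a, s'.tab a' = s.tab a') ∧
      (∀ k < m, s'.tab a [(j : ℤ), (k : ℤ)] = s.reg (b + k)) ∧
      ∀ l, l.head? ≠ some (j : ℤ) → s'.tab a l = s.tab a l := by
    intro m
    induction m with
    | zero =>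
      rintro s' rfl
      simp
    | succ m ih =>
      rintro s' rfl
      obtain ⟨h₁, h₂, h₃, h₄, h₅⟩ := ih _ rfl
      rw [List.range_succ, List.map_append, ev_seqs_append]
      generalize (seqs ((List.range m).map fun k : ℕ =>
        .store a [.reg y, .const k] (.reg (b + k)))).ev s = s₁ at *
      simp only [List.map_cons, List.map_nil, seqs_cons, seqs_nil, ev_seq, Cmd.ev,
        Store.setTab, Store.key, RExpr.val, h₁, hj]
      refine ⟨trivial, h₂, fun a' ha' => ?_, fun k hk => ?_, fun l hl => ?_⟩
      · rw [Function.update_of_ne ha', h₃ a' ha']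
      · rw [Function.update_self]
        by_cases hkm : k = m
        · subst hkm
          simp
        · rw [Function.update_of_ne (by simpa using hkm), h₄ k (by omega)]
      · rw [Function.update_self, Function.update_of_ne, h₅ l hl]
        rintro rfl
        simp at hl
  obtain ⟨h₁, h₂, h₃, h₄, h₅⟩ := key (d + 1) _ rfl
  exact ⟨h₁, h₂, h₃, fun k hk => h₄ k (by omega), h₅⟩

theorem RowAt.congr {T T' : List ℤ → ℝ} {i : ℕ} {q : Pt d × ℕ} (h : RowAt T i q)
    (h' : ∀ k : ℕ, T' [(i : ℤ), (k : ℤ)] = T [(i : ℤ), (k : ℤ)]) : RowAt T' i q :=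
  ⟨fun k => (h' _).trans (h.1 k), (h' _).trans h.2⟩

theorem ev_storeRow_same (b y a : ℕ) (s : Store Ctx) {j : ℕ} (hj : s.reg y = j) {q : Pt d × ℕ}
    (h : BufAt s.reg b q) : RowAt (((storeRow d b y a).ev s).tab a) j q := by
  obtain ⟨-, -, -, h₄, -⟩ := ev_storeRow d b y a s hj
  exact ⟨fun k => (h₄ _ k.2.le).trans (h.1 k), (h₄ _ le_rfl).trans h.2⟩

theorem ev_storeRow_other (b y a : ℕ) (s : Store Ctx) {i j : ℕ} (hj : s.reg y = j) (hij : i ≠ j)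
    {q : Pt d × ℕ} (h : RowAt (s.tab a) i q) : RowAt (((storeRow d b y a).ev s).tab a) i q := by
  obtain ⟨-, -, -, -, h₅⟩ := ev_storeRow d b y a s hj
  exact h.congr fun k => h₅ _ (by simpa using hij)

/-- The table stores the weighted points of the list. -/
def Holds (T : List ℤ → ℝ) (L : List (Pt d × ℕ)) : Prop :=
  ∀ i (h : i < L.length), RowAt T i L[i]

theorem Holds.points {s : Store Ctx} {a : ℕ} {L : List (Pt d × ℕ)} (h : Holds (s.tab a) L) :
    s.points d a L.length = L := by
  refine List.ext_getElem (by simp [Store.points]) fun i h₁ h₂ => ?_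
  obtain ⟨h₃, h₄⟩ := h i h₂
  simp only [Store.points, List.getElem_ofFn, h₃, h₄]
  ext <;> simp

theorem holds_pointTable (L : List (Pt d × ℕ)) : Holds (pointTable L) L := by
  refine fun i hi => ⟨fun k => ?_, ?_⟩
  · change (match L[i]? with
      | none => 0
      | some q => if h : (k : ℕ) < d then q.1 ⟨k, h⟩ else if (k : ℕ) = d then (q.2 : ℝ) else 0) = _
    simp [hi]
  · change (match L[i]? with
      | none => 0
      | some q => if h : d < d then q.1 ⟨d, h⟩ else if d = d then (q.2 : ℝ) else 0) = _
    simp [hi]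

/-! ### Distances and grid cells -/

def sumE (l : List RExpr) : RExpr := l.foldr .add (.const 0)

theorem val_sumE (ρ : ℕ → ℝ) (l : List RExpr) : (sumE l).val ρ = (l.map (RExpr.val ρ)).sum := by
  induction l with
  | nil => simp [sumE, RExpr.val]
  | cons e l ih => simpa [sumE, RExpr.val] using ih

/-- The squared distance of the points in the registers from `b` on and from `b'` on. -/
def sqDist (d b b' : ℕ) : RExpr :=
  sumE (List.ofFn fun k : Fin d => .mul (.sub (.reg (b + k)) (.reg (b' + k)))
    (.sub (.reg (b + k)) (.reg (b' + k))))

theorem val_sqDist {ρ : ℕ → ℝ} {b b' : ℕ} {q q' : Pt d × ℕ} (h : BufAt ρ b q)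
    (h' : BufAt ρ b' q') : (sqDist d b b').val ρ = dist q.1 q'.1 ^ 2 := by
  rw [sqDist, val_sumE, List.map_ofFn, List.sum_ofFn, EuclideanSpace.dist_eq,
    Real.sq_sqrt (Finset.sum_nonneg fun _ _ => sq_nonneg _)]
  refine Finset.sum_congr rfl fun k _ => ?_
  simp [RExpr.val, h.1 k, h'.1 k, Real.dist_eq, sq]

/-- The cell of a point in the grid of side length `σ`. -/
def cell (σ : ℝ) (p : Pt d) (k : Fin d) : ℤ := ⌊p k / σ⌋

/-- The table index with the first component `reg t` that belongs to the grid cell with offset `o`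
from the point in the registers from `b` on, where the side length of the grid is `reg σ`. -/
def cellKey (t σ b : ℕ) (o : Fin d → ℤ) : List RExpr :=
  .reg t :: List.ofFn fun k : Fin d => .add (.div (.reg (b + k)) (.reg σ)) (.const (o k))

theorem key_cellKey {s : Store Ctx} {t σ b N : ℕ} {q : Pt d × ℕ} (o : Fin d → ℤ)
    (hN : s.reg t = N) (h : BufAt s.reg b q) :
    s.key (cellKey t σ b o) = (N : ℤ) :: List.ofFn (cell (s.reg σ) q.1 + o) := by
  simp only [Store.key, cellKey, List.map_cons, RExpr.val, hN, Int.floor_natCast, List.map_ofFn]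
  congr 2
  funext k
  simp [RExpr.val, h.1 k, cell]

end Blocks

section Geometry

variable {d : ℕ}

/-! ### Grid cells -/

theorem abs_coord_sub_le (p q : Pt d) (k : Fin d) : |p k - q k| ≤ dist p q := by
  rw [← Real.dist_eq, EuclideanSpace.dist_eq]
  refine Real.le_sqrt_of_sq_le ?_
  exact Finset.single_le_sum (f := fun k => dist (p k) (q k) ^ 2) (fun _ _ => sq_nonneg _)
    (Finset.mem_univ k)

/-- The factor `d` instead of `√d` is lossy, but it keeps the constants that occur in the programs
rational. -/
theorem dist_le_mul (p q : Pt d) {t : ℝ} (ht : 0 ≤ t) (h : ∀ k, |p k - q k| ≤ t) :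
    dist p q ≤ d * t := by
  rw [EuclideanSpace.dist_eq]
  refine Real.sqrt_le_iff.2 ⟨by positivity, ?_⟩
  calc ∑ k, dist (p k) (q k) ^ 2 ≤ ∑ _k : Fin d, t ^ 2 := by
        refine Finset.sum_le_sum fun k _ => ?_
        rw [Real.dist_eq]
        exact pow_le_pow_left₀ (abs_nonneg _) (h k) 2
    _ = d * t ^ 2 := by simp
    _ ≤ (d * t) ^ 2 := by
        rw [mul_pow]
        gcongr
        exact_mod_cast Nat.le_self_pow two_ne_zero d

theorem dist_le_of_cell {σ : ℝ} (hσ : 0 < σ) {p q : Pt d} {R : ℤ} (hR : 0 ≤ R)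
    (h : ∀ k, |cell σ p k - cell σ q k| ≤ R) : dist p q ≤ d * ((R + 1) * σ) := by
  have hR' : (0 : ℝ) ≤ R := by exact_mod_cast hR
  refine dist_le_mul p q (by positivity) fun k => ?_
  have h₁ := abs_le.1 (h k)
  simp only [cell] at h₁
  have h₂ : ((⌊p k / σ⌋ : ℤ) : ℝ) - ⌊q k / σ⌋ ≤ R := by exact_mod_cast h₁.2
  have h₃ : (-R : ℝ) ≤ (⌊p k / σ⌋ : ℤ) - ⌊q k / σ⌋ := by exact_mod_cast h₁.1
  have h₄ := Int.floor_le (p k / σ)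
  have h₅ := Int.lt_floor_add_one (p k / σ)
  have h₆ := Int.floor_le (q k / σ)
  have h₇ := Int.lt_floor_add_one (q k / σ)
  have h₈ : |p k / σ - q k / σ| ≤ R + 1 := abs_le.2 ⟨by linarith, by linarith⟩
  rwa [← sub_div, abs_div, abs_of_pos hσ, div_le_iff₀ hσ] at h₈

theorem cell_of_dist_le {σ : ℝ} (hσ : 0 < σ) {p q : Pt d} {R : ℕ} (h : dist p q ≤ R * σ)
    (k : Fin d) : |cell σ p k - cell σ q k| ≤ R := by
  have h₁ : |p k / σ - q k / σ| ≤ R := by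
    rw [← sub_div, abs_div, abs_of_pos hσ, div_le_iff₀ hσ]
    exact (abs_coord_sub_le p q k).trans h
  rw [abs_le] at h₁ ⊢
  simp only [cell]
  constructor
  · have : ⌊q k / σ⌋ ≤ ⌊p k / σ + R⌋ := Int.floor_le_floor (by linarith)
    rw [Int.floor_add_natCast] at this
    linarith
  · have : ⌊p k / σ⌋ ≤ ⌊q k / σ + R⌋ := Int.floor_le_floor (by linarith)
    rw [Int.floor_add_natCast] at this
    linarith

/-- The offsets with components between `-R` and `R`. -/
def offsets (d R : ℕ) : List (Fin d → ℤ) :=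
  (Fintype.piFinset fun _ : Fin d => Finset.Icc (-(R : ℤ)) R).toList

theorem mem_offsets {R : ℕ} {o : Fin d → ℤ} : o ∈ offsets d R ↔ ∀ k, |o k| ≤ R := by
  simp [offsets, abs_le]

/-! ### Lists of weighted points -/

/-- The weighted set with the points of the list. -/
def ofList (L : List (Pt d × ℕ)) : WSet d := (L.map fun q => Finsupp.single q.1 q.2).sum

@[simp] theorem ofList_nil : ofList ([] : List (Pt d × ℕ)) = 0 := rfl

theorem ofList_append (L L' : List (Pt d × ℕ)) : ofList (L ++ L') = ofList L + ofList L' := by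
  simp [ofList]

@[simp] theorem ofList_cons (q : Pt d × ℕ) (L : List (Pt d × ℕ)) :
    ofList (q :: L) = Finsupp.single q.1 q.2 + ofList L := by
  simp [ofList]

theorem ofList_eq_zero {L : List (Pt d × ℕ)} {p : Pt d} (h : p ∉ L.map Prod.fst) :
    ofList L p = 0 := by
  induction L with
  | nil => rfl
  | cons q L ih =>
    simp only [List.map_cons, List.mem_cons, not_or] at h
    rw [ofList_cons, Finsupp.add_apply, ih h.2, Finsupp.single_apply, if_neg (Ne.symm h.1)]

theorem ofList_apply {L : List (Pt d × ℕ)} (h : (L.map Prod.fst).Nodup) {q : Pt d × ℕ}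
    (hq : q ∈ L) : ofList L q.1 = q.2 := by
  induction L with
  | nil => simp at hq
  | cons q' L ih =>
    rw [List.map_cons, List.nodup_cons] at h
    rw [ofList_cons, Finsupp.add_apply]
    rcases List.mem_cons.1 hq with rfl | hq
    · rw [ofList_eq_zero h.1]
      simp
    · have : q'.1 ≠ q.1 := fun e => h.1 (e ▸ List.mem_map_of_mem hq)
      rw [ih h.2 hq, Finsupp.single_apply, if_neg this, zero_add]

theorem enumerates_ofList {L : List (Pt d × ℕ)} (h : (L.map Prod.fst).Nodup)
    (hpos : ∀ q ∈ L, 0 < q.2) : Enumerates L (ofList L) := by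
  refine ⟨h, fun p w => ⟨fun hq => ?_, ?_⟩⟩
  · have h₁ := ofList_apply h hq
    have h₂ := hpos _ hq
    simp only at h₁ h₂
    exact ⟨Finsupp.mem_support_iff.2 (by omega), h₁⟩
  · rintro ⟨hp, rfl⟩
    rw [Finsupp.mem_support_iff] at hp
    by_cases hm : p ∈ L.map Prod.fst
    · obtain ⟨q, hq, rfl⟩ := List.mem_map.1 hm
      rwa [ofList_apply h hq]
    · exact (hp (ofList_eq_zero hm)).elim

variable {L : List (Pt d × ℕ)} {P : WSet d}

theorem Enumerates.pos (h : Enumerates L P) {q : Pt d × ℕ} (hq : q ∈ L) : 0 < q.2 := by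
  obtain ⟨h₁, h₂⟩ := (h.2 q.1 q.2).1 hq
  rw [← h₂]
  exact Nat.pos_of_ne_zero (Finsupp.mem_support_iff.1 h₁)

theorem Enumerates.mem_support (h : Enumerates L P) {p : Pt d} :
    p ∈ P.support ↔ p ∈ L.map Prod.fst := by
  constructor
  · exact fun hp => List.mem_map.2 ⟨(p, P p), (h.2 _ _).2 ⟨hp, rfl⟩, rfl⟩
  · intro hp
    obtain ⟨q, hq, rfl⟩ := List.mem_map.1 hp
    exact ((h.2 _ _).1 hq).1

theorem Enumerates.eq_ofList (h : Enumerates L P) : P = ofList L := by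
  ext p
  by_cases hp : p ∈ P.support
  · exact (ofList_apply h.1 ((h.2 p (P p)).2 ⟨hp, rfl⟩)).symm
  · rw [ofList_eq_zero (fun h' => hp (h.mem_support.2 h')), Finsupp.notMem_support_iff.1 hp]

open Classical in
theorem Enumerates.toFinset (h : Enumerates L P) : (L.map Prod.fst).toFinset = P.support := by
  ext p
  rw [List.mem_toFinset, h.mem_support]

theorem Enumerates.length_eq (h : Enumerates L P) : L.length = size P := by
  classical
  rw [size, ← h.toFinset, List.toFinset_card_of_nodup h.1, List.length_map]

theorem Enumerates.sum_range (h : Enumerates L P) (g : Pt d → ℝ) (X : ℕ → ℝ)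
    (hX : ∀ i (hi : i < L.length), X i = g L[i].1) :
    ∑ i ∈ Finset.range L.length, X i = ∑ p ∈ P.support, g p := by
  classical
  rw [← h.toFinset, List.sum_toFinset _ h.1, Finset.sum_range, List.map_map, ← List.sum_ofFn]
  congr 1
  refine List.ext_getElem (by simp) fun i h₁ h₂ => ?_
  simp [hX i (by simpa using h₁)]

open Classical in
/-- The `r`-close points of a list. -/
def closeList (L : List (Pt d × ℕ)) (r : ℝ) : List (Pt d × ℕ) :=
  L.filter fun q => ∃ q' ∈ L, q'.1 ≠ q.1 ∧ dist q.1 q'.1 < r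

theorem Enumerates.closePts (h : Enumerates L P) (r : ℝ) :
    Enumerates (closeList L r) (closePts P r) := by
  refine ⟨h.1.sublist ((List.filter_sublist).map _), fun p w => ?_⟩
  have key : (∃ q' ∈ L, q'.1 ≠ p ∧ dist p q'.1 < r) ↔ ∃ q ∈ P.support, q ≠ p ∧ dist p q < r := by
    constructor
    · rintro ⟨q', hq', h'⟩
      exact ⟨q'.1, ((h.2 _ _).1 hq').1, h'⟩
    · rintro ⟨q, hq, h'⟩
      exact ⟨(q, P q), (h.2 _ _).2 ⟨hq, rfl⟩, h'⟩
  rw [closeList, List.mem_filter, h.2, NiceDistance.closePts, Finsupp.support_filter,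
    Finset.mem_filter]
  simp only [decide_eq_true_eq, key]
  constructor
  · rintro ⟨⟨h₁, h₂⟩, h₃⟩
    exact ⟨⟨h₁, h₃⟩, (if_pos h₃).trans h₂⟩
  · rintro ⟨⟨h₁, h₃⟩, h₂⟩
    exact ⟨⟨h₁, (if_pos h₃).symm.trans h₂⟩, h₃⟩

/-! ### Nearest neighbours -/

/-- The distance from `p` to the nearest other point of `S` is `r`. -/
def IsNearest (S : Finset (Pt d)) (p : Pt d) (r : ℝ) : Prop :=
  (∃ q ∈ S, q ≠ p ∧ dist p q = r) ∧ ∀ q ∈ S, q ≠ p → r ≤ dist p q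

theorem IsNearest.unique {S : Finset (Pt d)} {p : Pt d} {r r' : ℝ} (h : IsNearest S p r)
    (h' : IsNearest S p r') : r = r' := by
  obtain ⟨⟨q, hq, hqp, rfl⟩, h₁⟩ := h
  obtain ⟨⟨q', hq', hqp', rfl⟩, h₂⟩ := h'
  exact le_antisymm (h₁ _ hq' hqp') (h₂ _ hq hqp)

theorem exists_nearest {S : Finset (Pt d)} (hS : 1 < S.card) :
    ∃ δ : Pt d → ℝ, ∀ p ∈ S, IsNearest S p (δ p) := by
  have : ∀ p, ∃ r, p ∈ S → IsNearest S p r := by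
    intro p
    by_cases hp : p ∈ S
    · classical
      have hne : (S.erase p).Nonempty := by
        rw [← Finset.card_pos, Finset.card_erase_of_mem hp]
        omega
      obtain ⟨q, hq, hmin⟩ := Finset.exists_min_image (S.erase p) (fun q => dist p q) hne
      rw [Finset.mem_erase] at hq
      exact ⟨_, fun _ => ⟨⟨q, hq.2, hq.1, rfl⟩, fun q' hq' hne =>
        hmin q' (Finset.mem_erase.2 ⟨hne, hq'⟩)⟩⟩
    · exact ⟨0, fun h => (hp h).elim⟩
  choose δ hδ using this
  exact ⟨δ, hδ⟩

open Classical in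
/-- The smaller one of the numbers of points whose nearest neighbour distance is at least and at
most that of `p`. -/
def rank (S : Finset (Pt d)) (δ : Pt d → ℝ) (p : Pt d) : ℕ :=
  min (S.filter fun q => δ p ≤ δ q).card (S.filter fun q => δ q ≤ δ p).card

theorem rank_pos {S : Finset (Pt d)} (δ : Pt d → ℝ) {p : Pt d} (hp : p ∈ S) : 0 < rank S δ p := by
  classical
  exact lt_min (Finset.card_pos.2 ⟨p, by simp [hp]⟩) (Finset.card_pos.2 ⟨p, by simp [hp]⟩)

/-- Count the triples with `δ a ≤ δ b ≤ δ c`. A fixed `b` is the middle of a product of two counts,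
one of which is the rank of `b` while the other is at most `S.card`. -/
theorem card_sq_le_sum_rank (S : Finset (Pt d)) (δ : Pt d → ℝ) :
    S.card ^ 2 ≤ 6 * ∑ p ∈ S, rank S δ p := by
  classical
  let I (a b c : Pt d) : ℕ := if δ a ≤ δ b ∧ δ b ≤ δ c then 1 else 0
  have h₁ : ∀ b ∈ S, ∑ a ∈ S, ∑ c ∈ S, I a b c ≤ S.card * rank S δ b := by
    intro b _
    have : ∑ a ∈ S, ∑ c ∈ S, I a b c =
        (S.filter fun q => δ q ≤ δ b).card * (S.filter fun q => δ b ≤ δ q).card := by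
      rw [Finset.card_filter, Finset.card_filter, Finset.sum_mul_sum]
      refine Finset.sum_congr rfl fun a _ => Finset.sum_congr rfl fun c _ => ?_
      by_cases h₁ : δ a ≤ δ b <;> by_cases h₂ : δ b ≤ δ c <;> simp [I, h₁, h₂]
    rw [this, rank]
    have h₂ := Finset.card_filter_le S fun q => δ q ≤ δ b
    have h₃ := Finset.card_filter_le S fun q => δ b ≤ δ q
    rcases le_total (S.filter fun q => δ b ≤ δ q).card (S.filter fun q => δ q ≤ δ b).card
      with h | h
    · rw [min_eq_left h]
      exact Nat.mul_le_mul_right _ h₂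
    · rw [min_eq_right h, mul_comm]
      exact Nat.mul_le_mul_right _ h₃
  set A := ∑ a ∈ S, ∑ b ∈ S, ∑ c ∈ S, I a b c with hA
  have h₂ : A ≤ S.card * ∑ p ∈ S, rank S δ p := by
    rw [hA, Finset.sum_comm, Finset.mul_sum]
    exact Finset.sum_le_sum h₁
  -- Every triple is monotone in at least one of its six orders, and relabelling the summation
  -- variables shows that each order contributes the same sum `A`.
  have h₃ : S.card ^ 3 ≤ 6 * A := by
    have e₁ : ∑ a ∈ S, ∑ b ∈ S, ∑ c ∈ S, I a c b = A :=
      Finset.sum_congr rfl fun a _ => Finset.sum_comm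
    have e₂ : ∑ a ∈ S, ∑ b ∈ S, ∑ c ∈ S, I b a c = A := Finset.sum_comm
    have e₃ : ∑ a ∈ S, ∑ b ∈ S, ∑ c ∈ S, I b c a = A := by
      rw [Finset.sum_comm, ← e₁]
    have e₄ : ∑ a ∈ S, ∑ b ∈ S, ∑ c ∈ S, I c a b = A := by
      rw [← e₂, Finset.sum_congr rfl fun a _ => Finset.sum_comm]
    have e₅ : ∑ a ∈ S, ∑ b ∈ S, ∑ c ∈ S, I c b a = A := by
      rw [← e₃, Finset.sum_congr rfl fun a _ => Finset.sum_comm]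
    have e₆ : S.card ^ 3 = ∑ a ∈ S, ∑ b ∈ S, ∑ c ∈ S, 1 := by
      simp [pow_succ, mul_assoc]
    have : ∑ a ∈ S, ∑ b ∈ S, ∑ c ∈ S, 1 ≤ ∑ a ∈ S, ∑ b ∈ S, ∑ c ∈ S,
        (I a b c + I a c b + I b a c + I b c a + I c a b + I c b a) := by
      refine Finset.sum_le_sum fun a _ => Finset.sum_le_sum fun b _ => Finset.sum_le_sum
        fun c _ => ?_
      rcases le_total (δ a) (δ b) with h | h <;> rcases le_total (δ b) (δ c) with h' | h' <;>
        rcases le_total (δ a) (δ c) with h'' | h'' <;> simp only [I, h, h', h''] <;> simp <;> omega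
    simp only [Finset.sum_add_distrib] at this
    omega
  rcases Nat.eq_zero_or_pos S.card with h | h
  · simp [h]
  · refine Nat.le_of_mul_le_mul_left ?_ h
    calc S.card * S.card ^ 2 = S.card ^ 3 := by ring
      _ ≤ 6 * A := h₃
      _ ≤ 6 * (S.card * ∑ p ∈ S, rank S δ p) := by gcongr
      _ = _ := by ring

/-- A surviving point has a neighbour closer than `δ p`, so all points counted in the first set of
the rank disappear. -/
theorem size_closePts_add_rank_le {δ : Pt d → ℝ} (hδ : ∀ p ∈ P.support, IsNearest P.support p (δ p))
    (p : Pt d) : size (closePts P (δ p)) + rank P.support δ p ≤ size P := by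
  classical
  have h : (closePts P (δ p)).support ⊆ P.support.filter fun q => ¬ δ p ≤ δ q := by
    intro q hq
    rw [closePts, Finsupp.support_filter, Finset.mem_filter] at hq
    obtain ⟨hq, q', hq', hne, hlt⟩ := hq
    refine Finset.mem_filter.2 ⟨hq, not_le.2 (((hδ q hq).2 q' hq' hne).trans_lt hlt)⟩
  have h₁ := Finset.card_le_card h
  have h₂ := Finset.card_filter_add_card_filter_not (s := P.support) (fun q => δ p ≤ δ q)
  have h₃ : rank P.support δ p ≤ (P.support.filter fun q => δ p ≤ δ q).card := min_le_left _ _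
  simp only [size]
  omega

/-- Let `A` be the points with `δ q ≤ δ p`. If such a point survives in the separated set `T`, its
nearest neighbour does not; and two survivors cannot share a neighbour within `δ p`, because they
are more than `2 * δ p` apart. Thus both `A ∩ T` and `A \ T` have at most as many elements as `S \
T`. -/
theorem two_mul_card_add_rank_le {S T : Finset (Pt d)} {δ : Pt d → ℝ}
    (hδ : ∀ p ∈ S, IsNearest S p (δ p)) {p : Pt d} (hT : T ⊆ S) (h₀ : 0 ≤ δ p)
    (hsep : ∀ q ∈ T, ∀ q' ∈ T, q ≠ q' → 2 * δ p < dist q q') :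
    2 * T.card + rank S δ p ≤ 2 * S.card := by
  classical
  set A := S.filter fun q => δ q ≤ δ p with hA
  have h₁ : rank S δ p ≤ A.card := min_le_right _ _
  have h₂ : (A ∩ T).card ≤ (S \ T).card := by
    have : ∀ q ∈ A ∩ T, ∃ q' ∈ S \ T, q' ≠ q ∧ dist q q' ≤ δ p := by
      intro q hq
      rw [Finset.mem_inter, hA, Finset.mem_filter] at hq
      obtain ⟨⟨q', hq', hne, heq⟩, -⟩ := hδ q hq.1.1
      refine ⟨q', Finset.mem_sdiff.2 ⟨hq', fun h => ?_⟩, hne, heq.trans_le hq.1.2⟩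
      have := hsep q hq.2 q' h hne.symm
      have := hq.1.2
      linarith
    choose! g hg using this
    refine Finset.card_le_card_of_injOn g (fun q hq => (hg q hq).1) fun q hq q' hq' h => ?_
    by_contra hne
    have h₁ := (hg q hq).2.2
    have h₂ := (hg q' hq').2.2
    rw [← h] at h₂
    have h₃ := hsep q (Finset.mem_inter.1 hq).2 q' (Finset.mem_inter.1 hq').2 hne
    have h₄ := dist_triangle_right q q' (g q)
    linarith
  have h₃ : (A \ T).card ≤ (S \ T).card :=
    Finset.card_le_card (Finset.sdiff_subset_sdiff (Finset.filter_subset _ _) subset_rfl)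
  have h₄ := Finset.card_inter_add_card_sdiff A T
  have h₅ := Finset.card_sdiff_add_card_eq_card hT
  omega

end Geometry

/-! ### Copying the input and computing a nearest neighbour distance -/

section Loops

variable {d : ℕ} {Ctx : Type u} {O : Procedures d Ctx} {s : Store Ctx} {Q : Store Ctx → Prop}

theorem Det.simple_seq {c₁ c₂ : Cmd} {τ : ℝ} (h₁ : c₁.Simple) (h₂ : Det O c₂ (c₁.ev s) τ Q) :
    Det O (.seq c₁ c₂) s (1 + c₁.cost + τ) Q :=
  Det.seq (Det.of_simple h₁ h₂)

/-- Copy the input points to table `1`. -/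
def copyBody (d : ℕ) : Cmd := .seq (loadRow d 0 10 16) (storeRow d 16 10 1)

theorem within_copyBody : (copyBody d).Within 11 {1} :=
  ⟨within_loadRow _ _ _ (by norm_num), within_storeRow _ _ rfl⟩

theorem Det.copy {L : List (Pt d × ℕ)} (hn : s.reg 0 = L.length) (hL : Holds (s.tab 0) L) :
    Det O (countLoop 10 0 (copyBody d)) s ((L.length + 1) * ((copyBody d).cost + 12)) fun s' =>
      Same 10 {1} s s' ∧ Holds (s'.tab 1) L := by
  refine (Det.forLoop (by norm_num) within_copyBody.simple (fun k s' => Same 10 {1} s s' ∧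
    ∀ i (h : i < L.length), i < k → RowAt (s'.tab 1) i L[i]) hn ?_ ?_).mono le_rfl ?_
  · exact ⟨Same.setReg _ _ _ le_rfl, by simp⟩
  · rintro k hk s₁ hx hy ⟨h₁, h₂⟩
    have hs := (within_copyBody (d := d)).same s₁
    refine ⟨(hs.1 _ (by norm_num)).trans hx, (hs.1 _ (by norm_num)).trans hy,
      (h₁.trans (hs.mono (by norm_num) subset_rfl)).trans (Same.setReg _ _ _ le_rfl), ?_⟩
    intro i hi hik
    have h₀ : RowAt (s₁.tab 0) k L[k] := by
      rw [h₁.2.1 0 (by simp)]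
      exact hL k hk
    have hb := ev_loadRow_buf (d := d) 0 10 16 s₁ (by norm_num) hx h₀
    have hr := (ev_loadRow_reg (d := d) 0 10 16 s₁ (by norm_num) (x := 10) (by norm_num)).trans hx
    change RowAt (((storeRow d 16 10 1).ev ((loadRow d 0 10 16).ev s₁)).tab 1) i L[i]
    by_cases hik' : i = k
    · subst hik'
      exact ev_storeRow_same 16 10 1 _ hr hb
    · refine ev_storeRow_other 16 10 1 _ hr hik' ?_
      rw [ev_loadRow_tab _ _ _ _ (by norm_num)]
      exact h₂ i hi (by omega)
  · rintro s' ⟨-, h₁, h₂⟩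
    exact ⟨h₁, fun i hi => h₂ i hi hi⟩

/-- Update the minimal squared distance in register `13` from the point in the registers from `16`
on to the other points. -/
def nearestBody (d : ℕ) : Cmd :=
  .seq (loadRow d 1 10 (17 + d))
    (.ite (.const 0) (sqDist d 16 (17 + d))
      (.ite (sqDist d 16 (17 + d)) (.reg 13) (.set 13 (sqDist d 16 (17 + d)))
        (.ite (.reg 13) (.const 0) (.set 13 (sqDist d 16 (17 + d))) .skip)) .skip)

theorem within_nearestBody : (nearestBody d).Within 11 ∅ :=
  ⟨within_loadRow _ _ _ (by omega), ⟨by simp [Cmd.Within], by simp [Cmd.Within]⟩⟩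

/-- Compute in register `4` the distance from the point with number `reg 9` to the other points. -/
def nearestCmd (d : ℕ) : Cmd :=
  .seq (loadRow d 1 9 16) (.seq (.set 13 (.const (-1)))
    (.seq (countLoop 10 2 (nearestBody d)) (.set 4 (.sqrt (.reg 13)))))

/-- Register `13` starts at `-1`, meaning that no other point has been seen. The point itself is
skipped by the test for a positive squared distance. -/
theorem Det.nearest {L : List (Pt d × ℕ)} {P : WSet d} (hE : Enumerates L P)
    (hn : s.reg 2 = L.length) (hL : Holds (s.tab 1) L) (h2 : 1 < L.length) {p : ℕ}
    (hp : p < L.length) (h9 : s.reg 9 = p) :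
    Det O (nearestCmd d) s (5 + (loadRow d 1 9 16).cost + 2 +
      (L.length + 1) * ((nearestBody d).cost + 12) + 3) fun s' =>
      ∃ r, IsNearest P.support L[p].1 r ∧ Same 10 ∅ (s.setReg 4 r) s' := by
  set q := L[p] with hq
  set s₀ := (Cmd.set 13 (.const (-1))).ev ((loadRow d 1 9 16).ev s) with hs₀
  have hsame₀ : Same 10 ∅ s s₀ := ((within_loadRow 1 9 ∅ (by norm_num)).same s).trans
    (Same.setReg _ _ _ (by norm_num))
  have hb₀ : BufAt s₀.reg 16 q :=
    (ev_loadRow_buf (d := d) 1 9 16 s (by norm_num) h9 (hL p hp)).congr fun x hx _ =>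
      Function.update_of_ne (by omega) _ _
  have hloop := Det.forLoop (O := O) (x := 10) (y := 2) (n := L.length) (s := s₀) (by norm_num)
    (within_nearestBody (d := d)).simple
    (fun k s' => Same 10 ∅ s s' ∧ BufAt s'.reg 16 q ∧
      ((s'.reg 13 = -1 ∧ ∀ i (h : i < L.length), i < k → L[i].1 = q.1) ∨
        ((∃ i, ∃ h : i < L.length, L[i].1 ≠ q.1 ∧ s'.reg 13 = dist q.1 L[i].1 ^ 2) ∧
          ∀ i (h : i < L.length), i < k → L[i].1 ≠ q.1 → s'.reg 13 ≤ dist q.1 L[i].1 ^ 2)))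
    (by rw [hsame₀.1 2 (by norm_num), hn])
    ⟨hsame₀.trans (Same.setReg _ _ _ le_rfl), hb₀.congr fun x hx _ =>
      Function.update_of_ne (by omega) _ _, Or.inl ⟨by simp [hs₀, Store.setReg, Cmd.ev, RExpr.val], by simp⟩⟩ ?_
  · refine (Det.simple_seq (within_loadRow 1 9 ∅ (le_refl 16)).simple (Det.simple_seq
      (c₁ := .set 13 (.const (-1))) trivial (Det.seq (τ₂ := 3) (hloop.mono le_rfl ?_)))).mono ?_
      fun _ h => h
    · rintro s' ⟨-, hs', -, h⟩
      refine (Det.of_simple (c := .set 4 (.sqrt (.reg 13))) trivial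
        ⟨√(s'.reg 13), ?_, ?_⟩).mono (by norm_num [Cmd.cost, RExpr.cost]) fun _ h => h
      · have hmem : ∀ q' ∈ P.support, ∃ i, ∃ h : i < L.length, L[i].1 = q' := by
          intro q' hq'
          obtain ⟨q'', h₁, rfl⟩ := List.mem_map.1 (hE.mem_support.1 hq')
          obtain ⟨i, hi, rfl⟩ := List.getElem_of_mem h₁
          exact ⟨i, hi, rfl⟩
        -- The first alternative would mean that every listed point equals the chosen one, which
        -- distinctness of at least two points excludes.
        rcases h with ⟨-, h⟩ | ⟨⟨i, hi, hne, heq⟩, h⟩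
        · exfalso
          obtain ⟨j, hj, hjp⟩ : ∃ j, j < L.length ∧ j ≠ p := by
            by_cases h0 : p = 0
            · exact ⟨1, h2, by omega⟩
            · exact ⟨0, by omega, by omega⟩
          refine hjp ((List.Nodup.getElem_inj_iff hE.1 (hi := by simpa using hj)
            (hj := by simpa using hp)).1 ?_)
          simpa using h j hj hj
        · rw [heq, Real.sqrt_sq dist_nonneg]
          refine ⟨⟨L[i].1, ?_, hne, rfl⟩, fun q' hq' hne' => ?_⟩
          · exact hE.mem_support.2 (List.mem_map_of_mem (List.getElem_mem hi))
          · obtain ⟨j, hj, rfl⟩ := hmem q' hq'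
            have := h j hj hj hne'
            rw [heq] at this
            exact (pow_le_pow_iff_left₀ dist_nonneg dist_nonneg two_ne_zero).1 this
      · refine ⟨fun x hx => ?_, fun a ha => hs'.2.1 a ha, hs'.2.2⟩
        simp only [Cmd.ev, Store.setReg, RExpr.val]
        by_cases hx4 : x = 4
        · simp [hx4]
        · rw [Function.update_of_ne hx4, Function.update_of_ne hx4, hs'.1 x hx]
    · simp only [Cmd.cost, RExpr.cost]
      push_cast
      linarith
  · rintro k hk s₁ hx hy ⟨h₁, h₂, h₃⟩
    have hs := (within_nearestBody (d := d)).same s₁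
    have h₀ : RowAt (s₁.tab 1) k L[k] := by
      rw [h₁.2.1 1 (by simp)]
      exact hL k hk
    set s₂ := (loadRow d 1 10 (17 + d)).ev s₁ with hs₂
    have hB : BufAt s₂.reg (17 + d) L[k] := ev_loadRow_buf 1 10 (17 + d) s₁ (by omega) hx h₀
    have hr : ∀ x < 17 + d, s₂.reg x = s₁.reg x := fun x hx =>
      ev_loadRow_reg 1 10 (17 + d) s₁ (by omega) (Or.inl hx)
    have hA : BufAt s₂.reg 16 q := h₂.congr fun x _ _ => hr x (by omega)
    have hv := val_sqDist hA hB
    have hev : ∃ v, (nearestBody d).ev s₁ = s₂.setReg 13 v ∧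
        ((L[k].1 = q.1 ∧ v = s₁.reg 13) ∨ (L[k].1 ≠ q.1 ∧ (v = s₁.reg 13 ∨ v = dist q.1 L[k].1 ^ 2)
          ∧ v ≤ dist q.1 L[k].1 ^ 2 ∧ 0 ≤ v ∧ (v ≤ s₁.reg 13 ∨ s₁.reg 13 < 0))) := by
      -- An untouched memory is written as an assignment of the old value, so that all branches have
      -- the same form.
      have hself : s₂ = s₂.setReg 13 (s₁.reg 13) := by
        rw [← hr 13 (by omega), Store.setReg, Function.update_eq_self]
      simp only [nearestBody, ev_seq, ← hs₂, Cmd.ev, hv, RExpr.val, hr 13 (by omega : 13 < 17 + d)]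
      by_cases hne : L[k].1 = q.1
      · exact ⟨s₁.reg 13, by simpa [hne] using hself, Or.inl ⟨hne, rfl⟩⟩
      · have hpos : 0 < dist q.1 L[k].1 ^ 2 := by
          have := dist_pos.2 (Ne.symm hne)
          positivity
        by_cases hlt : dist q.1 L[k].1 ^ 2 < s₁.reg 13
        · exact ⟨_, by simp [hpos, hlt], Or.inr ⟨hne, Or.inr rfl, le_rfl, hpos.le, Or.inl hlt.le⟩⟩
        · by_cases hneg : s₁.reg 13 < 0
          · exact ⟨_, by simp [hpos, hlt, hneg],
              Or.inr ⟨hne, Or.inr rfl, le_rfl, hpos.le, Or.inr hneg⟩⟩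
          · exact ⟨s₁.reg 13, by simpa [hpos, hlt, hneg] using hself,
              Or.inr ⟨hne, Or.inl rfl, not_lt.1 hlt, not_lt.1 hneg, Or.inl le_rfl⟩⟩
    refine ⟨(hs.1 _ (by norm_num)).trans hx, (hs.1 _ (by norm_num)).trans hy,
      (h₁.trans (hs.mono (by norm_num) subset_rfl)).trans (Same.setReg _ _ _ le_rfl), ?_⟩
    obtain ⟨v, hev, hv⟩ := hev
    have hv13 : (((nearestBody d).ev s₁).setReg 10 (k + 1)).reg 13 = v := by
      simp [hev, Store.setReg]
    rw [hv13]
    refine ⟨?_, ?_⟩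
    · rw [hev]
      exact hA.congr fun x hx _ => by
        simp only [Store.setReg]
        rw [Function.update_of_ne (by omega), Function.update_of_ne (by omega)]
    · have hsucc : ∀ i (h : i < L.length), i < k + 1 → i < k ∨ L[i] = L[k] := by
        intro i _ hik
        rcases Nat.lt_succ_iff_lt_or_eq.1 hik with h | rfl
        · exact Or.inl h
        · exact Or.inr rfl
      rcases hv with ⟨he, rfl⟩ | ⟨hne, hv, hle, hnn, hcmp⟩
      · refine h₃.imp (fun h => ⟨h.1, fun i hi hik => ?_⟩) fun h => ⟨h.1, fun i hi hik hne => ?_⟩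
        · rcases hsucc i hi hik with h' | h'
          · exact h.2 i hi h'
          · rw [h', he]
        · rcases hsucc i hi hik with h' | h'
          · exact h.2 i hi h' hne
          · exact absurd (by rw [h', he]) hne
      · refine Or.inr ⟨?_, fun i hi hik hne' => ?_⟩
        · rcases hv with rfl | rfl
          · rcases h₃ with h | h
            · linarith [h.1]
            · exact h.1
          · exact ⟨k, hk, hne, rfl⟩
        · rcases hsucc i hi hik with h' | h'
          · rcases h₃ with h | h
            · exact absurd (h.2 i hi h') hne'
            · have := h.2 i hi h' hne'
              rcases hcmp with h'' | h''
              · exact h''.trans this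
              · obtain ⟨j, hj, -, h₄⟩ := h.1
                rw [h₄] at h''
                exact absurd h'' (not_lt.2 (sq_nonneg _))
          · rw [h']
            exact hle

end Loops

section Prune

variable {d : ℕ} {Ctx : Type u} {O : Procedures d Ctx} {s : Store Ctx} {Q : Store Ctx → Prop}

/-! ### Time stamps of hash tables -/

/-- In the tables from `2` on only entries with first index component `N` have changed. -/
def Stamped (N : ℤ) (s s' : Store Ctx) : Prop :=
  ∀ a, 1 < a → ∀ z l, z ≠ N → s'.tab a (z :: l) = s.tab a (z :: l)

theorem Stamped.trans {N : ℤ} {s₁ s₂ s₃ : Store Ctx} (h : Stamped N s₁ s₂)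
    (h' : Stamped N s₂ s₃) : Stamped N s₁ s₃ :=
  fun a ha z l hz => (h' a ha z l hz).trans (h a ha z l hz)

theorem Stamped.of_tab {N : ℤ} {s s' : Store Ctx} (h : s'.tab = s.tab) : Stamped N s s' :=
  fun a _ z l _ => by rw [h]

/-- The command accesses the tables from `2` on only with first index component `reg 3`. -/
def Cmd.Stamping : Cmd → Prop
  | .store a idx _ => 1 < a → idx.head? = some (.reg 3)
  | .seq c₁ c₂ | .ite _ _ c₁ c₂ => c₁.Stamping ∧ c₂.Stamping
  | _ => True

/-- Tables are never cleared. Each round uses its own number, kept in register `3`, as first key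
component, so leftovers of earlier rounds cannot be read. The condition `3 < b` protects the stamp
itself. -/
theorem Cmd.Stamping.stamped {b : ℕ} {A : Set ℕ} {c : Cmd} {N : ℤ} (h : c.Stamping)
    (hc : c.Within b A) (hb : 3 < b) (hN : s.reg 3 = N) : Stamped N s (c.ev s) := by
  induction c generalizing s with
  | skip | set | load => exact Stamped.of_tab rfl
  | store a idx e =>
    intro a' ha' z l hz
    by_cases haa : a' = a
    · subst haa
      obtain ⟨e₀, l', rfl⟩ : ∃ e₀ l', idx = e₀ :: l' := by
        cases idx with
        | nil => simpa using h ha'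
        | cons e₀ l' => exact ⟨_, _, rfl⟩
      obtain rfl : e₀ = .reg 3 := by simpa using h ha'
      simp only [Cmd.ev, Store.setTab, Store.key, List.map_cons, RExpr.val, hN, Int.floor_intCast,
        Function.update_self]
      rw [Function.update_of_ne (by simp [hz])]
    · simp only [Cmd.ev, Store.setTab]
      rw [Function.update_of_ne haa]
  | seq c₁ c₂ h₁ h₂ =>
    exact (h₁ h.1 hc.1 hN).trans (h₂ h.2 hc.2 (((hc.1.same s).1 3 hb).trans hN))
  | ite e₁ e₂ c₁ c₂ h₁ h₂ =>
    by_cases hlt : e₁.val s.reg < e₂.val s.reg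
    · simpa [Cmd.ev, hlt] using h₁ h.1 hc.1 hN
    · simpa [Cmd.ev, hlt] using h₂ h.2 hc.2 hN
  | _ => exact hc.elim

theorem stamping_seqs {l : List Cmd} (h : ∀ c ∈ l, c.Stamping) : (seqs l).Stamping := by
  induction l with
  | nil => trivial
  | cons c l ih => exact ⟨h c (by simp), ih fun c' hc' => h c' (by simp [hc'])⟩

theorem stamping_loadRow (a y b : ℕ) : (loadRow d a y b).Stamping := by
  refine stamping_seqs fun c hc => ?_
  obtain ⟨k, -, rfl⟩ := List.mem_map.1 hc
  trivial

theorem stamping_storeRow (b y : ℕ) : (storeRow d b y 1).Stamping := by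
  refine stamping_seqs fun c hc => ?_
  obtain ⟨k, -, rfl⟩ := List.mem_map.1 hc
  exact fun h => absurd h (lt_irrefl _)

/-! ### Grids -/

/-- The entry of the table for a cell of the grid is zero if the cell contains no point of `M`,
and otherwise it is the number of such a point, plus one. -/
def GridAt (T : List ℤ → ℝ) (N : ℤ) (σ : ℝ) (M : List (Pt d × ℕ)) : Prop :=
  ∀ c : Fin d → ℤ, (T (N :: List.ofFn c) = 0 ∧ ∀ q ∈ M, cell σ q.1 ≠ c) ∨
    ∃ i, ∃ h : i < M.length, T (N :: List.ofFn c) = i + 1 ∧ cell σ M[i].1 = c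

theorem GridAt.nil {T : List ℤ → ℝ} {N : ℤ} {σ : ℝ} (h : ∀ l, T (N :: l) = 0) :
    GridAt T N σ ([] : List (Pt d × ℕ)) :=
  fun _ => Or.inl ⟨h _, by simp⟩

/-- Overwriting the entry of a cell is harmless, since one representative per nonempty cell is all
that is claimed. -/
theorem GridAt.append {T : List ℤ → ℝ} {N : ℤ} {σ : ℝ} {M : List (Pt d × ℕ)} {q : Pt d × ℕ}
    (h : GridAt T N σ M) :
    GridAt (Function.update T (N :: List.ofFn (cell σ q.1)) (M.length + 1)) N σ (M ++ [q]) := by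
  intro c
  by_cases hc : cell σ q.1 = c
  · subst hc
    exact Or.inr ⟨M.length, by simp, by simp, by simp⟩
  · rw [Function.update_of_ne (by simpa using Ne.symm hc)]
    rcases h c with ⟨h₁, h₂⟩ | ⟨i, hi, h₁, h₂⟩
    · refine Or.inl ⟨h₁, fun q' hq' => ?_⟩
      rcases List.mem_append.1 hq' with h | h
      · exact h₂ q' h
      · rwa [List.mem_singleton.1 h]
    · exact Or.inr ⟨i, by simp; omega, h₁, by rwa [List.getElem_append_left hi]⟩

/-- The memory after the current points have been replaced by those of the list `L'`. -/
def Replaced (N : ℤ) (L' : List (Pt d × ℕ)) (s s' : Store Ctx) : Prop :=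
  Same 8 {1, 2, 3} (s.setReg 2 L'.length) s' ∧ Stamped N s s' ∧ Holds (s'.tab 1) L'

/-! ### Pruning -/

/-- A later point overwrites an earlier one in the same cell, so each nonempty cell ends up with
exactly one representative. Numbers are shifted by one because `0` means empty. -/
def registerBody (d : ℕ) : Cmd :=
  .seq (loadRow d 1 10 16) (.store 2 (cellKey 3 8 16 (0 : Fin d → ℤ)) (.add (.reg 10) (.const 1)))

theorem within_registerBody : (registerBody d).Within 11 {2} :=
  ⟨within_loadRow _ _ _ (by norm_num), rfl⟩

theorem stamping_registerBody : (registerBody d).Stamping :=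
  ⟨stamping_loadRow _ _ _, fun _ => rfl⟩

variable {L : List (Pt d × ℕ)} {N : ℕ} {σ r : ℝ}

theorem Det.register (hn : s.reg 2 = L.length) (hN : s.reg 3 = N) (hσ : s.reg 8 = σ)
    (hL : Holds (s.tab 1) L) (h0 : ∀ l, s.tab 2 ((N : ℤ) :: l) = 0) :
    Det O (countLoop 10 2 (registerBody d)) s ((L.length + 1) * ((registerBody d).cost + 12))
      fun s' => Same 10 {2} s s' ∧ Stamped N s s' ∧ GridAt (s'.tab 2) N σ L := by
  refine (Det.forLoop (by norm_num) within_registerBody.simple (fun k s' => Same 10 {2} s s' ∧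
    Stamped N s s' ∧ GridAt (s'.tab 2) N σ (L.take k)) hn ?_ ?_).mono le_rfl ?_
  · exact ⟨Same.setReg _ _ _ le_rfl, Stamped.of_tab rfl, by
      rw [List.take_zero]
      exact GridAt.nil h0⟩
  · rintro k hk s₁ hx hy ⟨h₁, h₂, h₃⟩
    have hs := (within_registerBody (d := d)).same s₁
    have hN₁ : s₁.reg 3 = N := (h₁.1 3 (by norm_num)).trans hN
    have hst : Stamped (N : ℤ) s₁ ((registerBody d).ev s₁) :=
      stamping_registerBody.stamped within_registerBody (by norm_num) (by simpa using hN₁)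
    refine ⟨(hs.1 _ (by norm_num)).trans hx, (hs.1 _ (by norm_num)).trans hy,
      (h₁.trans (hs.mono (by norm_num) subset_rfl)).trans (Same.setReg _ _ _ le_rfl),
      (h₂.trans hst).trans (Stamped.of_tab rfl), ?_⟩
    have h₀ : RowAt (s₁.tab 1) k L[k] := by
      rw [h₁.2.1 1 (by simp)]
      exact hL k hk
    have hb := ev_loadRow_buf (d := d) 1 10 16 s₁ (by norm_num) hx h₀
    have hr : ∀ x < 16, ((loadRow d 1 10 16).ev s₁).reg x = s₁.reg x := fun x hx =>
      ev_loadRow_reg 1 10 16 s₁ (by norm_num) (Or.inl hx)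
    have hkey := key_cellKey (t := 3) (σ := 8) (0 : Fin d → ℤ)
      ((hr 3 (by norm_num)).trans hN₁) hb
    rw [hr 8 (by norm_num), h₁.1 8 (by norm_num), hσ, add_zero] at hkey
    rw [← List.take_append_getElem hk]
    have := h₃.append (q := L[k])
    rw [List.length_take, min_eq_left hk.le] at this
    simpa [registerBody, Cmd.ev, hkey, Store.setTab, Store.setReg, RExpr.val, hr, hx,
      ev_loadRow_tab] using this
  · rintro s' ⟨-, h₁, h₂, h₃⟩
    exact ⟨h₁, h₂, by simpa using h₃⟩

/-- The point in the first buffer looks at the representative of one nearby cell and marks it if it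
is a different point at distance less than `reg 4`. Distances are compared through their squares. -/
def markStep (d : ℕ) (o : Fin d → ℤ) : Cmd :=
  .seq (.load 12 2 (cellKey 3 8 16 o))
    (.ite (.const 0) (.reg 12)
      (.seq (.set 12 (.sub (.reg 12) (.const 1)))
        (.seq (loadRow d 1 12 (17 + d))
          (.ite (.const 0) (sqDist d 16 (17 + d))
            (.ite (sqDist d 16 (17 + d)) (.mul (.reg 4) (.reg 4))
              (.store 3 [.reg 3, .reg 12] (.const 1)) .skip) .skip)))
      .skip)

theorem within_markStep (o : Fin d → ℤ) : (markStep d o).Within 12 {3} :=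
  ⟨le_rfl, ⟨le_rfl, within_loadRow _ _ _ (by omega), ⟨rfl, trivial⟩, trivial⟩, trivial⟩

theorem stamping_markStep (o : Fin d → ℤ) : (markStep d o).Stamping :=
  ⟨trivial, ⟨trivial, stamping_loadRow _ _ _, ⟨fun _ => rfl, trivial⟩, trivial⟩, trivial⟩

theorem ev_markStep {q : Pt d × ℕ} (o : Fin d → ℤ) (hN : s.reg 3 = N) (hσ : s.reg 8 = σ)
    (hr : s.reg 4 = r) (h0 : 0 < r) (hL : Holds (s.tab 1) L) (hG : GridAt (s.tab 2) N σ L)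
    (hq : BufAt s.reg 16 q) :
    BufAt ((markStep d o).ev s).reg 16 q ∧
    (∀ l, ((markStep d o).ev s).tab 3 l = s.tab 3 l ∨ ((markStep d o).ev s).tab 3 l = 1 ∧
      ∃ i, ∃ h : i < L.length, l = [(N : ℤ), (i : ℤ)] ∧ q.1 ≠ L[i].1 ∧ dist q.1 L[i].1 < r) ∧
    ∀ i (h : i < L.length), s.tab 2 ((N : ℤ) :: List.ofFn (cell σ q.1 + o)) = i + 1 →
      q.1 ≠ L[i].1 → dist q.1 L[i].1 < r →
      ((markStep d o).ev s).tab 3 [(N : ℤ), (i : ℤ)] = 1 := by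
  have hkey := key_cellKey (t := 3) (σ := 8) o hN hq
  rw [hσ] at hkey
  simp only [markStep, ev_seq, Cmd.ev, hkey]
  rcases hG (cell σ q.1 + o) with ⟨h₁, -⟩ | ⟨i, hi, h₁, -⟩
  · have : ¬ RExpr.val (s.setReg 12 0).reg (.const 0) < RExpr.val (s.setReg 12 0).reg (.reg 12) := by
      simp [RExpr.val, Store.setReg]
    rw [h₁, if_neg this]
    refine ⟨hq.congr fun x hx _ => Function.update_of_ne (by omega) _ _,
      fun l => Or.inl rfl, fun i _ h => ?_⟩
    have : (0 : ℝ) < i + 1 := by positivity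
    rw [← h] at this
    exact absurd this (lt_irrefl _)
  · rw [h₁]
    have : RExpr.val (s.setReg 12 ((i : ℝ) + 1)).reg (.const 0) <
        RExpr.val (s.setReg 12 ((i : ℝ) + 1)).reg (.reg 12) := by
      simp only [RExpr.val, Store.setReg, Function.update_self, Rat.cast_zero]
      positivity
    rw [if_pos this]
    set s₁ := (s.setReg 12 ((i : ℝ) + 1)).setReg 12
      (RExpr.val (s.setReg 12 ((i : ℝ) + 1)).reg (.sub (.reg 12) (.const 1))) with hs₁
    have h12 : s₁.reg 12 = i := by simp [hs₁, Store.setReg, RExpr.val]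
    have hx₁ : ∀ x ≠ 12, s₁.reg x = s.reg x := fun x hx => by simp [hs₁, Store.setReg, hx]
    have ht₁ : s₁.tab = s.tab := rfl
    set s₂ := (loadRow d 1 12 (17 + d)).ev s₁ with hs₂
    have hB : BufAt s₂.reg (17 + d) L[i] :=
      ev_loadRow_buf 1 12 (17 + d) s₁ (by omega) h12 (hL i hi)
    have hx₂ : ∀ x < 17 + d, s₂.reg x = s₁.reg x := fun x hx =>
      ev_loadRow_reg 1 12 (17 + d) s₁ (by omega) (Or.inl hx)
    have ht₂ : s₂.tab = s.tab := (ev_loadRow_tab 1 12 (17 + d) s₁ (by omega)).trans ht₁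
    have hA : BufAt s₂.reg 16 q := hq.congr fun x _ _ =>
      (hx₂ x (by omega)).trans (hx₁ x (by omega))
    have h3 : s₂.reg 3 = N := by rw [hx₂ _ (by omega), hx₁ _ (by omega), hN]
    have h4 : s₂.reg 4 = r := by rw [hx₂ _ (by omega), hx₁ _ (by omega), hr]
    have h12' : s₂.reg 12 = i := by rw [hx₂ _ (by omega), h12]
    rw [val_sqDist hA hB]
    simp only [RExpr.val, h4, Rat.cast_zero]
    have e₁ : 0 < dist q.1 L[i].1 ^ 2 ↔ q.1 ≠ L[i].1 := by
      rw [← dist_pos]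
      exact ⟨fun h => lt_of_le_of_ne dist_nonneg fun he => by simp [← he] at h,
        fun h => by positivity⟩
    have e₂ : dist q.1 L[i].1 ^ 2 < r * r ↔ dist q.1 L[i].1 < r := by
      rw [← sq, pow_lt_pow_iff_left₀ dist_nonneg h0.le two_ne_zero]
    simp only [e₁, e₂]
    by_cases hc : q.1 ≠ L[i].1 ∧ dist q.1 L[i].1 < r
    · rw [if_pos hc.1, if_pos hc.2]
      have hk : s₂.key [.reg 3, .reg 12] = [(N : ℤ), (i : ℤ)] := by
        simp [Store.key, RExpr.val, h3, h12']
      rw [hk]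
      refine ⟨hA, fun l => ?_, fun j hj hij _ _ => ?_⟩
      · by_cases hl : l = [(N : ℤ), (i : ℤ)]
        · subst hl
          exact Or.inr ⟨by simp [Store.setTab], i, hi, rfl, hc⟩
        · left
          simp only [Store.setTab, Function.update_self]
          rw [Function.update_of_ne hl, ht₂]
      · obtain rfl : i = j := by
          have : (i : ℝ) = j := by linarith
          exact_mod_cast this
        simp [Store.setTab]
    · have : (if q.1 ≠ L[i].1 then if dist q.1 L[i].1 < r then
          s₂.setTab 3 (s₂.key [.reg 3, .reg 12]) ((1 : ℚ) : ℝ) else s₂ else s₂) = s₂ := by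
        by_cases h : q.1 ≠ L[i].1
        · rw [if_pos h, if_neg fun h' => hc ⟨h, h'⟩]
        · rw [if_neg h]
      rw [this]
      refine ⟨hA, fun l => Or.inl (by rw [ht₂]), fun j hj hij h h' => ?_⟩
      obtain rfl : i = j := by
        have : (i : ℝ) = j := by linarith
        exact_mod_cast this
      exact absurd ⟨h, h'⟩ hc

theorem ev_markSteps {q : Pt d × ℕ} (os : List (Fin d → ℤ)) (hN : s.reg 3 = N)
    (hσ : s.reg 8 = σ) (hr : s.reg 4 = r) (h0 : 0 < r) (hL : Holds (s.tab 1) L)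
    (hG : GridAt (s.tab 2) N σ L) (hq : BufAt s.reg 16 q) :
    (∀ l, ((seqs (os.map (markStep d))).ev s).tab 3 l = s.tab 3 l ∨
      ((seqs (os.map (markStep d))).ev s).tab 3 l = 1 ∧
      ∃ i, ∃ h : i < L.length, l = [(N : ℤ), (i : ℤ)] ∧ q.1 ≠ L[i].1 ∧ dist q.1 L[i].1 < r) ∧
    ∀ o ∈ os, ∀ i (h : i < L.length),
      s.tab 2 ((N : ℤ) :: List.ofFn (cell σ q.1 + o)) = i + 1 →
      q.1 ≠ L[i].1 → dist q.1 L[i].1 < r →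
      ((seqs (os.map (markStep d))).ev s).tab 3 [(N : ℤ), (i : ℤ)] = 1 := by
  induction os generalizing s with
  | nil => simp
  | cons o os ih =>
    obtain ⟨h₁, h₂, h₃⟩ := ev_markStep o hN hσ hr h0 hL hG hq
    have hs := (within_markStep o).same s
    simp only [List.map_cons, seqs_cons, ev_seq]
    generalize (markStep d o).ev s = s₁ at *
    have ht : ∀ a ≠ 3, s₁.tab a = s.tab a := fun a ha => hs.2.1 a (by simpa using ha)
    obtain ⟨h₄, h₅⟩ := ih (s := s₁) ((hs.1 _ (by norm_num)).trans hN)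
      ((hs.1 _ (by norm_num)).trans hσ) ((hs.1 _ (by norm_num)).trans hr)
      (by rwa [ht 1 (by norm_num)]) (by rwa [ht 2 (by norm_num)]) h₁
    rw [ht 2 (by norm_num)] at h₅
    refine ⟨fun l => ?_, fun o' ho' i hi hc hne hlt => ?_⟩
    · rcases h₄ l with h | h
      · rw [h]
        exact h₂ l
      · exact Or.inr h
    · rcases List.mem_cons.1 ho' with rfl | ho'
      · rcases h₄ [(N : ℤ), (i : ℤ)] with h | h
        · rw [h]
          exact h₃ i hi hc hne hlt
        · exact h.1
      · exact h₅ o' ho' i hi hc hne hlt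

/-- For side length `σ = r / (d + 1)`, points at distance at most `r` have cell coordinates that
differ by at most `d + 1`, so these offsets suffice; their number depends only on `d`. -/
def markBody (d : ℕ) : Cmd :=
  .seq (loadRow d 1 10 16) (seqs ((offsets d (d + 1)).map (markStep d)))

theorem within_markBody : (markBody d).Within 11 {3} := by
  refine ⟨within_loadRow _ _ _ (by norm_num), within_seqs fun c hc => ?_⟩
  obtain ⟨o, -, rfl⟩ := List.mem_map.1 hc
  exact (within_markStep o).mono (by norm_num)

theorem stamping_markBody : (markBody d).Stamping := by
  refine ⟨stamping_loadRow _ _ _, stamping_seqs fun c hc => ?_⟩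
  obtain ⟨o, -, rfl⟩ := List.mem_map.1 hc
  exact stamping_markStep o

/-- Only representatives need to be decided by marks. Letting every point visit the nearby
representatives, rather than every representative visit the nearby points, keeps the work per point
bounded even if cells are crowded. -/
theorem Det.mark (hn : s.reg 2 = L.length) (hN : s.reg 3 = N) (hσ : s.reg 8 = σ) (h0 : 0 < σ)
    (hr : s.reg 4 = ((d + 1 : ℕ) : ℝ) * σ) (hL : Holds (s.tab 1) L)
    (hG : GridAt (s.tab 2) N σ L) (h3 : ∀ l, s.tab 3 ((N : ℤ) :: l) = 0) :
    Det O (countLoop 10 2 (markBody d)) s ((L.length + 1) * ((markBody d).cost + 12))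
      fun s' => Same 10 {3} s s' ∧ Stamped N s s' ∧ ∀ i (h : i < L.length),
        (s'.tab 3 [(N : ℤ), (i : ℤ)] = 0 ∨ s'.tab 3 [(N : ℤ), (i : ℤ)] = 1 ∧
          ∃ q ∈ L, q.1 ≠ L[i].1 ∧ dist L[i].1 q.1 < s.reg 4) ∧
        (s.tab 2 ((N : ℤ) :: List.ofFn (cell σ L[i].1)) = i + 1 →
          (∃ q ∈ L, q.1 ≠ L[i].1 ∧ dist L[i].1 q.1 < s.reg 4) →
          s'.tab 3 [(N : ℤ), (i : ℤ)] = 1) := by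
  have h0r : 0 < s.reg 4 := by
    rw [hr]
    positivity
  refine (Det.forLoop (by norm_num) within_markBody.simple (fun k s' => Same 10 {3} s s' ∧
    Stamped N s s' ∧ ∀ i (h : i < L.length),
        (s'.tab 3 [(N : ℤ), (i : ℤ)] = 0 ∨ s'.tab 3 [(N : ℤ), (i : ℤ)] = 1 ∧
          ∃ q ∈ L, q.1 ≠ L[i].1 ∧ dist L[i].1 q.1 < s.reg 4) ∧
        (s.tab 2 ((N : ℤ) :: List.ofFn (cell σ L[i].1)) = i + 1 →
          (∃ j, ∃ h' : j < L.length, j < k ∧ L[j].1 ≠ L[i].1 ∧ dist L[i].1 L[j].1 < s.reg 4) →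
          s'.tab 3 [(N : ℤ), (i : ℤ)] = 1)) hn ?_ ?_).mono le_rfl ?_
  · exact ⟨Same.setReg _ _ _ le_rfl, Stamped.of_tab rfl, fun i hi => ⟨Or.inl (h3 _),
      fun _ ⟨j, _, hj, _⟩ => absurd hj (by omega)⟩⟩
  · rintro k hk s₁ hx hy ⟨h₁, h₂, h₃⟩
    have hs := (within_markBody (d := d)).same s₁
    have hN₁ : s₁.reg 3 = N := (h₁.1 3 (by norm_num)).trans hN
    have hst : Stamped (N : ℤ) s₁ ((markBody d).ev s₁) :=
      stamping_markBody.stamped within_markBody (by norm_num) (by simpa using hN₁)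
    refine ⟨(hs.1 _ (by norm_num)).trans hx, (hs.1 _ (by norm_num)).trans hy,
      (h₁.trans (hs.mono (by norm_num) subset_rfl)).trans (Same.setReg _ _ _ le_rfl),
      (h₂.trans hst).trans (Stamped.of_tab rfl), ?_⟩
    have ht : ∀ a ≠ 3, s₁.tab a = s.tab a := fun a ha => h₁.2.1 a (by simpa using ha)
    have h₀ : RowAt (s₁.tab 1) k L[k] := by
      rw [ht 1 (by norm_num)]
      exact hL k hk
    have hb := ev_loadRow_buf (d := d) 1 10 16 s₁ (by norm_num) hx h₀
    have hr' : ∀ x < 10, ((loadRow d 1 10 16).ev s₁).reg x = s.reg x := fun x hx =>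
      (ev_loadRow_reg 1 10 16 s₁ (by norm_num) (Or.inl (by omega))).trans (h₁.1 x hx)
    have htab := ev_loadRow_tab (d := d) 1 10 16 s₁ (by norm_num)
    obtain ⟨h₄, h₅⟩ := ev_markSteps (offsets d (d + 1)) ((hr' 3 (by norm_num)).trans hN)
      ((hr' 8 (by norm_num)).trans hσ) (hr' 4 (by norm_num)) h0r
      (by rwa [htab, ht 1 (by norm_num)]) (by rwa [htab, ht 2 (by norm_num)]) hb
    rw [htab, ht 2 (by norm_num)] at h₅
    rw [htab] at h₄
    change ∀ i (h : i < L.length), _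
    intro i hi
    have e : ((markBody d).ev s₁).setReg 10 ((k : ℝ) + 1) =
      ((seqs ((offsets d (d + 1)).map (markStep d))).ev ((loadRow d 1 10 16).ev s₁)).setReg 10
        ((k : ℝ) + 1) := rfl
    rw [e]
    simp only [Store.setReg]
    refine ⟨?_, fun hg hj => ?_⟩
    · rcases h₄ [(N : ℤ), (i : ℤ)] with h | ⟨h, j, hj, hij, hne, hlt⟩
      · rw [h]
        exact (h₃ i hi).1
      · obtain rfl : i = j := by simpa using hij
        exact Or.inr ⟨h, L[k], List.getElem_mem _, hne, by rwa [dist_comm]⟩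
    · obtain ⟨j, hj, hjk, hne, hlt⟩ := hj
      rcases Nat.lt_succ_iff_lt_or_eq.1 hjk with h | rfl
      · rcases h₄ [(N : ℤ), (i : ℤ)] with h' | h'
        · rw [h']
          exact (h₃ i hi).2 hg ⟨j, hj, h, hne, hlt⟩
        · exact h'.1
      -- The current point reaches the cell of `L[i]` through the difference of the two cells, which
      -- is an admissible offset.
      · refine h₅ (cell σ L[i].1 - cell σ L[j].1) (mem_offsets.2 ?_) i hi (by simpa using hg) hne
          (by rwa [dist_comm])
        rw [hr] at hlt
        exact cell_of_dist_le h0 hlt.le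
  · rintro s' ⟨-, h₁, h₂, h₃⟩
    refine ⟨h₁, h₂, fun i hi => ⟨(h₃ i hi).1, fun h ⟨q, hq, h'⟩ => (h₃ i hi).2 h ?_⟩⟩
    obtain ⟨j, hj, rfl⟩ := List.getElem_of_mem hq
    exact ⟨j, hj, hj, h'⟩

end Prune

/-! ### Pruning: compaction of the point table and the complete command -/

section Prune

variable {d : ℕ} {Ctx : Type u} {O : Procedures d Ctx} {s : Store Ctx} {Q : Store Ctx → Prop}
  {L : List (Pt d × ℕ)} {N : ℕ} {σ r : ℝ}

/-- A point is kept if it is not the representative of its cell (the square is positive) or if it is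
marked (register `13` is positive). -/
def filterBody (d : ℕ) : Cmd :=
  .seq (loadRow d 1 10 16) (.seq (.load 12 2 (cellKey 3 8 16 (0 : Fin d → ℤ)))
    (.seq (.load 13 3 [.reg 3, .reg 10])
      (.ite (.const 0) (.add (.mul (.sub (.reg 12) (.add (.reg 10) (.const 1)))
          (.sub (.reg 12) (.add (.reg 10) (.const 1)))) (.reg 13))
        (.seq (storeRow d 16 11 1) (.set 11 (.add (.reg 11) (.const 1)))) .skip)))

theorem within_filterBody : (filterBody d).Within 11 {1} :=
  ⟨within_loadRow _ _ _ (by norm_num), by simp [Cmd.Within], by simp [Cmd.Within],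
    ⟨within_storeRow _ _ rfl, le_rfl⟩, trivial⟩

theorem stamping_filterBody : (filterBody d).Stamping :=
  ⟨stamping_loadRow _ _ _, trivial, trivial, ⟨stamping_storeRow _ _, trivial⟩, trivial⟩

theorem Det.filter (p : Pt d × ℕ → Prop) [DecidablePred p] (hn : s.reg 2 = L.length)
    (hN : s.reg 3 = N) (hσ : s.reg 8 = σ) (h11 : s.reg 11 = 0) (hL : Holds (s.tab 1) L)
    (hp : ∀ i (h : i < L.length),
      0 < (s.tab 2 ((N : ℤ) :: List.ofFn (cell σ L[i].1)) - (i + 1)) *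
        (s.tab 2 ((N : ℤ) :: List.ofFn (cell σ L[i].1)) - (i + 1)) +
        s.tab 3 [(N : ℤ), (i : ℤ)] ↔ p L[i]) :
    Det O (countLoop 10 2 (filterBody d)) s ((L.length + 1) * ((filterBody d).cost + 12))
      fun s' => Same 10 {1} s s' ∧ Stamped N s s' ∧ s'.reg 11 = (L.filter p).length ∧
        Holds (s'.tab 1) (L.filter p) := by
  refine (Det.forLoop (by norm_num) within_filterBody.simple (fun k s' => Same 10 {1} s s' ∧
    Stamped N s s' ∧ s'.reg 11 = ((L.take k).filter p).length ∧
        Holds (s'.tab 1) ((L.take k).filter p) ∧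
        ∀ i (h : i < L.length), k ≤ i → RowAt (s'.tab 1) i L[i]) hn ?_ ?_).mono le_rfl ?_
  · refine ⟨Same.setReg _ _ _ le_rfl, Stamped.of_tab rfl, ?_, ?_, fun i hi _ => hL i hi⟩
    · simpa [Store.setReg] using h11
    · intro i hi
      simp at hi
  · rintro k hk s₁ hx hy ⟨h₁, h₂, h₃, h₄, h₅⟩
    have hs := (within_filterBody (d := d)).same s₁
    have hN₁ : s₁.reg 3 = N := (h₁.1 3 (by norm_num)).trans hN
    have hst : Stamped (N : ℤ) s₁ ((filterBody d).ev s₁) :=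
      stamping_filterBody.stamped within_filterBody (by norm_num) (by simpa using hN₁)
    refine ⟨(hs.1 _ (by norm_num)).trans hx, (hs.1 _ (by norm_num)).trans hy,
      (h₁.trans (hs.mono (by norm_num) subset_rfl)).trans (Same.setReg _ _ _ le_rfl),
      (h₂.trans hst).trans (Stamped.of_tab rfl), ?_⟩
    have ht : ∀ a ≠ 1, s₁.tab a = s.tab a := fun a ha => h₁.2.1 a (by simpa using ha)
    have hb := ev_loadRow_buf (d := d) 1 10 16 s₁ (by norm_num) hx (h₅ k hk le_rfl)
    set s₂ := (loadRow d 1 10 16).ev s₁ with hs₂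
    have hr : ∀ x < 16, s₂.reg x = s₁.reg x := fun x hx =>
      ev_loadRow_reg 1 10 16 s₁ (by norm_num) (Or.inl hx)
    have htab : s₂.tab = s₁.tab := ev_loadRow_tab (d := d) 1 10 16 s₁ (by norm_num)
    have hkey := key_cellKey (t := 3) (σ := 8) (0 : Fin d → ℤ)
      ((hr 3 (by norm_num)).trans hN₁) hb
    rw [hr 8 (by norm_num), h₁.1 8 (by norm_num), hσ, add_zero] at hkey
    set s₃ := (s₂.setReg 12 (s.tab 2 ((N : ℤ) :: List.ofFn (cell σ L[k].1)))).setReg 13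
      (s.tab 3 [(N : ℤ), (k : ℤ)]) with hs₃
    have hev : (filterBody d).ev s₁ = (Cmd.ite (.const 0)
        (.add (.mul (.sub (.reg 12) (.add (.reg 10) (.const 1)))
          (.sub (.reg 12) (.add (.reg 10) (.const 1)))) (.reg 13))
        (.seq (storeRow d 16 11 1) (.set 11 (.add (.reg 11) (.const 1)))) .skip).ev s₃ := by
      rw [filterBody, ev_seq, ev_seq, ev_seq, ← hs₂]
      congr 1
      rw [hs₃, ← ht 2 (by norm_num), ← ht 3 (by norm_num), ← htab, ← hkey]
      simp [Cmd.ev, Store.key, RExpr.val, Store.setReg, hr, hx, hN₁]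
    have h11₃ : s₃.reg 11 = ((L.take k).filter p).length := by
      rw [← h₃, ← hr 11 (by norm_num)]
      simp [hs₃, Store.setReg]
    have hv : RExpr.val s₃.reg (.add (.mul (.sub (.reg 12) (.add (.reg 10) (.const 1)))
          (.sub (.reg 12) (.add (.reg 10) (.const 1)))) (.reg 13)) =
        (s.tab 2 ((N : ℤ) :: List.ofFn (cell σ L[k].1)) - (k + 1)) *
        (s.tab 2 ((N : ℤ) :: List.ofFn (cell σ L[k].1)) - (k + 1)) +
        s.tab 3 [(N : ℤ), (k : ℤ)] := by
      simp [hs₃, RExpr.val, Store.setReg, hr, hx]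
    have hpk : RExpr.val s₃.reg (.const 0) < RExpr.val s₃.reg
        (.add (.mul (.sub (.reg 12) (.add (.reg 10) (.const 1)))
          (.sub (.reg 12) (.add (.reg 10) (.const 1)))) (.reg 13)) ↔ p L[k] := by
      rw [hv, show RExpr.val s₃.reg (.const 0) = 0 by simp [RExpr.val]]
      exact hp k hk
    have ht₃ : s₃.tab = s₁.tab := htab
    have hb₃ : BufAt s₃.reg 16 L[k] := hb.congr fun x hx _ => by
      simp only [hs₃, Store.setReg]
      rw [Function.update_of_ne (by omega), Function.update_of_ne (by omega)]
    -- The writing position never overtakes the reading position, so the compaction in place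
    -- destroys no unread row.
    have hlen : ((L.take k).filter p).length ≤ k :=
      (List.length_filter_le _ _).trans (by simp)
    rw [hev, ← List.take_append_getElem hk, List.filter_append]
    by_cases hpL : p L[k]
    · have hfil : ([L[k]] : List (Pt d × ℕ)).filter (fun b => decide (p b)) = [L[k]] := by
        simp [hpL]
      have he := ev_storeRow d 16 11 1 s₃ h11₃
      rw [hfil]
      rw [ev_ite_pos (hpk.2 hpL)]
      simp only [Cmd.ev, RExpr.val, he.1]
      refine ⟨?_, ?_, ?_⟩
      · simp [Store.setReg, h11₃]
      · intro i hi
        simp only [Store.setReg]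
        rw [List.length_append, List.length_singleton] at hi
        rcases Nat.lt_succ_iff_lt_or_eq.1 hi with hi' | hi'
        · rw [List.getElem_append_left hi']
          refine ev_storeRow_other 16 11 1 s₃ h11₃ hi'.ne ?_
          rw [ht₃]
          exact h₄ i hi'
        · have : ((L.take k).filter (fun b => decide (p b)) ++ [L[k]])[i]'(by
              simpa using hi) = L[k] := by
            rw [List.getElem_append_right (by omega)]
            simp
          rw [this, hi']
          exact ev_storeRow_same 16 11 1 s₃ h11₃ hb₃
      · intro i hi hik
        simp only [Store.setReg]
        refine ev_storeRow_other 16 11 1 s₃ h11₃ (by omega) ?_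
        rw [ht₃]
        exact h₅ i hi (by omega)
    · have hfil : ([L[k]] : List (Pt d × ℕ)).filter (fun b => decide (p b)) = [] := by
        simp [hpL]
      rw [hfil, List.append_nil]
      rw [ev_ite_neg fun h => hpL (hpk.1 h), ev_skip]
      refine ⟨?_, ?_, ?_⟩
      · simpa [Store.setReg] using h11₃
      · simpa only [Store.setReg, ht₃] using h₄
      · simpa only [Store.setReg, ht₃] using fun i hi hik => h₅ i hi (by omega)
  · rintro s' ⟨-, h₁, h₂, h₃, h₄, -⟩
    rw [List.take_length] at h₃ h₄
    exact ⟨h₁, h₂, h₃, h₄⟩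

/-- Replace the current points by those whose nearest neighbour distance is less than `reg 4`. -/
def pruneCmd (d : ℕ) : Cmd :=
  .seq (.set 8 (.div (.reg 4) (.const ((d + 1 : ℕ) : ℚ))))
    (.seq (countLoop 10 2 (registerBody d)) (.seq (countLoop 10 2 (markBody d))
      (.seq (.set 11 (.const 0)) (.seq (countLoop 10 2 (filterBody d)) (.set 2 (.reg 11))))))

def pruneCost (d : ℕ) : ℕ :=
  (registerBody d).cost + (markBody d).cost + (filterBody d).cost + 50

/-- With `σ = r / (d + 1)` two points of the same cell are at distance at most `d σ < r`. Hence a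
point that is not the representative of its cell is close automatically, and for a representative
the marks give the exact answer. -/
theorem Det.prune {P : WSet d} (hE : Enumerates L P) (hn : s.reg 2 = L.length) (hN : s.reg 3 = N)
    (hr : s.reg 4 = r) (h0 : 0 < r) (hL : Holds (s.tab 1) L)
    (hfresh : ∀ a, 1 < a → ∀ l, s.tab a ((N : ℤ) :: l) = 0) :
    Det O (pruneCmd d) s (pruneCost d * (L.length + 1)) (Replaced N (closeList L r) s) := by
  classical
  set σ : ℝ := r / (d + 1 : ℕ) with hσ
  have hd : (0 : ℝ) < (d + 1 : ℕ) := by positivity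
  have hσ0 : 0 < σ := by positivity
  have hrσ : r = (d + 1 : ℕ) * σ := by
    rw [hσ]
    field_simp
  set s₀ := (Cmd.set 8 (.div (.reg 4) (.const ((d + 1 : ℕ) : ℚ)))).ev s with hs₀
  have hs₀' : s₀ = s.setReg 8 σ := by
    simp [hs₀, Cmd.ev, RExpr.val, hr, hσ]
  have h₀ : ∀ x ≠ 8, s₀.reg x = s.reg x := fun x hx => by simp [hs₀', Store.setReg, hx]
  have h₀8 : s₀.reg 8 = σ := by simp [hs₀', Store.setReg]
  have ht₀ : s₀.tab = s.tab := by rw [hs₀']; rfl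
  have hc₀ : s₀.ctx = s.ctx := by rw [hs₀']; rfl
  refine (Det.simple_seq (c₁ := .set 8 _) trivial (Det.seq_of (Det.register (σ := σ) (N := N)
    (L := L) ((h₀ 2 (by norm_num)).trans hn) ((h₀ 3 (by norm_num)).trans hN) h₀8
    (by rwa [ht₀]) (by rw [ht₀]; exact hfresh 2 (by norm_num)))
    (τ₂ := 1 + (L.length + 1) * ((markBody d).cost + 12) +
      (1 + 2 + (1 + (L.length + 1) * ((filterBody d).cost + 12) + 2)))
    fun s₁ ⟨h₁, hst₁, hG⟩ => ?_)).mono ?_ fun _ h => h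
  swap
  · simp only [Cmd.cost, RExpr.cost, pruneCost]
    push_cast
    nlinarith [(Nat.cast_nonneg L.length : (0 : ℝ) ≤ L.length)]
  have hr₁ : ∀ x < 10, x ≠ 8 → s₁.reg x = s.reg x := fun x hx hx8 =>
    (h₁.1 x hx).trans (h₀ x hx8)
  have h8₁ : s₁.reg 8 = σ := (h₁.1 8 (by norm_num)).trans h₀8
  have h4₁ : s₁.reg 4 = r := (hr₁ 4 (by norm_num) (by norm_num)).trans hr
  have ht₁ : ∀ a ≠ 2, s₁.tab a = s.tab a := fun a ha =>
    (h₁.2.1 a (by simpa using ha)).trans (by rw [ht₀])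
  refine Det.seq_of (Det.mark (σ := σ) (N := N) (L := L)
    ((hr₁ 2 (by norm_num) (by norm_num)).trans hn) ((hr₁ 3 (by norm_num) (by norm_num)).trans hN)
    h8₁ hσ0 (h4₁.trans hrσ) (by rwa [ht₁ 1 (by norm_num)]) hG
    (by rw [ht₁ 3 (by norm_num)]; exact hfresh 3 (by norm_num))) fun s₂ ⟨h₂, hst₂, hM⟩ => ?_
  rw [h4₁] at hM
  set s₃ := (Cmd.set 11 (.const 0)).ev s₂ with hs₃
  have hs₃' : s₃ = s₂.setReg 11 0 := by simp [hs₃, Cmd.ev, RExpr.val]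
  have hr₃ : ∀ x < 10, s₃.reg x = s₁.reg x := fun x hx => by
    rw [← h₂.1 x hx, hs₃', Store.setReg]
    exact Function.update_of_ne (by omega) _ _
  have ht₃ : ∀ a ≠ 3, s₃.tab a = s₁.tab a := fun a ha => by
    rw [hs₃', ← h₂.2.1 a (by simpa using ha)]
    rfl
  have ht₃' : s₃.tab = s₂.tab := by rw [hs₃']; rfl
  refine (Det.simple_seq (c₁ := .set 11 (.const 0)) trivial (Det.seq_of (Det.filter (σ := σ)
    (N := N) (L := L) (s := s₃) (fun q => ∃ q' ∈ L, q'.1 ≠ q.1 ∧ dist q.1 q'.1 < r)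
    ?_ ?_ ?_ ?_ ?_ ?_) (τ₂ := 2) fun s₄ ⟨h₄, hst₄, h11, hH⟩ => ?_)).mono
      (by simp [Cmd.cost, RExpr.cost]) fun _ h => h
  · rw [hr₃ 2 (by norm_num), hr₁ 2 (by norm_num) (by norm_num), hn]
  · rw [hr₃ 3 (by norm_num), hr₁ 3 (by norm_num) (by norm_num), hN]
  · rw [hr₃ 8 (by norm_num), h8₁]
  · simp [hs₃', Store.setReg]
  · rwa [ht₃ 1 (by norm_num), ht₁ 1 (by norm_num)]
  · intro i hi
    rw [ht₃ 2 (by norm_num), ht₃']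
    obtain ⟨hM₁, hM₂⟩ := hM i hi
    rcases hG (cell σ L[i].1) with ⟨-, h⟩ | ⟨j, hj, hTj, hcj⟩
    · exact absurd rfl (h _ (List.getElem_mem hi))
    · rw [hTj] at hM₂ ⊢
      -- If `i = j`, the point is its own representative and the mark decides. Otherwise both sides
      -- hold, the witness being the representative `L[j]` of the common cell.
      by_cases hij : i = j
      · subst hij
        simp only [sub_self, mul_zero, zero_add]
        constructor
        · intro h
          rcases hM₁ with h' | h'
          · rw [h'] at h
            exact absurd h (lt_irrefl _)
          · exact h'.2
        · intro h
          rw [hM₂ rfl h]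
          exact one_pos
      · have hne : (j : ℝ) + 1 - (i + 1) ≠ 0 := by
          have : (i : ℝ) ≠ j := by exact_mod_cast hij
          intro h
          exact this (by linarith)
        have hpos : 0 < ((j : ℝ) + 1 - (i + 1)) * ((j : ℝ) + 1 - (i + 1)) := mul_self_pos.2 hne
        refine iff_of_true ?_ ⟨L[j], List.getElem_mem hj, fun h => hij ?_, ?_⟩
        · rcases hM₁ with h' | h'
          · rw [h']
            linarith
          · rw [h'.1]
            linarith
        · refine ((List.Nodup.getElem_inj_iff hE.1 (hi := by simpa using hi)
            (hj := by simpa using hj)).1 ?_)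
          simpa using h.symm
        · refine (dist_le_of_cell hσ0 (R := 0) le_rfl fun k => ?_).trans_lt ?_
          · simp [hcj]
          · rw [hrσ]
            push_cast
            nlinarith
  · refine (Det.of_simple (c := .set 2 (.reg 11)) trivial ⟨⟨fun x hx => ?_, fun a ha => ?_, ?_⟩,
      ?_, ?_⟩).mono (by norm_num [Cmd.cost, RExpr.cost]) fun _ h => h
    · simp only [Cmd.ev, RExpr.val, Store.setReg, h11, closeList]
      by_cases hx2 : x = 2
      · subst hx2
        simp
      · rw [Function.update_of_ne hx2, Function.update_of_ne hx2, h₄.1 x (by omega),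
          hr₃ x (by omega), hr₁ x (by omega) (by omega)]
    · simp only [Set.mem_insert_iff, Set.mem_singleton_iff, not_or] at ha
      exact (h₄.2.1 a (by simpa using ha.1)).trans ((ht₃ a ha.2.2).trans (ht₁ a ha.2.1))
    · exact h₄.2.2.trans ((congrArg Store.ctx hs₃').trans (h₂.2.2.trans (h₁.2.2.trans hc₀)))
    · exact (((Stamped.of_tab ht₀).trans hst₁).trans (hst₂.trans (Stamped.of_tab ht₃'))).trans
        (hst₄.trans (Stamped.of_tab rfl))
    · change Holds (s₄.tab 1) (closeList L r)
      unfold closeList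
      convert hH using 2

end Prune

section NetLists

variable {d : ℕ} {L M : List (Pt d × ℕ)} {σ : ℝ} {q : Pt d × ℕ}

/-! ### Nets -/

/-- The list `M` results from moving the points of `L` to a subset of these points with mutual
distances greater than `σ`. -/
structure NetOf (σ : ℝ) (L M : List (Pt d × ℕ)) : Prop where
  nodup : (M.map Prod.fst).Nodup
  pos : ∀ q ∈ M, 0 < q.2
  subset : ∀ q ∈ M, q.1 ∈ L.map Prod.fst
  sep : ∀ q ∈ M, ∀ q' ∈ M, q.1 ≠ q'.1 → σ < dist q.1 q'.1
  exists_move : ∃ g : Pt d → Pt d, (∀ q ∈ L, dist q.1 (g q.1) ≤ d * (2 * σ)) ∧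
    ofList M = (ofList L).mapDomain g

theorem netOf_nil : NetOf σ ([] : List (Pt d × ℕ)) [] :=
  ⟨by simp, by simp, by simp, by simp, id, by simp, by simp⟩

theorem mapDomain_ofList_update (hq : q.1 ∉ L.map Prod.fst) (g : Pt d → Pt d) (p : Pt d) :
    (ofList (L ++ [q])).mapDomain (Function.update g q.1 p) =
      (ofList L).mapDomain g + Finsupp.single p q.2 := by
  rw [ofList_append, Finsupp.mapDomain_add]
  congr 1
  · refine Finsupp.mapDomain_congr fun x hx => Function.update_of_ne ?_ _ _
    rintro rfl
    exact Finsupp.mem_support_iff.1 hx (ofList_eq_zero hq)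
  · simp [Finsupp.mapDomain_single]

theorem ofList_set {t : ℕ} (ht : t < M.length) (w : ℕ) :
    ofList (M.set t (M[t].1, M[t].2 + w)) = ofList M + Finsupp.single M[t].1 w := by
  induction M generalizing t with
  | nil => simp at ht
  | cons m M ih =>
    cases t with
    | zero =>
      simp only [List.set_cons_zero, ofList_cons, List.getElem_cons_zero, Finsupp.single_add]
      abel
    | succ t =>
      simp only [List.set_cons_succ, ofList_cons, List.getElem_cons_succ]
      rw [ih, add_assoc]

theorem map_fst_set {t : ℕ} (ht : t < M.length) (w : ℕ) :
    (M.set t (M[t].1, w)).map Prod.fst = M.map Prod.fst := by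
  rw [List.map_set]
  refine List.ext_getElem (by simp) fun i h₁ h₂ => ?_
  rw [List.getElem_set]
  split_ifs with h
  · subst h
    simp
  · rfl

/-- Points in equal or adjacent cells are at distance at most `d * (2 * σ)`. Only the weight of the
net point changes, so separation is inherited. -/
theorem NetOf.merge (h : NetOf σ L M) (hσ : 0 < σ) (hq : q.1 ∉ L.map Prod.fst) {t : ℕ}
    (ht : t < M.length) (hc : ∀ k, |cell σ q.1 k - cell σ M[t].1 k| ≤ 1) :
    NetOf σ (L ++ [q]) (M.set t (M[t].1, M[t].2 + q.2)) := by
  obtain ⟨g, hg₁, hg₂⟩ := h.exists_move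
  have hmem : ∀ p, p ∈ M.set t (M[t].1, M[t].2 + q.2) → p.1 ∈ M.map Prod.fst := by
    intro p hp
    rw [← map_fst_set ht (M[t].2 + q.2)]
    exact List.mem_map_of_mem hp
  refine ⟨?_, ?_, ?_, ?_, Function.update g q.1 M[t].1, ?_, ?_⟩
  · rw [map_fst_set ht]
    exact h.nodup
  · intro p hp
    rcases List.mem_or_eq_of_mem_set hp with hp | rfl
    · exact h.pos p hp
    · exact Nat.add_pos_left (h.pos _ (List.getElem_mem ht)) _
  · intro p hp
    obtain ⟨m, hm, he⟩ := List.mem_map.1 (hmem p hp)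
    rw [← he, List.map_append]
    exact List.mem_append_left _ (h.subset m hm)
  · intro p hp p' hp' hne
    obtain ⟨m, hm, he⟩ := List.mem_map.1 (hmem p hp)
    obtain ⟨m', hm', he'⟩ := List.mem_map.1 (hmem p' hp')
    rw [← he, ← he'] at hne ⊢
    exact h.sep m hm m' hm' hne
  · intro p hp
    rcases List.mem_append.1 hp with hp | hp
    · rw [Function.update_of_ne (by rintro e; exact hq (e ▸ List.mem_map_of_mem hp))]
      exact hg₁ p hp
    · rw [List.mem_singleton.1 hp, Function.update_self]
      refine (dist_le_of_cell hσ (R := 1) zero_le_one hc).trans_eq ?_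
      push_cast
      ring
  · rw [mapDomain_ofList_update hq, ← hg₂, ofList_set ht]

/-- A net point within distance `σ` of `q` would lie in the cell of `q` or in an adjacent one; if
there is none, `q` can become a net point and stay in place. -/
theorem NetOf.append (h : NetOf σ L M) (hσ : 0 < σ) (hq : q.1 ∉ L.map Prod.fst) (hpos : 0 < q.2)
    (hc : ∀ m ∈ M, ¬ ∀ k, |cell σ m.1 k - cell σ q.1 k| ≤ 1) :
    NetOf σ (L ++ [q]) (M ++ [q]) := by
  obtain ⟨g, hg₁, hg₂⟩ := h.exists_move
  have hsep : ∀ m ∈ M, σ < dist m.1 q.1 := by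
    intro m hm
    by_contra hle
    exact hc m hm fun k => by simpa using cell_of_dist_le hσ (R := 1) (by simpa using hle) k
  refine ⟨?_, ?_, ?_, ?_, Function.update g q.1 q.1, ?_, ?_⟩
  · rw [List.map_append, List.nodup_append]
    refine ⟨h.nodup, by simp, ?_⟩
    rintro p hp p' hp' rfl
    obtain ⟨m, hm, rfl⟩ := List.mem_map.1 hp
    have he : m.1 = q.1 := by simpa using hp'
    exact hq (he ▸ h.subset m hm)
  · intro p hp
    rcases List.mem_append.1 hp with hp | hp
    · exact h.pos p hp
    · rwa [List.mem_singleton.1 hp]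
  · intro p hp
    rw [List.map_append, List.mem_append]
    rcases List.mem_append.1 hp with hp | hp
    · exact Or.inl (h.subset p hp)
    · exact Or.inr (by simp [List.mem_singleton.1 hp])
  · intro p hp p' hp' hne
    rcases List.mem_append.1 hp with hp | hp <;> rcases List.mem_append.1 hp' with hp' | hp'
    · exact h.sep p hp p' hp' hne
    · rw [List.mem_singleton.1 hp']
      exact hsep p hp
    · rw [List.mem_singleton.1 hp, dist_comm]
      exact hsep p' hp'
    · exact absurd (by rw [List.mem_singleton.1 hp, List.mem_singleton.1 hp']) hne
  · intro p hp
    rcases List.mem_append.1 hp with hp | hp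
    · rw [Function.update_of_ne (by rintro e; exact hq (e ▸ List.mem_map_of_mem hp))]
      exact hg₁ p hp
    · rw [List.mem_singleton.1 hp, Function.update_self, dist_self]
      positivity
  · rw [mapDomain_ofList_update hq, ← hg₂, ofList_append]
    simp

end NetLists

/-! ### The program that computes a net -/

section Net

variable {d : ℕ} {Ctx : Type u} {O : Procedures d Ctx} {s : Store Ctx} {Q : Store Ctx → Prop}
  {L M : List (Pt d × ℕ)} {N : ℕ} {σ r : ℝ} {q : Pt d × ℕ}

theorem GridAt.congr {T : List ℤ → ℝ} {N : ℤ} {M' : List (Pt d × ℕ)} (h : GridAt T N σ M)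
    (hM : M'.map Prod.fst = M.map Prod.fst) : GridAt T N σ M' := by
  have hlen : M'.length = M.length := by simpa using congrArg List.length hM
  intro c
  rcases h c with ⟨h₁, h₂⟩ | ⟨i, hi, h₁, h₂⟩
  · refine Or.inl ⟨h₁, fun q hq => ?_⟩
    have : q.1 ∈ M.map Prod.fst := hM ▸ List.mem_map_of_mem hq
    obtain ⟨q', hq', he⟩ := List.mem_map.1 this
    rw [← he]
    exact h₂ q' hq'
  · refine Or.inr ⟨i, hlen ▸ hi, h₁, ?_⟩
    have : (M'.map Prod.fst)[i]'(by simpa [hlen] using hi) =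
        (M.map Prod.fst)[i]'(by simpa using hi) := by
      simp only [hM]
    rw [List.getElem_map, List.getElem_map] at this
    rw [this, h₂]

/-- A later hit may overwrite an earlier one: any net point in an adjacent cell will do. -/
def scanStep (d : ℕ) (o : Fin d → ℤ) : Cmd :=
  .seq (.load 13 2 (cellKey 3 8 16 o)) (.ite (.const 0) (.reg 13) (.set 12 (.reg 13)) .skip)

theorem within_scanStep (o : Fin d → ℤ) : (scanStep d o).Within 12 ∅ :=
  ⟨by simp [Cmd.Within], le_rfl, trivial⟩

theorem ev_scanSteps (os : List (Fin d → ℤ)) (hN : s.reg 3 = N) (hσ : s.reg 8 = σ)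
    (hG : GridAt (s.tab 2) N σ M) (hq : BufAt s.reg 16 q) :
    BufAt ((seqs (os.map (scanStep d))).ev s).reg 16 q ∧
    ((((seqs (os.map (scanStep d))).ev s).reg 12 = s.reg 12 ∧
      ∀ o ∈ os, ∀ m ∈ M, cell σ m.1 ≠ cell σ q.1 + o) ∨
    ∃ i, ∃ h : i < M.length, ((seqs (os.map (scanStep d))).ev s).reg 12 = i + 1 ∧
      ∃ o ∈ os, cell σ M[i].1 = cell σ q.1 + o) := by
  induction os generalizing s with
  | nil => simpa using hq
  | cons o os ih =>
    have hkey := key_cellKey (t := 3) (σ := 8) o hN hq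
    rw [hσ] at hkey
    have hs := (within_scanStep o).same s
    simp only [List.map_cons, seqs_cons, ev_seq]
    have hev : ∃ v w, (scanStep d o).ev s = (s.setReg 13 v).setReg 12 w ∧
        ((w = s.reg 12 ∧ ∀ m ∈ M, cell σ m.1 ≠ cell σ q.1 + o) ∨
        ∃ i, ∃ h : i < M.length, w = i + 1 ∧ cell σ M[i].1 = cell σ q.1 + o) := by
      simp only [scanStep, ev_seq, Cmd.ev, hkey]
      rcases hG (cell σ q.1 + o) with ⟨h₁, h₂⟩ | ⟨i, hi, h₁, h₂⟩
      · refine ⟨0, s.reg 12, ?_, Or.inl ⟨rfl, h₂⟩⟩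
        have : (s.setReg 13 0).reg 12 = s.reg 12 := by simp [Store.setReg]
        rw [h₁, ← this]
        rw [if_neg (by simp [RExpr.val, Store.setReg])]
        simp only [Store.setReg, Function.update_eq_self]
      · refine ⟨i + 1, i + 1, ?_, Or.inr ⟨i, hi, rfl, h₂⟩⟩
        rw [h₁, if_pos]
        · simp [RExpr.val, Store.setReg]
        · simp only [RExpr.val, Store.setReg, Function.update_self, Rat.cast_zero]
          positivity
    obtain ⟨v, w, hev, hw⟩ := hev
    have hb : BufAt ((scanStep d o).ev s).reg 16 q := hq.congr fun x hx _ => by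
      simp only [hev, Store.setReg]
      rw [Function.update_of_ne (by omega), Function.update_of_ne (by omega)]
    have h12 : ((scanStep d o).ev s).reg 12 = w := by simp [hev, Store.setReg]
    obtain ⟨h₁, h₂⟩ := ih (s := (scanStep d o).ev s) ((hs.1 _ (by norm_num)).trans hN)
      ((hs.1 _ (by norm_num)).trans hσ) (by rwa [hs.2.1 2 (by simp)]) hb
    refine ⟨h₁, ?_⟩
    rcases h₂ with ⟨h₂, h₃⟩ | ⟨i, hi, h₂, o', ho', h₃⟩
    · rw [h12] at h₂
      rcases hw with ⟨rfl, hw⟩ | ⟨i, hi, rfl, hw⟩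
      · refine Or.inl ⟨h₂, fun o' ho' => ?_⟩
        rcases List.mem_cons.1 ho' with rfl | ho'
        · exact hw
        · exact h₃ o' ho'
      · exact Or.inr ⟨i, hi, h₂, o, by simp, hw⟩
    · exact Or.inr ⟨i, hi, h₂, o', by simp [ho'], h₃⟩

/-- A greedy net built in place: if a cell with offsets in `{-1, 0, 1}` holds a net point, the
weight of the current point is added to it; otherwise the current point is appended to the net and
entered into the grid. The net grows at the front of table `1`, behind the reading position. -/
def netBody (d : ℕ) : Cmd :=
  .seq (loadRow d 1 10 16) (.seq (.set 12 (.const 0))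
    (.seq (seqs ((offsets d 1).map (scanStep d)))
      (.ite (.const 0) (.reg 12)
        (.seq (.load 13 1 [.sub (.reg 12) (.const 1), .const (d : ℚ)])
          (.store 1 [.sub (.reg 12) (.const 1), .const (d : ℚ)] (.add (.reg 13) (.reg (16 + d)))))
        (.seq (storeRow d 16 11 1) (.seq (.set 11 (.add (.reg 11) (.const 1)))
          (.store 2 (cellKey 3 8 16 (0 : Fin d → ℤ)) (.reg 11)))))))

theorem within_netBody : (netBody d).Within 11 {1, 2} := by
  refine ⟨within_loadRow _ _ _ (by norm_num), by simp [Cmd.Within], within_seqs fun c hc => ?_,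
    ⟨by simp [Cmd.Within], by simp [Cmd.Within]⟩, within_storeRow _ _ (by simp), le_rfl,
    by simp [Cmd.Within]⟩
  obtain ⟨o, -, rfl⟩ := List.mem_map.1 hc
  exact ⟨by simp [Cmd.Within], by simp [Cmd.Within], trivial⟩

theorem stamping_netBody : (netBody d).Stamping := by
  refine ⟨stamping_loadRow _ _ _, trivial, stamping_seqs fun c hc => ?_,
    ⟨trivial, fun h => absurd h (lt_irrefl _)⟩, stamping_storeRow _ _, trivial, fun _ => rfl⟩
  obtain ⟨o, -, rfl⟩ := List.mem_map.1 hc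
  exact ⟨trivial, trivial, trivial⟩

/-- The effect of the second half of the loop body. -/
theorem ev_netBody {k : ℕ} (hk : k < L.length) (hσ0 : 0 < σ) (hN : s.reg 3 = N)
    (hσ : s.reg 8 = σ) (hx : s.reg 10 = k) (h11 : s.reg 11 = M.length) (hMk : M.length ≤ k)
    (hM : Holds (s.tab 1) M)
    (hL : ∀ i (h : i < L.length), k ≤ i → RowAt (s.tab 1) i L[i]) (hG : GridAt (s.tab 2) N σ M)
    (hnet : NetOf σ (L.take k) M) (hq : L[k].1 ∉ (L.take k).map Prod.fst) (hpos : 0 < L[k].2) :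
    ∃ M' : List (Pt d × ℕ), ((netBody d).ev s).reg 11 = M'.length ∧ M'.length ≤ k + 1 ∧
      Holds (((netBody d).ev s).tab 1) M' ∧
      (∀ i (h : i < L.length), k + 1 ≤ i → RowAt (((netBody d).ev s).tab 1) i L[i]) ∧
      GridAt (((netBody d).ev s).tab 2) N σ M' ∧ NetOf σ (L.take k ++ [L[k]]) M' := by
  set q := L[k] with hqdef
  have hb := ev_loadRow_buf (d := d) 1 10 16 s (by norm_num) hx (hL k hk le_rfl)
  set s₁ := ((loadRow d 1 10 16).ev s).setReg 12 0 with hs₁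
  have hr₁ : ∀ x < 16, x ≠ 12 → s₁.reg x = s.reg x := fun x hx hx' => by
    rw [hs₁, Store.setReg]
    simp only
    rw [Function.update_of_ne hx']
    exact ev_loadRow_reg 1 10 16 s (by norm_num) (Or.inl hx)
  have ht₁ : s₁.tab = s.tab := ev_loadRow_tab (d := d) 1 10 16 s (by norm_num)
  have h12₁ : s₁.reg 12 = 0 := by simp [hs₁, Store.setReg]
  have hb₁ : BufAt s₁.reg 16 q := hb.congr fun x hx _ => Function.update_of_ne (by omega) _ _
  obtain ⟨hb₂, hscan⟩ := ev_scanSteps (M := M) (offsets d 1)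
    ((hr₁ 3 (by norm_num) (by norm_num)).trans hN)
    ((hr₁ 8 (by norm_num) (by norm_num)).trans hσ) (by rwa [ht₁]) hb₁
  have hsame : Same 12 ∅ s₁ ((seqs ((offsets d 1).map (scanStep d))).ev s₁) := by
    refine (within_seqs fun c hc => ?_ : (seqs ((offsets d 1).map (scanStep d))).Within 12 ∅).same _
    obtain ⟨o, -, rfl⟩ := List.mem_map.1 hc
    exact within_scanStep o
  have hev : (netBody d).ev s = (Cmd.ite (.const 0) (.reg 12)
        (.seq (.load 13 1 [.sub (.reg 12) (.const 1), .const (d : ℚ)])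
          (.store 1 [.sub (.reg 12) (.const 1), .const (d : ℚ)] (.add (.reg 13) (.reg (16 + d)))))
        (.seq (storeRow d 16 11 1) (.seq (.set 11 (.add (.reg 11) (.const 1)))
          (.store 2 (cellKey 3 8 16 (0 : Fin d → ℤ)) (.reg 11))))).ev
      ((seqs ((offsets d 1).map (scanStep d))).ev s₁) := by
    simp [netBody, hs₁, Cmd.ev, RExpr.val]
  rw [hev]
  rw [h12₁] at hscan
  generalize (seqs ((offsets d 1).map (scanStep d))).ev s₁ = s₂ at *
  have ht₂ : s₂.tab = s.tab := by
    funext a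
    rw [hsame.2.1 a (by simp), ht₁]
  have hr₂ : ∀ x < 12, s₂.reg x = s.reg x := fun x hx =>
    (hsame.1 x hx).trans (hr₁ x (by omega) (by omega))
  rcases hscan with ⟨h12, hno⟩ | ⟨t, ht, h12, o, ho, hcell⟩
  · rw [ev_ite_neg (by simp [RExpr.val, h12])]
    have h11₂ : s₂.reg 11 = M.length := (hr₂ 11 (by norm_num)).trans h11
    obtain ⟨e₁, e₂, e₃, -, -⟩ := ev_storeRow d 16 11 1 s₂ h11₂
    set s₃ := (storeRow d 16 11 1).ev s₂ with hs₃
    set s₄ := s₃.setReg 11 ((M.length : ℝ) + 1) with hs₄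
    have hb₄ : BufAt s₄.reg 16 q := hb₂.congr fun x hx _ => by
      rw [← e₁]
      exact Function.update_of_ne (by omega) _ _
    have hr₄ : ∀ x < 11, s₄.reg x = s.reg x := fun x hx => by
      rw [← hr₂ x (by omega), ← e₁]
      exact Function.update_of_ne (by omega) _ _
    have hkey := key_cellKey (t := 3) (σ := 8) (0 : Fin d → ℤ)
      ((hr₄ 3 (by norm_num)).trans hN) hb₄
    rw [hr₄ 8 (by norm_num), hσ, add_zero] at hkey
    have hev' : (Cmd.seq (storeRow d 16 11 1) (.seq (.set 11 (.add (.reg 11) (.const 1)))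
          (.store 2 (cellKey 3 8 16 (0 : Fin d → ℤ)) (.reg 11)))).ev s₂ =
        s₄.setTab 2 ((N : ℤ) :: List.ofFn (cell σ q.1)) ((M.length : ℝ) + 1) := by
      have h11₄ : s₃.setReg 11 (RExpr.val s₃.reg (.add (.reg 11) (.const 1))) = s₄ := by
        simp [RExpr.val, e₁, h11₂, hs₄]
      simp only [Cmd.ev, ← hs₃, h11₄, hkey]
      simp [hs₄, RExpr.val, Store.setReg]
    rw [hev']
    have ht1 : (s₄.setTab 2 ((N : ℤ) :: List.ofFn (cell σ q.1)) ((M.length : ℝ) + 1)).tab 1 =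
        s₃.tab 1 := by simp [Store.setTab, hs₄, Store.setReg]
    rw [ht1]
    refine ⟨M ++ [q], ?_, by simpa using hMk, ?_, ?_, ?_, ?_⟩
    · simp [Store.setTab, hs₄, Store.setReg]
    · intro i hi
      rw [List.length_append, List.length_singleton] at hi
      rcases Nat.lt_succ_iff_lt_or_eq.1 hi with hi' | rfl
      · rw [List.getElem_append_left hi']
        refine ev_storeRow_other 16 11 1 s₂ h11₂ hi'.ne ?_
        rw [ht₂]
        exact hM i hi'
      · rw [List.getElem_append_right le_rfl]
        simpa using ev_storeRow_same 16 11 1 s₂ h11₂ hb₂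
    · intro i hi hik
      refine ev_storeRow_other 16 11 1 s₂ h11₂ (by omega) ?_
      rw [ht₂]
      exact hL i hi (by omega)
    · have : (s₄.setTab 2 ((N : ℤ) :: List.ofFn (cell σ q.1)) ((M.length : ℝ) + 1)).tab 2 =
          Function.update (s.tab 2) ((N : ℤ) :: List.ofFn (cell σ q.1)) ((M.length : ℝ) + 1) := by
        rw [← ht₂, ← e₃ 2 (by norm_num)]
        simp [Store.setTab, hs₄, Store.setReg]
      rw [this]
      exact hG.append
    · refine hnet.append hσ0 hq hpos fun m hm hle => hno (cell σ m.1 - cell σ q.1)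
        (mem_offsets.2 (by simpa using hle)) m hm ?_
      abel
  · have hlt : RExpr.val s₂.reg (.const 0) < RExpr.val s₂.reg (.reg 12) := by
      simp only [RExpr.val, h12, Rat.cast_zero]
      positivity
    rw [ev_ite_pos hlt]
    have hk₂ : s₂.key [.sub (.reg 12) (.const 1), .const (d : ℚ)] = [(t : ℤ), (d : ℤ)] := by
      simp [Store.key, RExpr.val, h12]
    have hk₃ : ∀ v, (s₂.setReg 13 v).key [.sub (.reg 12) (.const 1), .const (d : ℚ)] =
        [(t : ℤ), (d : ℤ)] := fun v => by
      simp [Store.key, RExpr.val, Store.setReg, h12]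
    have hbd : s₂.reg (16 + d) = q.2 := hb₂.2
    have hev' : (Cmd.seq (.load 13 1 [.sub (.reg 12) (.const 1), .const (d : ℚ)])
          (.store 1 [.sub (.reg 12) (.const 1), .const (d : ℚ)]
            (.add (.reg 13) (.reg (16 + d))))).ev s₂ =
        (s₂.setReg 13 M[t].2).setTab 1 [(t : ℤ), (d : ℤ)] ((M[t].2 + q.2 : ℕ) : ℝ) := by
      have h13 : s₂.tab 1 [(t : ℤ), (d : ℤ)] = M[t].2 := by
        rw [ht₂]
        exact (hM t ht).2
      simp only [Cmd.ev, hk₂, hk₃, h13]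
      have : (s₂.setReg 13 (M[t].2 : ℝ)).reg (16 + d) = s₂.reg (16 + d) :=
        Function.update_of_ne (by omega) _ _
      simp only [RExpr.val, this, hbd]
      simp [Store.setReg]
    rw [hev']
    have hT : ((s₂.setReg 13 (M[t].2 : ℝ)).setTab 1 [(t : ℤ), (d : ℤ)]
        ((M[t].2 + q.2 : ℕ) : ℝ)).tab 1 =
        Function.update (s.tab 1) [(t : ℤ), (d : ℤ)] ((M[t].2 + q.2 : ℕ) : ℝ) := by
      simp [Store.setTab, Store.setReg, ht₂]
    have hother : ∀ i ≠ t, ∀ p : Pt d × ℕ, RowAt (s.tab 1) i p → RowAt (Function.update (s.tab 1)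
        [(t : ℤ), (d : ℤ)] ((M[t].2 + q.2 : ℕ) : ℝ)) i p := fun i hi p hp =>
      hp.congr fun k => Function.update_of_ne (by simp [hi]) _ _
    rw [hT]
    refine ⟨M.set t (M[t].1, M[t].2 + q.2), ?_, by simpa using hMk.trans (Nat.le_succ k), ?_, ?_,
      ?_, ?_⟩
    · rw [List.length_set, ← h11, ← hr₂ 11 (by norm_num)]
      simp [Store.setTab, Store.setReg]
    · intro i hi
      by_cases hit : i = t
      · subst hit
        rw [List.getElem_set_self]
        refine ⟨fun k => ?_, by simp⟩
        rw [Function.update_of_ne]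
        · exact (hM i ht).1 k
        · simpa using k.2.ne
      · rw [List.getElem_set_ne (Ne.symm hit)]
        exact hother i hit _ (hM i (by simpa using hi))
    · exact fun i hi hik => hother i (by omega) _ (hL i hi (by omega))
    · have : ((s₂.setReg 13 (M[t].2 : ℝ)).setTab 1 [(t : ℤ), (d : ℤ)]
          ((M[t].2 + q.2 : ℕ) : ℝ)).tab 2 = s.tab 2 := by
        simp [Store.setTab, Store.setReg, ht₂]
      rw [this]
      exact hG.congr (map_fst_set ht _)
    · refine hnet.merge hσ0 hq ht fun k => ?_
      have := mem_offsets.1 ho k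
      rw [hcell]
      simpa [abs_neg] using this

theorem Det.netLoop {P : WSet d} (hE : Enumerates L P) (hσ0 : 0 < σ) (hn : s.reg 2 = L.length)
    (hN : s.reg 3 = N) (hσ : s.reg 8 = σ) (h11 : s.reg 11 = 0) (hL : Holds (s.tab 1) L)
    (h0 : ∀ l, s.tab 2 ((N : ℤ) :: l) = 0) :
    Det O (countLoop 10 2 (netBody d)) s ((L.length + 1) * ((netBody d).cost + 12))
      fun s' => Same 10 {1, 2} s s' ∧ Stamped N s s' ∧ ∃ M : List (Pt d × ℕ), NetOf σ L M ∧
        s'.reg 11 = M.length ∧ Holds (s'.tab 1) M := by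
  refine (Det.forLoop (by norm_num) within_netBody.simple (fun k s' => Same 10 {1, 2} s s' ∧
    Stamped N s s' ∧ ∃ M : List (Pt d × ℕ), s'.reg 11 = M.length ∧ M.length ≤ k ∧
      Holds (s'.tab 1) M ∧ (∀ i (h : i < L.length), k ≤ i → RowAt (s'.tab 1) i L[i]) ∧
      GridAt (s'.tab 2) N σ M ∧ NetOf σ (L.take k) M) hn ?_ ?_).mono le_rfl ?_
  · refine ⟨Same.setReg _ _ _ le_rfl, Stamped.of_tab rfl, [], ?_, le_rfl, ?_,
      fun i hi _ => hL i hi, GridAt.nil h0, netOf_nil⟩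
    · simpa [Store.setReg] using h11
    · intro i hi
      simp at hi
  · rintro k hk s₁ hx hy ⟨h₁, h₂, M, h₃, h₄, h₅, h₆, h₇, h₈⟩
    have hs := (within_netBody (d := d)).same s₁
    have hN₁ : s₁.reg 3 = N := (h₁.1 3 (by norm_num)).trans hN
    have hst : Stamped (N : ℤ) s₁ ((netBody d).ev s₁) :=
      stamping_netBody.stamped within_netBody (by norm_num) (by simpa using hN₁)
    refine ⟨(hs.1 _ (by norm_num)).trans hx, (hs.1 _ (by norm_num)).trans hy,
      (h₁.trans (hs.mono (by norm_num) subset_rfl)).trans (Same.setReg _ _ _ le_rfl),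
      (h₂.trans hst).trans (Stamped.of_tab rfl), ?_⟩
    have hq : L[k].1 ∉ (L.take k).map Prod.fst := by
      have := hE.1
      rw [← List.take_append_drop k L, List.map_append, List.nodup_append] at this
      intro h
      refine this.2.2 _ h _ ?_ rfl
      exact List.mem_map_of_mem (by
        rw [List.drop_eq_getElem_cons hk]
        exact List.mem_cons_self)
    obtain ⟨M', h₁', h₂', h₃', h₄', h₅', h₆'⟩ := ev_netBody hk hσ0 hN₁
      ((h₁.1 8 (by norm_num)).trans hσ) hx h₃ h₄ h₅ h₆ h₇ h₈ hq (hE.pos (List.getElem_mem hk))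
    refine ⟨M', ?_, h₂', h₃', h₄', h₅', ?_⟩
    · simpa [Store.setReg] using h₁'
    · rwa [List.take_append_getElem hk] at h₆'
  · rintro s' ⟨-, h₁, h₂, M, h₃, -, h₅, -, -, h₈⟩
    rw [List.take_length] at h₈
    exact ⟨h₁, h₂, M, h₈, h₃, h₅⟩

/-- Move the current points to a net with mutual distances greater than twice `reg 4`. -/
def netCmd (d : ℕ) : Cmd :=
  .seq (.set 8 (.mul (.const 2) (.reg 4))) (.seq (.set 11 (.const 0))
    (.seq (countLoop 10 2 (netBody d)) (.set 2 (.reg 11))))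

def netCost (d : ℕ) : ℕ := (netBody d).cost + 50

theorem Det.net {P : WSet d} (hE : Enumerates L P) (hn : s.reg 2 = L.length) (hN : s.reg 3 = N)
    (hr : s.reg 4 = r) (h0 : 0 < r) (hL : Holds (s.tab 1) L)
    (hfresh : ∀ a, 1 < a → ∀ l, s.tab a ((N : ℤ) :: l) = 0) :
    Det O (netCmd d) s (netCost d * (L.length + 1)) fun s' =>
      ∃ M, NetOf (2 * r) L M ∧ Replaced N M s s' := by
  set s₀ := (Cmd.set 11 (.const 0)).ev ((Cmd.set 8 (.mul (.const 2) (.reg 4))).ev s) with hs₀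
  have hs₀' : s₀ = (s.setReg 8 (2 * r)).setReg 11 0 := by
    simp [hs₀, Cmd.ev, RExpr.val, hr]
  have h₀ : ∀ x ≠ 8, x ≠ 11 → s₀.reg x = s.reg x := fun x hx hx' => by
    simp [hs₀', Store.setReg, hx, hx']
  have ht₀ : s₀.tab = s.tab := by rw [hs₀']; rfl
  refine (Det.simple_seq (c₁ := .set 8 _) trivial (Det.simple_seq (c₁ := .set 11 _) trivial
    (Det.seq_of (Det.netLoop (σ := 2 * r) (N := N) (s := s₀) hE (by positivity)
      ((h₀ 2 (by norm_num) (by norm_num)).trans hn) ((h₀ 3 (by norm_num) (by norm_num)).trans hN)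
      (by simp [hs₀', Store.setReg]) (by simp [hs₀', Store.setReg]) (by rwa [ht₀])
      (by rw [ht₀]; exact hfresh 2 (by norm_num))) (τ₂ := 2)
      fun s₁ ⟨h₁, hst₁, M, hM, h11, hH⟩ => ?_))).mono ?_ fun _ h => h
  · refine (Det.of_simple (c := .set 2 (.reg 11)) trivial ⟨M, hM, ⟨fun x hx => ?_,
      fun a ha => ?_, ?_⟩, ?_, ?_⟩).mono (by norm_num [Cmd.cost, RExpr.cost]) fun _ h => h
    · simp only [Cmd.ev, RExpr.val, Store.setReg, h11]
      by_cases hx2 : x = 2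
      · subst hx2
        simp
      · rw [Function.update_of_ne hx2, Function.update_of_ne hx2, h₁.1 x (by omega),
          h₀ x (by omega) (by omega)]
    · simp only [Set.mem_insert_iff, Set.mem_singleton_iff, not_or] at ha
      exact (h₁.2.1 a (by simp [ha.1, ha.2.1])).trans (by rw [ht₀]; rfl)
    · exact h₁.2.2.trans (by rw [hs₀']; rfl)
    · exact ((Stamped.of_tab ht₀).trans hst₁).trans (Stamped.of_tab rfl)
    · exact hH
  · simp only [Cmd.cost, RExpr.cost, netCost]
    push_cast
    nlinarith [(Nat.cast_nonneg L.length : (0 : ℝ) ≤ L.length)]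

end Net

section Main

variable {d : ℕ} {Ctx : Type u} {O : Procedures d Ctx} {N : Problem d Ctx} {v : ℝ}
  {P : WSet d} {Γ : Ctx} {L M : List (Pt d × ℕ)} {r C φ : ℝ} {s s' s₀ : Store Ctx}

/-! ### Invariants of the problem -/

theorem Problem.one_lt_size (hI : N.Inst P Γ) (hf : 0 < N.f P Γ) : 1 < size P := by
  by_contra h
  exact hf.ne' (N.f_eq_zero P Γ hI (not_lt.1 h))

/-- The value of the target on the pair is a good approximation of `v`, where the error is
bounded by the minimal distance of the points. -/
structure Good (N : Problem d Ctx) (v : ℝ) (P : WSet d) (Γ : Ctx) : Prop where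
  inst : N.Inst P Γ
  pos : 0 < N.f P Γ
  error : ∃ m : ℝ, 0 ≤ m ∧ (∀ p ∈ P.support, ∀ q ∈ P.support, q ≠ p → m ≤ dist p q) ∧
    |v - N.f P Γ| ≤ 8 * (d + 1) * m ∧ 8 * (d + 1) * m ≤ N.f P Γ / 2

theorem Good.init (hI : N.Inst P Γ) (hf : 0 < N.f P Γ) : Good N (N.f P Γ) P Γ :=
  ⟨hI, hf, 0, le_rfl, fun _ _ _ _ _ => dist_nonneg, by simp, by rw [mul_zero]; linarith⟩

/-- The second error bound in `Good` makes the current target a constant factor approximation of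
`v`, which suffices for starting the final search. -/
theorem Good.le (h : Good N v P Γ) : N.f P Γ / 2 ≤ v ∧ v ≤ 3 / 2 * N.f P Γ := by
  obtain ⟨m, -, -, h₁, h₂⟩ := h.error
  have := abs_le.1 h₁
  constructor <;> linarith

/-- A subset of the points has no smaller distances and the target is the same, so the old `m` still
works. -/
theorem Good.prune (h : Good N v P Γ) (hP : HasPrune N O C) (hE : Enumerates L P)
    (hr : N.f P Γ < r) : Good N v (closePts P r) (O.update r L Γ) := by
  obtain ⟨h₁, h₂, -⟩ := hP P Γ L r h.inst hE h.pos hr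
  obtain ⟨m, hm, hsep, h₃⟩ := h.error
  refine ⟨h₁, h₂ ▸ h.pos, m, hm, fun p hp q hq => ?_, h₂ ▸ h₃⟩
  rw [closePts, Finsupp.support_filter, Finset.mem_filter] at hp hq
  exact hsep p hp.1 q hq.1

/-- The new lower bound for distances is `2 * r`. As `m ≤ r`, the old error and the new one, each at
most `8 (d + 1) r`, add up to at most `8 (d + 1) (2 r)`. The new target exceeds `(40 - 8) (d + 1)
r`, which is twice that; this is where the constant `40` comes from. -/
theorem Good.net (h : Good N v P Γ) (hE : Enumerates L P) {p : Pt d} (hp : p ∈ P.support)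
    (hr : IsNearest P.support p r) (h0 : 0 < r) (hM : NetOf (2 * r) L M)
    (hlt : 40 * (d + 1) * r < N.f P Γ) : Good N v (ofList M) Γ := by
  obtain ⟨m, hm, hsep, h₁, h₂⟩ := h.error
  obtain ⟨g, hg, hM'⟩ := hM.exists_move
  have hd : (0 : ℝ) ≤ d := Nat.cast_nonneg d
  have hT : IsTranslation (4 * (d + 1) * r) P (ofList M) := by
    refine ⟨g, fun q hq => ?_, by rw [hM', ← hE.eq_ofList]⟩
    obtain ⟨q', hq', rfl⟩ := List.mem_map.1 (hE.mem_support.1 hq)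
    refine (hg q' hq').trans ?_
    nlinarith
  have h₃ := N.inst_translation P _ Γ _ (by positivity) h.inst hT
  have h₄ := abs_le.1 (N.lipschitz P _ Γ _ (by positivity) h.inst hT)
  -- The radius is itself a distance of two current points, hence at least `m`.
  have hmr : m ≤ r := by
    obtain ⟨⟨q, hq, hne, rfl⟩, -⟩ := hr
    exact hsep p hp q hq hne
  have h₅ : (d + 1) * m ≤ (d + 1) * r := by gcongr
  have h₆ : 0 < (d + 1) * r := by positivity
  have h₇ := abs_le.1 h₁
  have hME := enumerates_ofList hM.nodup hM.pos
  refine ⟨h₃, by nlinarith, 2 * r, by positivity, fun q hq q' hq' hne => ?_, ?_, ?_⟩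
  · obtain ⟨w, hw, rfl⟩ := List.mem_map.1 (hME.mem_support.1 hq)
    obtain ⟨w', hw', rfl⟩ := List.mem_map.1 (hME.mem_support.1 hq')
    exact (hM.sep w hw w' hw' hne.symm).le
  · rw [abs_le]
    constructor <;> nlinarith
  · nlinarith

/-! ### Procedure calls -/

theorem Det.decide {T : ℝ} (hD : HasDecider N O φ T) (hI : N.Inst P Γ) (hE : Enumerates L P)
    (hr0 : 0 < r) {φe re ne : RExpr} {a g : ℕ} (hφ : φe.val s.reg = φ) (hr : re.val s.reg = r)
    (hn : ne.val s.reg = L.length) (hL : Holds (s.tab a) L) (hg : s.ctx g = Γ) :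
    Det O (.callDecider φe re ne a g 14) s (1 + φe.cost + re.cost + ne.cost + T * L.length)
      fun s' => Same 14 ∅ s s' ∧ ((s'.reg 14 = -1 ∧ N.f P Γ < r) ∨ (s'.reg 14 = 1 ∧ r < N.f P Γ) ∨
        (s'.reg 14 = 0 ∧ s'.reg 15 ≤ N.f P Γ ∧ N.f P Γ ≤ φ * s'.reg 15)) := by
  have hpts : s.points d a ⌊ne.val s.reg⌋₊ = L := by
    rw [hn, Nat.floor_natCast]
    exact hL.points
  obtain ⟨h₁, h₂⟩ := hD P Γ L r hI hE hr0
  refine Det.callDecider ?_ ?_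
  · rw [hpts, hφ, hr, hg, hE.length_eq]
    exact h₂
  · rw [hpts, hφ, hr, hg]
    generalize O.decider φ r L Γ = A at h₁
    have hsame : ∀ x y, Same 14 ∅ s ((s.setReg 14 x).setReg 15 y) := fun x y =>
      (Same.setReg _ _ _ le_rfl).trans (Same.setReg _ _ _ (by norm_num))
    cases A with
    | less => exact ⟨hsame _ _, Or.inl ⟨by simp [Store.setAnswer, Store.setReg], h₁⟩⟩
    | greater => exact ⟨hsame _ _, Or.inr (Or.inl ⟨by simp [Store.setAnswer, Store.setReg], h₁⟩)⟩
    | within α =>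
      refine ⟨hsame _ _, Or.inr (Or.inr ⟨by simp [Store.setAnswer, Store.setReg], ?_⟩)⟩
      simpa [Store.setAnswer, Store.setReg, Answer.Correct] using h₁

/-! ### The main loop -/

/-- Stop with an interval obtained from the answer of the decider. -/
def stopWithin (φe : RExpr) : Cmd :=
  .seq (.set 5 (.div (.reg 15) (.const 2)))
    (.seq (.set 6 (.mul (.const (3 / 2)) (.mul φe (.reg 15)))) (.set 7 (.const 1)))

/-- Stop with an interval obtained from the nearest neighbour distance. -/
def stopNearest (d : ℕ) : Cmd :=
  .seq (.set 5 (.div (.reg 4) (.const 2)))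
    (.seq (.set 6 (.mul (.const (60 * ((d + 1 : ℕ) : ℚ))) (.reg 4))) (.set 7 (.const 1)))

/-- Ask whether the value is much larger than the nearest neighbour distance. -/
def askLarge (d : ℕ) (φe : RExpr) : Cmd :=
  .seq (.callDecider φe (.mul (.const (40 * ((d + 1 : ℕ) : ℚ))) (.reg 4)) (.reg 2) 1 0 14)
    (.ite (.const 0) (.reg 14) (netCmd d)
      (.ite (.reg 14) (.const 0) (stopNearest d) (stopWithin φe)))

def branch (d : ℕ) (φe : RExpr) : Cmd :=
  .ite (.reg 14) (.const 0) (.seq (.callUpdate (.reg 4) (.reg 2) 1 0 0) (pruneCmd d))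
    (.ite (.const 0) (.reg 14) (askLarge d φe) (stopWithin φe))

/-- One round of the main loop after the random choice of a point. -/
def round (d : ℕ) (φe : RExpr) : Cmd :=
  .seq (nearestCmd d) (.seq (.callDecider φe (.reg 4) (.reg 2) 1 0 14)
    (.seq (branch d φe) (.set 3 (.add (.reg 3) (.const 1)))))

def mainLoop (d : ℕ) (φe : RExpr) : Cmd :=
  .loop (.reg 7) (.const 1) (.seq (.rand 9 (.sub (.reg 2) (.const 1))) (round d φe))

/-- The input has been kept. -/
def Kept (s₀ s : Store Ctx) : Prop :=
  s.reg 0 = s₀.reg 0 ∧ s.reg 1 = s₀.reg 1 ∧ s.tab 0 = s₀.tab 0 ∧ s.ctx 1 = s₀.ctx 1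

/-- The main loop has found an interval that contains `v`. -/
def Done (d : ℕ) (φ v : ℝ) (s₀ s : Store Ctx) : Prop :=
  Kept s₀ s ∧ s.reg 7 = 1 ∧ 0 < s.reg 5 ∧ s.reg 5 ≤ v ∧ v ≤ s.reg 6 ∧
    s.reg 6 ≤ 120 * (d + 1) * φ * s.reg 5

/-- The memory stores the current points `L` in the course of the main loop. -/
structure Current (N : Problem d Ctx) (v : ℝ) (s₀ s : Store Ctx) (L : List (Pt d × ℕ))
    (P : WSet d) : Prop where
  kept : Kept s₀ s
  running : s.reg 7 = 0
  length : s.reg 2 = L.length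
  holds : Holds (s.tab 1) L
  enum : Enumerates L P
  good : Good N v P (s.ctx 0)

/-- The entries of the tables from `2` on with first index component at least `k` are zero. -/
def Fresh (k : ℤ) (s : Store Ctx) : Prop :=
  ∀ a, 1 < a → ∀ z, k ≤ z → ∀ l, s.tab a (z :: l) = 0

/-- The memories differ only in registers that are not relevant to the main loop. -/
def Alike (s s' : Store Ctx) : Prop :=
  (∀ x < 8, x ≠ 4 → s'.reg x = s.reg x) ∧ s'.tab = s.tab ∧ s'.ctx = s.ctx

theorem Alike.of_same {b : ℕ} (hb : 8 ≤ b) {y : ℝ} (h : Same b ∅ (s.setReg 4 y) s') :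
    Alike s s' :=
  ⟨fun x hx hx4 => (h.1 x (hx.trans_le hb)).trans (Function.update_of_ne hx4 _ _),
    funext fun a => h.2.1 a (by simp), h.2.2⟩

theorem Alike.of_same' {b : ℕ} (hb : 8 ≤ b) (h : Same b ∅ s s') : Alike s s' :=
  ⟨fun x hx _ => h.1 x (hx.trans_le hb), funext fun a => h.2.1 a (by simp), h.2.2⟩

theorem Current.alike (h : Current N v s₀ s L P) (hs : Alike s s') : Current N v s₀ s' L P := by
  obtain ⟨h₁, h₂, h₃⟩ := hs
  obtain ⟨k₁, k₂, k₃, k₄⟩ := h.kept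
  exact ⟨⟨(h₁ 0 (by norm_num) (by norm_num)).trans k₁, (h₁ 1 (by norm_num) (by norm_num)).trans k₂,
    by rw [h₂, k₃], by rw [h₃, k₄]⟩, (h₁ 7 (by norm_num) (by norm_num)).trans h.running,
    (h₁ 2 (by norm_num) (by norm_num)).trans h.length, by rw [h₂]; exact h.holds, h.enum,
    by rw [h₃]; exact h.good⟩

/-- Only entries with stamp `k` have been touched, so the tables look empty to the next round. -/
theorem Fresh.replaced {k : ℕ} (hF : Fresh k s) (hR : Replaced k M s s') :
    Fresh (k + 1) s' := by
  intro a ha z hz l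
  rw [hR.2.1 a ha z l (by omega)]
  exact hF a ha z (by omega) l

theorem Current.replaced {k : ℕ} (hk : Kept s₀ s) (h7 : s.reg 7 = 0) (hR : Replaced k M s s')
    (hE : Enumerates M P) (hG : Good N v P (s.ctx 0)) : Current N v s₀ s' M P := by
  obtain ⟨⟨h₁, h₂, h₃⟩, -, h₄⟩ := hR
  obtain ⟨k₁, k₂, k₃, k₄⟩ := hk
  have hr : ∀ x < 8, x ≠ 2 → s'.reg x = s.reg x := fun x hx hx2 =>
    (h₁ x hx).trans (Function.update_of_ne hx2 _ _)
  refine ⟨⟨(hr 0 (by norm_num) (by norm_num)).trans k₁, (hr 1 (by norm_num) (by norm_num)).trans k₂,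
    (h₂ 0 (by simp)).trans k₃, (congrFun h₃ 1).trans k₄⟩,
    (hr 7 (by norm_num) (by norm_num)).trans h7, ?_, h₄, hE, ?_⟩
  · rw [h₁ 2 (by norm_num)]
    simp [Store.setReg]
  · rw [h₃]
    exact hG

/-- The current target lies in `[α, φ α]` and `v` between one half and three halves of it; the
resulting ratio `3 φ` is within the bound of `Done`. -/
theorem done_stopWithin {φe : RExpr} (hφe : ∀ s : Store Ctx, s.reg 1 = s₀.reg 1 → φe.val s.reg = φ)
    (hφ : 1 ≤ φ) (h : Current N v s₀ s L P) (hα : s.reg 15 ≤ N.f P (s.ctx 0))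
    (hα' : N.f P (s.ctx 0) ≤ φ * s.reg 15) : Done d φ v s₀ ((stopWithin φe).ev s) := by
  obtain ⟨h₁, h₂⟩ := h.good.le
  have hpos : 0 < s.reg 15 := by
    have := h.good.pos.trans_le hα'
    exact pos_of_mul_pos_right this (by linarith)
  have hev : (stopWithin φe).ev s =
      ((s.setReg 5 (s.reg 15 / 2)).setReg 6 (3 / 2 * (φ * s.reg 15))).setReg 7 1 := by
    have := hφe (s.setReg 5 (s.reg 15 / 2)) (by simpa [Store.setReg] using h.kept.2.1)
    simp only [stopWithin, ev_seq, Cmd.ev, RExpr.val, Rat.cast_ofNat, Rat.cast_one, this]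
    simp [Store.setReg]
  have hd : (0 : ℝ) ≤ d := Nat.cast_nonneg d
  have hφα : 0 ≤ φ * s.reg 15 := by positivity
  obtain ⟨k₁, k₂, k₃, k₄⟩ := h.kept
  rw [hev]
  refine ⟨⟨?_, ?_, k₃, k₄⟩, ?_⟩
  · simpa [Store.setReg] using k₁
  · simpa [Store.setReg] using k₂
  · have e₅ : (((s.setReg 5 (s.reg 15 / 2)).setReg 6 (3 / 2 * (φ * s.reg 15))).setReg 7 1).reg 5 =
        s.reg 15 / 2 := by simp [Store.setReg]
    have e₆ : (((s.setReg 5 (s.reg 15 / 2)).setReg 6 (3 / 2 * (φ * s.reg 15))).setReg 7 1).reg 6 =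
        3 / 2 * (φ * s.reg 15) := by simp [Store.setReg]
    rw [e₅, e₆]
    refine ⟨by simp [Store.setReg], by linarith, by linarith, by linarith, ?_⟩
    nlinarith [mul_nonneg hd hφα]

/-- The factors `1 / 2` and `3 / 2` from `Good.le` turn the ratio `40 (d + 1)` into `120 (d + 1)`,
the constant in `Done`. -/
theorem done_stopNearest (hφ : 1 ≤ φ) (h : Current N v s₀ s L P) (h0 : 0 < s.reg 4)
    (hlo : s.reg 4 ≤ N.f P (s.ctx 0)) (hhi : N.f P (s.ctx 0) ≤ 40 * (d + 1) * s.reg 4) :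
    Done d φ v s₀ ((stopNearest d).ev s) := by
  obtain ⟨h₁, h₂⟩ := h.good.le
  have hev : (stopNearest d).ev s =
      ((s.setReg 5 (s.reg 4 / 2)).setReg 6 (60 * (d + 1) * s.reg 4)).setReg 7 1 := by
    simp only [stopNearest, ev_seq, Cmd.ev, RExpr.val]
    simp [Store.setReg]
  have hd : (0 : ℝ) ≤ d := Nat.cast_nonneg d
  obtain ⟨k₁, k₂, k₃, k₄⟩ := h.kept
  rw [hev]
  refine ⟨⟨?_, ?_, k₃, k₄⟩, ?_⟩
  · simpa [Store.setReg] using k₁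
  · simpa [Store.setReg] using k₂
  · have e₅ : (((s.setReg 5 (s.reg 4 / 2)).setReg 6 (60 * (d + 1) * s.reg 4)).setReg 7 1).reg 5 =
        s.reg 4 / 2 := by simp [Store.setReg]
    have e₆ : (((s.setReg 5 (s.reg 4 / 2)).setReg 6 (60 * (d + 1) * s.reg 4)).setReg 7 1).reg 6 =
        60 * (d + 1) * s.reg 4 := by simp [Store.setReg]
    rw [e₅, e₆]
    refine ⟨by simp [Store.setReg], by linarith, by linarith, by linarith, ?_⟩
    have : 0 < (d + 1) * s.reg 4 := by positivity
    nlinarith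

/-- The state after a branch of the main loop: the computation is finished or the number of
points has decreased by at least `k / 2`. -/
def Progress (N : Problem d Ctx) (φ v : ℝ) (s₀ : Store Ctx) (n k : ℕ) (stamp stamp' : ℕ)
    (s : Store Ctx) : Prop :=
  Done d φ v s₀ s ∨ ∃ L P, Current N v s₀ s L P ∧ s.reg 3 = stamp ∧ Fresh stamp' s ∧
    2 * L.length + k ≤ 2 * n

def branchCost (d : ℕ) (φe : RExpr) : ℕ :=
  pruneCost d + netCost d + (stopNearest d).cost + 2 * (stopWithin φe).cost + φe.cost + 30

/-- Each of the two ways of continuing loses at least half the rank of the chosen point, for pruning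
even the whole rank. The doubled form of `Progress` avoids halves in natural numbers. -/
theorem Det.branch {φe : RExpr} (hφe : ∀ s : Store Ctx, s.reg 1 = s₀.reg 1 → φe.val s.reg = φ)
    (hφ : 1 ≤ φ) (hC : 0 ≤ C) (hD : HasDecider N O φ C) (hP : HasPrune N O C)
    (h : Current N v s₀ s L P) {stamp : ℕ} (h3 : s.reg 3 = stamp) (hF : Fresh stamp s)
    {δ : Pt d → ℝ} (hδ : ∀ p ∈ P.support, IsNearest P.support p (δ p)) {p : Pt d}
    (hp : p ∈ P.support) (h4 : s.reg 4 = δ p)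
    (hans : (s.reg 14 = -1 ∧ N.f P (s.ctx 0) < δ p) ∨ (s.reg 14 = 1 ∧ δ p < N.f P (s.ctx 0)) ∨
        (s.reg 14 = 0 ∧ s.reg 15 ≤ N.f P (s.ctx 0) ∧ N.f P (s.ctx 0) ≤ φ * s.reg 15)) :
    Det O (branch d φe) s (branchCost d φe * (L.length + 1) + 2 * C * L.length)
      (Progress N φ v s₀ L.length (rank P.support δ p) stamp (stamp + 1)) := by
  have h0 : 0 < δ p := by
    obtain ⟨⟨q, -, hne, heq⟩, -⟩ := hδ p hp
    rw [← heq]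
    exact dist_pos.2 hne.symm
  have hlen := h.enum.length_eq
  have hfresh : ∀ a, 1 < a → ∀ l, s.tab a ((stamp : ℤ) :: l) = 0 := fun a ha l =>
    hF a ha _ le_rfl l
  have hn0 : (0 : ℝ) ≤ L.length := Nat.cast_nonneg _
  have hpts : s.points d 1 ⌊(RExpr.reg 2).val s.reg⌋₊ = L := by
    simp only [RExpr.val, h.length, Nat.floor_natCast]
    exact h.holds.points
  refine (Det.ite (τ := (branchCost d φe - 3) * (L.length + 1) + 2 * C * L.length)
    (fun hlt => ?_) fun hlt => ?_).mono ?_ fun _ h => h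
  · have hlt' : N.f P (s.ctx 0) < δ p := by
      rcases hans with h' | h' | h'
      · exact h'.2
      · simp [RExpr.val, h'.1] at hlt
        linarith
      · simp [RExpr.val, h'.1] at hlt
    obtain ⟨-, -, hT⟩ := hP P _ L (δ p) h.good.inst h.enum h.good.pos hlt'
    refine (Det.seq (τ₂ := pruneCost d * (L.length + 1)) (Det.callUpdate (T := C * L.length)
      ?_ ?_)).mono ?_ fun _ h => h
    · rw [hpts, hlen]
      simpa [RExpr.val, h4] using hT
    · rw [hpts]
      simp only [RExpr.val, h4]
      set s₁ := s.setCtx 0 (O.update (δ p) L (s.ctx 0)) with hs₁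
      refine (Det.prune (s := s₁) h.enum h.length h3 h4 h0 h.holds hfresh).mono le_rfl
        fun s₂ hs₂ => Or.inr ⟨closeList L (δ p), closePts P (δ p), ?_, ?_, ?_, ?_⟩
      · refine Current.replaced (s := s₁) ?_ h.running hs₂ (h.enum.closePts _) ?_
        · obtain ⟨k₁, k₂, k₃, k₄⟩ := h.kept
          exact ⟨k₁, k₂, k₃, by simpa [hs₁, Store.setCtx] using k₄⟩
        · have : s₁.ctx 0 = O.update (δ p) L (s.ctx 0) := by simp [hs₁, Store.setCtx]
          rw [this]
          exact h.good.prune hP h.enum hlt'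
      · rw [hs₂.1.1 3 (by norm_num)]
        simpa [Store.setReg, hs₁, Store.setCtx] using h3
      · exact Fresh.replaced (s := s₁) hF hs₂
      · have h₁ := size_closePts_add_rank_le hδ p
        have h₂ := (h.enum.closePts (δ p)).length_eq
        omega
    · simp only [RExpr.cost, branchCost]
      push_cast
      have : (0 : ℝ) ≤ φe.cost := Nat.cast_nonneg _
      nlinarith [mul_nonneg hC hn0, mul_nonneg this hn0,
        mul_nonneg (Nat.cast_nonneg (netCost d) : (0 : ℝ) ≤ netCost d) hn0,
        mul_nonneg (Nat.cast_nonneg (stopNearest d).cost : (0 : ℝ) ≤ (stopNearest d).cost) hn0,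
        mul_nonneg (Nat.cast_nonneg (stopWithin φe).cost : (0 : ℝ) ≤ (stopWithin φe).cost) hn0]
  · refine (Det.ite (τ := (branchCost d φe - 6) * (L.length + 1) + 2 * C * L.length)
      (fun hlt₂ => ?_) fun hlt₂ => ?_).mono ?_ fun _ h => h
    · have hgt : δ p < N.f P (s.ctx 0) := by
        rcases hans with h' | h' | h'
        · simp [RExpr.val, h'.1] at hlt₂
          linarith
        · exact h'.2
        · simp [RExpr.val, h'.1] at hlt₂
      have hD' := Det.decide (s := s) (r := 40 * (d + 1) * δ p) (φe := φe)
        (re := .mul (.const (40 * ((d + 1 : ℕ) : ℚ))) (.reg 4)) (ne := .reg 2) (a := 1) (g := 0)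
        hD h.good.inst h.enum (by positivity) (hφe s h.kept.2.1) (by simp [RExpr.val, h4])
        (by simp [RExpr.val, h.length]) h.holds rfl
      refine (Det.seq_of hD' (τ₂ := 6 + netCost d * (L.length + 1) + ((stopNearest d).cost +
        (stopWithin φe).cost)) fun s₁ ⟨hs₁, hans₁⟩ => ?_).mono ?_ fun _ h => h
      · have hal := Alike.of_same' (by norm_num) hs₁
        have h' := h.alike hal
        have hc : s₁.ctx = s.ctx := hal.2.2
        have ht : s₁.tab = s.tab := hal.2.1
        have h4' : s₁.reg 4 = δ p := (hs₁.1 4 (by norm_num)).trans h4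
        rw [← hc] at hans₁ hgt
        refine (Det.ite (τ := 3 + netCost d * (L.length + 1) + ((stopNearest d).cost +
          (stopWithin φe).cost)) (fun hlt₃ => ?_) fun hlt₃ => ?_).mono ?_ fun _ h => h
        · have hlarge : 40 * (d + 1) * δ p < N.f P (s₁.ctx 0) := by
            rcases hans₁ with h'' | h'' | h''
            · simp [RExpr.val, h''.1] at hlt₃
              linarith
            · exact h''.2
            · simp [RExpr.val, h''.1] at hlt₃
          have h3' : s₁.reg 3 = stamp := (hs₁.1 3 (by norm_num)).trans h3
          refine (Det.net (s := s₁) h'.enum h'.length h3' h4' h0 h'.holds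
            (by rw [ht]; exact hfresh)).mono ?_ fun s₂ ⟨M, hM, hs₂⟩ => Or.inr ⟨M, ofList M,
              ?_, ?_, ?_, ?_⟩
          · have := (Nat.cast_nonneg (stopNearest d).cost : (0 : ℝ) ≤ (stopNearest d).cost)
            have := (Nat.cast_nonneg (stopWithin φe).cost : (0 : ℝ) ≤ (stopWithin φe).cost)
            linarith
          · exact Current.replaced h'.kept h'.running hs₂ (enumerates_ofList hM.nodup hM.pos)
              (h'.good.net h'.enum hp (hδ p hp) h0 hM hlarge)
          · rw [hs₂.1.1 3 (by norm_num)]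
            simpa [Store.setReg] using h3'
          · refine Fresh.replaced (s := s₁) ?_ hs₂
            simpa only [Fresh, ht] using hF
          · have hME := enumerates_ofList hM.nodup hM.pos
            have hsub : (ofList M).support ⊆ P.support := by
              intro q hq
              obtain ⟨m, hm, rfl⟩ := List.mem_map.1 (hME.mem_support.1 hq)
              exact h.enum.mem_support.2 (hM.subset m hm)
            have := two_mul_card_add_rank_le hδ hsub h0.le fun q hq q' hq' hne => by
              obtain ⟨m, hm, rfl⟩ := List.mem_map.1 (hME.mem_support.1 hq)
              obtain ⟨m', hm', rfl⟩ := List.mem_map.1 (hME.mem_support.1 hq')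
              exact hM.sep m hm m' hm' hne
            rw [hlen, hME.length_eq]
            exact this
        · have hnet0 : (0 : ℝ) ≤ netCost d * (L.length + 1) := by positivity
          refine (Det.ite (τ := (stopNearest d).cost + (stopWithin φe).cost)
            (fun hlt₄ => ?_) fun hlt₄ => ?_).mono ?_ fun _ h => h
          · have hle : N.f P (s₁.ctx 0) < 40 * (d + 1) * δ p := by
              rcases hans₁ with h'' | h'' | h''
              · exact h''.2
              · simp [RExpr.val, h''.1] at hlt₄
                linarith
              · simp [RExpr.val, h''.1] at hlt₄
            exact (Det.of_simple (c := stopNearest d) ⟨trivial, trivial, trivial⟩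
              (Or.inl (done_stopNearest hφ h' (h4' ▸ h0) (h4' ▸ hgt.le) (h4' ▸ hle.le)))).mono
              (by simp) fun _ h => h
          · rcases hans₁ with h'' | h'' | h''
            · simp [RExpr.val, h''.1] at hlt₄
            · simp [RExpr.val, h''.1] at hlt₃
            · exact (Det.of_simple (c := stopWithin φe) ⟨trivial, trivial, trivial⟩
                (Or.inl (done_stopWithin hφe hφ h' h''.2.1 h''.2.2))).mono (by simp) fun _ h => h
          · simp only [RExpr.cost]
            push_cast
            linarith
        · simp only [RExpr.cost]
          push_cast
          linarith
      · simp only [RExpr.cost, branchCost]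
        push_cast
        have : (0 : ℝ) ≤ φe.cost := Nat.cast_nonneg _
        have h₁ : (0 : ℝ) ≤ pruneCost d := Nat.cast_nonneg _
        nlinarith [mul_nonneg hC hn0, mul_nonneg this hn0, mul_nonneg h₁ hn0,
          mul_nonneg (Nat.cast_nonneg (stopNearest d).cost : (0 : ℝ) ≤ (stopNearest d).cost) hn0,
          mul_nonneg (Nat.cast_nonneg (stopWithin φe).cost : (0 : ℝ) ≤ (stopWithin φe).cost) hn0]
    · rcases hans with h' | h' | h'
      · simp [RExpr.val, h'.1] at hlt
      · simp [RExpr.val, h'.1] at hlt₂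
      · refine (Det.of_simple (c := stopWithin φe) ⟨trivial, trivial, trivial⟩
          (Or.inl (done_stopWithin hφe hφ h h'.2.1 h'.2.2))).mono ?_ fun _ h => h
        simp only [branchCost]
        push_cast
        have : (0 : ℝ) ≤ φe.cost := Nat.cast_nonneg _
        have h₁ : (0 : ℝ) ≤ pruneCost d := Nat.cast_nonneg _
        have h₂ : (0 : ℝ) ≤ netCost d := Nat.cast_nonneg _
        nlinarith [mul_nonneg hC hn0, mul_nonneg this hn0, mul_nonneg h₁ hn0, mul_nonneg h₂ hn0,
          mul_nonneg (Nat.cast_nonneg (stopNearest d).cost : (0 : ℝ) ≤ (stopNearest d).cost) hn0,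
          mul_nonneg (Nat.cast_nonneg (stopWithin φe).cost : (0 : ℝ) ≤ (stopWithin φe).cost) hn0]
    · simp only [RExpr.cost]
      push_cast
      nlinarith
  · simp only [RExpr.cost]
    push_cast
    nlinarith

end Main

/-! ### One round and the expected time of the main loop -/

section Main

variable {d : ℕ} {Ctx : Type u} {O : Procedures d Ctx} {N : Problem d Ctx} {v : ℝ}
  {P : WSet d} {Γ : Ctx} {L M : List (Pt d × ℕ)} {r C φ : ℝ} {s s' s₀ : Store Ctx}

def roundCost (d : ℕ) (φe : RExpr) : ℕ :=
  branchCost d φe + (nearestBody d).cost + (loadRow d 1 9 16).cost + φe.cost + 50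

theorem Det.round {φe : RExpr} (hφe : ∀ s : Store Ctx, s.reg 1 = s₀.reg 1 → φe.val s.reg = φ)
    (hφ : 1 ≤ φ) (hC : 0 ≤ C) (hD : HasDecider N O φ C) (hP : HasPrune N O C)
    (h : Current N v s₀ s L P) {stamp : ℕ} (h3 : s.reg 3 = stamp) (hF : Fresh stamp s)
    {δ : Pt d → ℝ} (hδ : ∀ p ∈ P.support, IsNearest P.support p (δ p)) {i : ℕ}
    (hi : i < L.length) (h9 : s.reg 9 = i) :
    Det O (round d φe) s (roundCost d φe * (L.length + 1) + 3 * C * L.length)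
      (Progress N φ v s₀ L.length (rank P.support δ L[i].1) (stamp + 1) (stamp + 1)) := by
  have hlen := h.enum.length_eq
  have h2 : 1 < L.length := hlen ▸ Problem.one_lt_size h.good.inst h.good.pos
  have hn0 : (0 : ℝ) ≤ L.length := Nat.cast_nonneg _
  have hmem : L[i].1 ∈ P.support :=
    h.enum.mem_support.2 (List.mem_map_of_mem (List.getElem_mem hi))
  have hpos : 0 < δ L[i].1 := by
    obtain ⟨⟨q, -, hne, heq⟩, -⟩ := hδ _ hmem
    rw [← heq]
    exact dist_pos.2 hne.symm
  refine (Det.seq_of (Det.nearest h.enum h.length h.holds h2 hi h9)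
    (τ₂ := 1 + (1 + φe.cost + 2 + C * L.length) + (1 + (branchCost d φe * (L.length + 1) +
      2 * C * L.length) + 4)) fun s₁ ⟨r, hr, hs₁⟩ => ?_).mono ?_ fun _ h => h
  · obtain rfl := hr.unique (hδ _ hmem)
    have hal := Alike.of_same (by norm_num) hs₁
    have h₁ := h.alike hal
    have h4 : s₁.reg 4 = δ L[i].1 := by
      rw [hs₁.1 4 (by norm_num)]
      simp [Store.setReg]
    have h3₁ : s₁.reg 3 = stamp := (hal.1 3 (by norm_num) (by norm_num)).trans h3
    refine (Det.seq_of (Det.decide (s := s₁) (φe := φe) (re := .reg 4) (ne := .reg 2) (a := 1)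
      (g := 0) hD h₁.good.inst h₁.enum hpos (hφe s₁ h₁.kept.2.1) h4 h₁.length h₁.holds rfl)
      (τ₂ := 1 + (branchCost d φe * (L.length + 1) + 2 * C * L.length) + 4)
      fun s₂ ⟨hs₂, hans⟩ => ?_).mono ?_ fun _ h => h
    · have hal₂ := Alike.of_same' (by norm_num) hs₂
      have h₂ := h₁.alike hal₂
      rw [← hal₂.2.2] at hans
      have hF₂ : Fresh stamp s₂ := by simpa only [Fresh, hal₂.2.1, hal.2.1] using hF
      refine Det.seq_of (Det.branch hφe hφ hC hD hP h₂
        ((hal₂.1 3 (by norm_num) (by norm_num)).trans h3₁) hF₂ hδ hmem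
        ((hs₂.1 4 (by norm_num)).trans h4) hans) fun s₃ hs₃ => ?_
      refine (Det.of_simple (c := .set 3 (.add (.reg 3) (.const 1))) trivial ?_).mono
        (by norm_num [Cmd.cost, RExpr.cost]) fun _ h => h
      rcases hs₃ with ⟨⟨k₁, k₂, k₃, k₄⟩, h₃, h₄⟩ | ⟨L', P', hc, h₃, h₄, h₅⟩
      · refine Or.inl ⟨⟨?_, ?_, k₃, k₄⟩, ?_, ?_⟩
        · simpa [Cmd.ev, Store.setReg] using k₁
        · simpa [Cmd.ev, Store.setReg] using k₂
        · simpa [Cmd.ev, Store.setReg] using h₃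
        · simpa [Cmd.ev, Store.setReg] using h₄
      · obtain ⟨k₁, k₂, k₃, k₄⟩ := hc.kept
        refine Or.inr ⟨L', P', ⟨⟨?_, ?_, k₃, k₄⟩, ?_, ?_, hc.holds, hc.enum, hc.good⟩, ?_, h₄, h₅⟩
        · simpa [Cmd.ev, Store.setReg] using k₁
        · simpa [Cmd.ev, Store.setReg] using k₂
        · simpa [Cmd.ev, Store.setReg] using hc.running
        · simpa [Cmd.ev, Store.setReg] using hc.length
        · simp [Cmd.ev, Store.setReg, RExpr.val, h₃]
    · simp only [RExpr.cost]
      push_cast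
      linarith
  · simp only [roundCost]
    push_cast
    have h₁ : (0 : ℝ) ≤ φe.cost := Nat.cast_nonneg _
    have h₂ : (0 : ℝ) ≤ (loadRow d 1 9 16).cost := Nat.cast_nonneg _
    have h₃ := mul_nonneg h₁ hn0
    have h₄ := mul_nonneg h₂ hn0
    linarith

/-- Strong induction on the number of points with the bound `A * n`. One round costs linear time,
and the mean rank is at least `n / 6`, so the induction hypothesis saves at least `A * n / 12` on
average; the constant `A` is chosen such that this saving pays for the round. `F` bounds what comes
after the loop. -/
theorem Bd.mainLoop {φe : RExpr} (hφe : ∀ s : Store Ctx, s.reg 1 = s₀.reg 1 → φe.val s.reg = φ)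
    (hφ : 1 ≤ φ) (hC : 0 ≤ C) (hD : HasDecider N O φ C) (hP : HasPrune N O C) {K : List Cmd}
    {R : Store Ctx → Prop} {F : ℝ}
    (hK : ∀ s', Done d φ v s₀ s' → Bd O R (K, s') F) {stamp : ℕ}
    (h : Current N v s₀ s L P) (h3 : s.reg 3 = stamp) (hF : Fresh stamp s) :
    Bd O R (mainLoop d φe :: K, s)
      (12 * (2 * roundCost d φe + 3 * C + 11) * L.length + 3 + F) := by
  set A : ℝ := 12 * (2 * roundCost d φe + 3 * C + 11) with hA
  have hA0 : 0 ≤ A := by positivity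
  have hexit : ∀ s', Done d φ v s₀ s' → Bd O R (NiceDistance.mainLoop d φe :: K, s') (3 + F) := by
    intro s' hs'
    obtain ⟨t, ht, hb⟩ := Det.loop_exit (O := O) (s := s') (e₁ := .reg 7) (e₂ := .const 1)
      (c := .seq (.rand 9 (.sub (.reg 2) (.const 1))) (round d φe)) (Q := Done d φ v s₀)
      (by simp [RExpr.val, hs'.2.1]) hs'
    refine (hb K R F (hK t ht)).mono ?_
    simp only [RExpr.cost]
    norm_num
  induction hn : L.length using Nat.strong_induction_on generalizing s L P stamp with
  | _ n ih =>
    have hlen := h.enum.length_eq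
    have h2 : 1 < L.length := hlen ▸ Problem.one_lt_size h.good.inst h.good.pos
    obtain ⟨δ, hδ⟩ := exists_nearest (S := P.support) (by
      change 1 < size P
      rwa [← hlen])
    have hn1 : (1 : ℝ) ≤ n := by
      rw [← hn]
      exact_mod_cast h2.le
    -- The bound if the point with number `i` is chosen: the round itself plus the induction bound
    -- for the remaining points. The default value `0` outside the list is never used.
    let X : ℕ → ℝ := fun i => (roundCost d φe * (n + 1) + 3 * C * n) +
      (A * (n - (if hi : i < L.length then (rank P.support δ L[i].1 : ℝ) else 0) / 2) + 3 + F)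
    have hX : ∀ i < n, Bd O R (round d φe :: NiceDistance.mainLoop d φe :: K, s.setReg 9 i)
        (X i) := by
      intro i hi
      rw [← hn] at hi
      have hsame : Alike s (s.setReg 9 (i : ℝ)) :=
        Alike.of_same' (b := 9) (by norm_num) (Same.setReg _ _ _ le_rfl)
      obtain ⟨s₁, hs₁, hb⟩ := Det.round hφe hφ hC hD hP (h.alike hsame)
        ((hsame.1 3 (by norm_num) (by norm_num)).trans h3) hF hδ hi
        (by simp [Store.setReg])
      rw [hn] at hb
      simp only [X, dif_pos hi]
      refine hb _ _ _ ?_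
      have hmem : L[i].1 ∈ P.support :=
        h.enum.mem_support.2 (List.mem_map_of_mem (List.getElem_mem hi))
      have hrank : rank P.support δ L[i].1 ≤ n := by
        rw [← hn, hlen]
        exact (min_le_left _ _).trans (Finset.card_filter_le _ _)
      rcases hs₁ with hs₁ | ⟨L', P', hc, h₃, h₄, h₅⟩
      -- If the search for an interval has ended, the term of the induction bound is nonnegative
      -- because the rank is at most `n`.
      · refine (hexit s₁ hs₁).mono ?_
        have : (rank P.support δ L[i].1 : ℝ) ≤ n := by exact_mod_cast hrank
        have : 0 ≤ A * (n - (rank P.support δ L[i].1 : ℝ) / 2) :=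
          mul_nonneg hA0 (by linarith)
        linarith
      · have := rank_pos δ hmem
        refine (ih L'.length (by omega) (stamp := stamp + 1) hc h₃ (by exact_mod_cast h₄)
          rfl).mono ?_
        have h₆ : (2 * L'.length + rank P.support δ L[i].1 : ℝ) ≤ 2 * n := by
          rw [← hn]
          exact_mod_cast h₅
        have : A * L'.length ≤ A * (n - (rank P.support δ L[i].1 : ℝ) / 2) :=
          mul_le_mul_of_nonneg_left (by linarith) hA0
        linarith
    have hfl : ⌊RExpr.val s.reg (.sub (.reg 2) (.const 1))⌋₊ + 1 = n := by
      simp only [RExpr.val, h.length, hn, Rat.cast_one]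
      rw [← Nat.cast_one, ← Nat.cast_sub (by omega), Nat.floor_natCast]
      omega
    have hrand := Bd.rand (O := O) (Q := R) (x := 9) (e := .sub (.reg 2) (.const 1)) hfl hX
    have hseq := Bd.of_step (c := .seq (.rand 9 (.sub (.reg 2) (.const 1))) (round d φe)) (O := O)
      (K := NiceDistance.mainLoop d φe :: K) (s := s) (by rw [step]) hrand
    have hloop := Bd.of_step (c := NiceDistance.mainLoop d φe) (O := O) (K := K) (s := s)
      (κ := (.seq (.rand 9 (.sub (.reg 2) (.const 1))) (round d φe) ::
        NiceDistance.mainLoop d φe :: K, s))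
      (by
        rw [NiceDistance.mainLoop, step, if_pos]
        simp [RExpr.val, h.running]) hseq
    refine hloop.mono ?_
    have hsum : ∑ i ∈ Finset.range n, X i = n * ((roundCost d φe * (n + 1) + 3 * C * n) +
        (A * n + 3 + F)) - A / 2 * ∑ p ∈ P.support, (rank P.support δ p : ℝ) := by
      have h₁ : ∑ i ∈ Finset.range n,
          (if hi : i < L.length then (rank P.support δ L[i].1 : ℝ) else 0) =
            ∑ p ∈ P.support, (rank P.support δ p : ℝ) := by
        rw [show Finset.range n = Finset.range L.length by rw [hn]]
        exact h.enum.sum_range _ _ fun i hi => dif_pos hi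
      rw [← h₁, Finset.mul_sum]
      have h₂ : (n : ℝ) * ((roundCost d φe * (n + 1) + 3 * C * n) + (A * n + 3 + F)) =
          ∑ _i ∈ Finset.range n, ((roundCost d φe * (n + 1) + 3 * C * n) + (A * n + 3 + F)) := by
        rw [Finset.sum_const, Finset.card_range, nsmul_eq_mul]
      rw [h₂, ← Finset.sum_sub_distrib]
      refine Finset.sum_congr rfl fun i _ => ?_
      simp only [X]
      ring
    have hrk : (n : ℝ) ^ 2 ≤ 6 * ∑ p ∈ P.support, (rank P.support δ p : ℝ) := by
      have := card_sq_le_sum_rank P.support δ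
      rw [show P.support.card = n by rw [← hn, hlen, size]] at this
      exact_mod_cast this
    have hdiv : (∑ i ∈ Finset.range n, X i) / n ≤ (roundCost d φe * (n + 1) + 3 * C * n) +
        (A * n + 3 + F) - A * n / 12 := by
      rw [div_le_iff₀ (by linarith), hsum]
      nlinarith
    simp only [stepTime, NiceDistance.mainLoop, RExpr.cost]
    push_cast
    have hr0 : (0 : ℝ) ≤ roundCost d φe := Nat.cast_nonneg _
    -- The expected saving: it covers the round, using `n + 1 ≤ 2 * n`, and the overhead of the
    -- loop.
    have : A * n / 12 = (2 * roundCost d φe + 3 * C + 11) * n := by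
      rw [hA]
      ring
    nlinarith

/-! ### The final search -/

/-- Shrink the interval between `reg 5` and `reg 6` by asking the decider with accuracy `acc` at
the threshold `thr`. -/
def refineBody (acc thr : RExpr) : Cmd :=
  .seq (.set 8 acc) (.seq (.set 9 thr) (.seq (.callDecider (.reg 8) (.reg 9) (.reg 0) 0 1 14)
    (.ite (.reg 14) (.const 0) (.set 6 (.reg 9))
      (.ite (.const 0) (.reg 14) (.set 5 (.reg 9))
        (.seq (.set 5 (.reg 15)) (.set 6 (.mul (.reg 8) (.reg 15))))))))

def refineLoop (acc thr : RExpr) : Cmd :=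
  .loop (.mul (.reg 1) (.reg 5)) (.reg 6) (refineBody acc thr)

/-- The memory stores the input and an interval `[a, b]` that contains the value. -/
def Between (N : Problem d Ctx) (P : WSet d) (s₀ : Store Ctx) (a b : ℝ) (s : Store Ctx) : Prop :=
  Kept s₀ s ∧ s.reg 5 = a ∧ s.reg 6 = b ∧ 0 < a ∧ a ≤ N.f P (s₀.ctx 1) ∧ N.f P (s₀.ctx 1) ≤ b

def refineCost (acc thr : RExpr) : ℕ := acc.cost + thr.cost + 30

/-- Each true answer yields a valid interval for the target on the original input. Accuracy and
threshold are copied to registers first, since `acc` and `thr` may depend on the interval that is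
overwritten afterwards. -/
theorem Det.refineBody {acc thr : RExpr} {T a b r ψ : ℝ}
    (hD : HasDecider N O ψ T) (hI : N.Inst P (s₀.ctx 1)) (hE : Enumerates L P)
    (hL : Holds (s₀.tab 0) L) (hn : s₀.reg 0 = L.length) (h : Between N P s₀ a b s)
    (hpos : 0 < N.f P (s₀.ctx 1)) (hψ : 0 < ψ) (hr : 0 < r) (hacc : acc.val s.reg = ψ)
    (hthr : thr.val (s.setReg 8 ψ).reg = r) :
    Det O (refineBody acc thr) s (refineCost acc thr + T * L.length) fun s' =>
      Between N P s₀ a r s' ∨ Between N P s₀ r b s' ∨ ∃ α, Between N P s₀ α (ψ * α) s' := by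
  obtain ⟨⟨k₁, k₂, k₃, k₄⟩, ha, hb, ha0, hav, hvb⟩ := h
  set s₁ := (s.setReg 8 ψ).setReg 9 r with hs₁
  have hx₁ : ∀ x < 8, s₁.reg x = s.reg x := fun x hx => by
    simp only [hs₁, Store.setReg]
    rw [Function.update_of_ne (by omega), Function.update_of_ne (by omega)]
  have h8 : s₁.reg 8 = ψ := by simp [hs₁, Store.setReg]
  have h9 : s₁.reg 9 = r := by simp [hs₁, Store.setReg]
  refine (Det.simple_seq (c₁ := .set 8 acc) (τ := 1 + (Cmd.set 9 thr).cost + (1 + (4 + T * L.length) +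
    13)) trivial (Det.simple_seq (c₁ := .set 9 thr) trivial (Det.seq_of (τ₁ := 4 + T * L.length)
      (τ₂ := 13) (R := fun s' => Same 14 ∅ s₁ s' ∧
        ((s'.reg 14 = -1 ∧ N.f P (s₀.ctx 1) < r) ∨ (s'.reg 14 = 1 ∧ r < N.f P (s₀.ctx 1)) ∨
        (s'.reg 14 = 0 ∧ s'.reg 15 ≤ N.f P (s₀.ctx 1) ∧ N.f P (s₀.ctx 1) ≤ ψ * s'.reg 15)))
      ?_ fun s₂ ⟨hs₂, hans⟩ => ?_))).mono ?_ fun _ h => h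
  · have : (Cmd.set 9 thr).ev ((Cmd.set 8 acc).ev s) = s₁ := by
      simp only [Cmd.ev, hacc, hthr, hs₁]
    rw [this]
    refine (Det.decide (s := s₁) (φe := .reg 8) (re := .reg 9) (ne := .reg 0) (a := 0)
      (g := 1) hD hI hE hr h8 h9 ?_ ?_ k₄).mono ?_ fun _ h => h
    · rw [RExpr.val, hx₁ 0 (by norm_num), k₁, hn]
    · change Holds (s.tab 0) L
      rw [k₃]
      exact hL
    · simp only [RExpr.cost]
      push_cast
      linarith
  · have hx₂ : ∀ x < 8, s₂.reg x = s.reg x := fun x hx =>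
      (hs₂.1 x (by omega)).trans (hx₁ x hx)
    have h8₂ : s₂.reg 8 = ψ := (hs₂.1 8 (by norm_num)).trans h8
    have h9₂ : s₂.reg 9 = r := (hs₂.1 9 (by norm_num)).trans h9
    have ht₂ : s₂.tab = s.tab := funext fun a => hs₂.2.1 a (by simp)
    have hc₂ : s₂.ctx = s.ctx := hs₂.2.2
    have hk : ∀ x y, 5 ≤ x → 5 ≤ y → ∀ a b, Kept s₀ ((s₂.setReg x a).setReg y b) := by
      intro x y hx hy a b
      refine ⟨?_, ?_, (congrFun ht₂ 0).trans k₃, (congrFun hc₂ 1).trans k₄⟩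
      · simp only [Store.setReg]
        rw [Function.update_of_ne (by omega), Function.update_of_ne (by omega),
          hx₂ 0 (by norm_num), k₁]
      · simp only [Store.setReg]
        rw [Function.update_of_ne (by omega), Function.update_of_ne (by omega),
          hx₂ 1 (by norm_num), k₂]
    have h5₂ : s₂.reg 5 = a := (hx₂ 5 (by norm_num)).trans ha
    have h6₂ : s₂.reg 6 = b := (hx₂ 6 (by norm_num)).trans hb
    refine (Det.ite (τ := 10) (fun hlt => ?_) fun hlt => ?_).mono ?_ fun _ h => h
    · have hv : N.f P (s₀.ctx 1) < r := by
        rcases hans with h' | h' | h'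
        · exact h'.2
        · simp [RExpr.val, h'.1] at hlt
          linarith
        · simp [RExpr.val, h'.1] at hlt
      refine (Det.of_simple (c := .set 6 (.reg 9)) trivial (Or.inl ?_)).mono
        (by norm_num [Cmd.cost, RExpr.cost]) fun _ h => h
      -- The unchanged endpoint is assigned to itself, so that `hk` applies to all three answers.
      have : (Cmd.set 6 (.reg 9)).ev s₂ = (s₂.setReg 5 a).setReg 6 r := by
        simp [Cmd.ev, RExpr.val, h9₂, Store.setReg, ← h5₂]
      rw [this]
      exact ⟨hk 5 6 (by norm_num) (by norm_num) _ _, by simp [Store.setReg],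
        by simp [Store.setReg], ha0, hav, hv.le⟩
    · refine (Det.ite (τ := 7) (fun hlt₂ => ?_) fun hlt₂ => ?_).mono ?_ fun _ h => h
      · have hv : r < N.f P (s₀.ctx 1) := by
          rcases hans with h' | h' | h'
          · simp [RExpr.val, h'.1] at hlt₂
            linarith
          · exact h'.2
          · simp [RExpr.val, h'.1] at hlt₂
        refine (Det.of_simple (c := .set 5 (.reg 9)) trivial (Or.inr (Or.inl ?_))).mono
          (by norm_num [Cmd.cost, RExpr.cost]) fun _ h => h
        have : (Cmd.set 5 (.reg 9)).ev s₂ = (s₂.setReg 6 b).setReg 5 r := by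
          simp [Cmd.ev, RExpr.val, h9₂, Store.setReg, ← h6₂]
        rw [this]
        exact ⟨hk 6 5 (by norm_num) (by norm_num) _ _, by simp [Store.setReg],
          by simp [Store.setReg], hr, hv.le, hvb⟩
      · rcases hans with h' | h' | h'
        · simp [RExpr.val, h'.1] at hlt
        · simp [RExpr.val, h'.1] at hlt₂
        · refine (Det.of_simple (c := .seq (.set 5 (.reg 15)) (.set 6 (.mul (.reg 8) (.reg 15))))
            ⟨trivial, trivial⟩ (Or.inr (Or.inr ⟨s₂.reg 15, ?_⟩))).mono
            (by norm_num [Cmd.cost, RExpr.cost]) fun _ h => h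
          have : (Cmd.seq (.set 5 (.reg 15)) (.set 6 (.mul (.reg 8) (.reg 15)))).ev s₂ =
              (s₂.setReg 5 (s₂.reg 15)).setReg 6 (ψ * s₂.reg 15) := by
            simp [Cmd.ev, RExpr.val, h8₂, Store.setReg]
          rw [this]
          exact ⟨hk 5 6 (by norm_num) (by norm_num) _ _, by simp [Store.setReg],
            by simp [Store.setReg], pos_of_mul_pos_right (hpos.trans_le h'.2.2) hψ.le, h'.2⟩
      · norm_num [RExpr.cost]
    · norm_num [RExpr.cost]
  · simp only [Cmd.cost, refineCost]
    push_cast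
    linarith

end Main

/-! ### Running time of the final search and assembly of the program -/

section Final

variable {d : ℕ} {Ctx : Type u} {O : Procedures d Ctx} {N : Problem d Ctx}
  {P : WSet d} {Γ : Ctx} {L : List (Pt d × ℕ)} {s s₀ : Store Ctx}

theorem HasDecider.mono {φ T T' : ℝ} (h : HasDecider N O φ T) (hT : T ≤ T') :
    HasDecider N O φ T' := fun P Γ L r hI hE hr =>
  ⟨(h P Γ L r hI hE hr).1, (h P Γ L r hI hE hr).2.trans (by gcongr)⟩

theorem HasPrune.mono {T T' : ℝ} (h : HasPrune N O T) (hT : T ≤ T') : HasPrune N O T' :=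
  fun P Γ L r hI hE h₀ hr => ⟨(h P Γ L r hI hE h₀ hr).1, (h P Γ L r hI hE h₀ hr).2.1,
    (h P Γ L r hI hE h₀ hr).2.2.trans (by gcongr)⟩

/-- The search with a decider of fixed accuracy. -/
theorem Det.refineLoop_const {φ T : ℝ} (hφ : 3 / 2 ≤ φ) (hD : HasDecider N O φ T)
    (hT : 0 ≤ T) (hI : N.Inst P (s₀.ctx 1)) (hE : Enumerates L P) (hL : Holds (s₀.tab 0) L)
    (hn : s₀.reg 0 = L.length) (h1 : s₀.reg 1 = φ) (hpos : 0 < N.f P (s₀.ctx 1)) (k : ℕ)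
    {a b : ℝ} (h : Between N P s₀ a b s) (hk : b ≤ φ * (3 / 2) ^ k * a) :
    Det O (refineLoop (.reg 1) (.mul (.const (3 / 2)) (.reg 5))) s
      (5 + k * (refineCost (.reg 1) (.mul (.const (3 / 2)) (.reg 5)) + 5 + T * L.length))
      fun s' => N.f P (s₀.ctx 1) ≤ s'.reg 6 ∧ s'.reg 6 ≤ φ * N.f P (s₀.ctx 1) := by
  induction k generalizing s a b with
  | zero =>
    obtain ⟨⟨-, k₂, -⟩, ha, hb, ha0, hav, hvb⟩ := h
    have hba : b ≤ φ * a := by simpa using hk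
    refine (Det.loop_exit ?_ ⟨hb ▸ hvb, ?_⟩).mono (by norm_num [RExpr.cost]) fun _ h => h
    · simpa [RExpr.val, k₂, h1, ha, hb] using hba
    · rw [hb]
      exact hba.trans (by gcongr)
  | succ k ih =>
    have h' := h
    obtain ⟨⟨-, k₂, -⟩, ha, hb, ha0, hav, hvb⟩ := h'
    by_cases hba : φ * a < b
    · refine (Det.loop_step (τ₂ := 5 + k * (refineCost (.reg 1) (.mul (.const (3 / 2)) (.reg 5)) +
          5 + T * L.length)) (by simpa [RExpr.val, k₂, h1, ha, hb] using hba)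
        ((Det.refineBody (r := 3 / 2 * a) hD hI hE hL hn h hpos (by linarith) (by positivity)
          (by simp [RExpr.val, k₂, h1]) (by simp [RExpr.val, Store.setReg, ha])).mono le_rfl
          fun s' hs' => ?_)).mono ?_ fun _ h => h
      · have hpow : (1 : ℝ) ≤ (3 / 2) ^ k := one_le_pow₀ (by norm_num)
        -- An upper bound `3 / 2 * a` gives ratio at most `φ` because `3 / 2 ≤ φ`, and so does an
        -- answer `[α, φ * α]`. A lower bound `3 / 2 * a` uses up one factor `3 / 2`, which is why
        -- `k` rounds suffice.
        rcases hs' with hs' | hs' | ⟨α, hs'⟩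
        · refine ih hs' ?_
          have : 3 / 2 * 1 ≤ φ * (3 / 2) ^ k := by gcongr
          nlinarith
        · refine ih hs' (hk.trans_eq ?_)
          ring
        · refine ih hs' ?_
          have hα : 0 < α := hs'.2.2.2.1
          have : φ * 1 ≤ φ * (3 / 2) ^ k := by gcongr
          nlinarith
      · simp only [RExpr.cost]
        push_cast
        linarith
    · refine (Det.loop_exit ?_ ⟨hb ▸ hvb, ?_⟩).mono ?_ fun _ h => h
      · simpa [RExpr.val, k₂, h1, ha, hb] using hba
      · have : (0 : ℝ) ≤ (k + 1 : ℕ) * ((refineCost (.reg 1) (.mul (.const (3 / 2)) (.reg 5)) : ℕ) +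
            5 + T * L.length) := by positivity
        simp only [RExpr.cost]
        push_cast at this ⊢
        linarith
      · rw [hb]
        exact (not_lt.1 hba).trans (by gcongr)

/-- The accuracy for the next call of the decider in the search with increasing accuracy. -/
def nextAcc (W : ℕ) : RExpr :=
  .add (.const 1) (.div (.sub (.reg 6) (.reg 5)) (.mul (.const (2 * (W : ℚ))) (.reg 5)))

def midpoint : RExpr := .div (.add (.reg 5) (.reg 6)) (.const 2)

/-- The search with a decider of increasing accuracy. -/
theorem Det.refineLoop_acc {ε c C : ℝ} {W : ℕ} (hW : 1 ≤ W) (hε : 0 < ε) (hc : 1 ≤ c)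
    (hC : 0 ≤ C)
    (hD : ∀ η : ℝ, 0 < η → η < 1 → HasDecider N O (1 + η) (C / η ^ c))
    (hI : N.Inst P (s₀.ctx 1)) (hE : Enumerates L P) (hL : Holds (s₀.tab 0) L)
    (hn : s₀.reg 0 = L.length) (h1 : s₀.reg 1 = 1 + ε) (hpos : 0 < N.f P (s₀.ctx 1))
    (hlen : 1 ≤ L.length) (k : ℕ) {a b A B : ℝ} (h : Between N P s₀ a b s)
    (hA : A = (refineCost (nextAcc W) midpoint + 5) * (W : ℝ) ^ c + C * (2 * W : ℝ) ^ c)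
    (hw : (b - a) / a ≤ W) (hk : (b - a) / a ≤ ε * 2 ^ k) (hB0 : 0 ≤ B)
    (hB : ε < (b - a) / a → A * L.length * (2 / ε ^ c - 1 / ((b - a) / a) ^ c) ≤ B) :
    Det O (refineLoop (nextAcc W) midpoint) s (5 + B)
      fun s' => N.f P (s₀.ctx 1) ≤ s'.reg 6 ∧ s'.reg 6 ≤ (1 + ε) * N.f P (s₀.ctx 1) := by
  have hW' : (1 : ℝ) ≤ W := by exact_mod_cast hW
  have hlen' : (1 : ℝ) ≤ L.length := by exact_mod_cast hlen
  induction k generalizing s a b B with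
  | zero =>
    obtain ⟨⟨-, k₂, -⟩, ha, hb, ha0, hav, hvb⟩ := h
    have hba : b ≤ (1 + ε) * a := by
      rw [pow_zero, mul_one, div_le_iff₀ ha0] at hk
      linarith
    refine (Det.loop_exit ?_ ⟨hb ▸ hvb, ?_⟩).mono ?_ fun _ h => h
    · simpa [RExpr.val, k₂, h1, ha, hb] using hba
    · simp only [RExpr.cost]
      push_cast
      linarith
    · rw [hb]
      exact hba.trans (by gcongr)
  | succ k ih =>
    have h' := h
    obtain ⟨⟨-, k₂, -⟩, ha, hb, ha0, hav, hvb⟩ := h'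
    by_cases hba : (1 + ε) * a < b
    · set w := (b - a) / a with hwdef
      have hwa : b - a = w * a := by
        rw [hwdef]
        field_simp
      have hεw : ε < w := by
        rw [hwdef, lt_div_iff₀ ha0]
        linarith
      have hw0 : 0 < w := hε.trans hεw
      have hη : RExpr.val s.reg (nextAcc W) = 1 + w / (2 * W) := by
        simp only [nextAcc, RExpr.val, ha, hb, hwa]
        push_cast
        field_simp
      have hη0 : 0 < w / (2 * W) := by positivity
      have hη1 : w / (2 * W) < 1 := by
        rw [div_lt_one (by positivity)]
        linarith
      have hwc : 0 < w ^ c := Real.rpow_pos_of_pos hw0 c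
      have hεc : 0 < ε ^ c := Real.rpow_pos_of_pos hε c
      have hWc : 0 < (W : ℝ) ^ c := Real.rpow_pos_of_pos (by linarith) c
      have hA0 : 0 ≤ A := by
        rw [hA]
        have : (0 : ℝ) ≤ (2 * W : ℝ) ^ c := by positivity
        positivity
      -- A round costs at most `A n / w ^ c`. As `w ≤ W`, the factor `W ^ c / w ^ c` is at least one
      -- and absorbs the constant part of the cost.
      have hcost : 5 + (refineCost (nextAcc W) midpoint : ℝ) + C / (w / (2 * W)) ^ c * L.length ≤
          A * L.length * (1 / w ^ c) := by
        rw [Real.div_rpow hw0.le (by positivity), hA]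
        have h₁ : (1 : ℝ) ≤ (W : ℝ) ^ c / w ^ c := by
          rw [one_le_div hwc]
          exact Real.rpow_le_rpow hw0.le hw (by linarith)
        have h₂ : (1 : ℝ) ≤ (W : ℝ) ^ c / w ^ c * L.length := by nlinarith
        have h₃ : (0 : ℝ) ≤ refineCost (nextAcc W) midpoint + 5 := by positivity
        have h₄ := mul_le_mul_of_nonneg_left h₂ h₃
        have h₅ : ((refineCost (nextAcc W) midpoint + 5) * (W : ℝ) ^ c + C * (2 * W : ℝ) ^ c) *
            L.length * (1 / w ^ c) = (refineCost (nextAcc W) midpoint + 5) *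
              ((W : ℝ) ^ c / w ^ c * L.length) + C / (w ^ c / (2 * W : ℝ) ^ c) * L.length := by
          field_simp
        rw [h₅]
        linarith
      have hB₁ := hB hεw
      have hwε : 1 / w ^ c ≤ 1 / ε ^ c :=
        one_div_le_one_div_of_le hεc (Real.rpow_le_rpow hε.le hεw.le (by linarith))
      have hAn : 0 ≤ A * L.length := by positivity
      -- The potential `A n (2 / ε ^ c - 1 / w ^ c)` pays for the round. If the width is at least
      -- halved, `c ≥ 1` gives `1 / w' ^ c ≥ 2 / w ^ c`, so the potential drops by at least `A n / w
      -- ^ c`; if the loop stops next, nonnegativity of the remainder is enough.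
      have hnext : ∀ {s' : Store Ctx} {a' b' : ℝ}, Between N P s₀ a' b' s' →
          (b' - a') / a' ≤ w / 2 → Det O (refineLoop (nextAcc W) midpoint) s'
            (5 + (B - A * L.length * (1 / w ^ c)))
            fun s' => N.f P (s₀.ctx 1) ≤ s'.reg 6 ∧ s'.reg 6 ≤ (1 + ε) * N.f P (s₀.ctx 1) := by
        intro s' a' b' hs' hw'
        refine ih hs' (by linarith) (hw'.trans ?_) ?_ fun hε' => ?_
        · rw [pow_succ] at hk
          linarith
        · have : 2 / ε ^ c = 1 / ε ^ c + 1 / ε ^ c := by ring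
          have : A * L.length * (1 / w ^ c) ≤ A * L.length * (2 / ε ^ c - 1 / w ^ c) :=
            mul_le_mul_of_nonneg_left (by linarith) hAn
          linarith
        · have hw'0 : 0 < (b' - a') / a' := hε.trans hε'
          have hc' : ((b' - a') / a') ^ c ≤ w ^ c / 2 := by
            calc ((b' - a') / a') ^ c ≤ (w / 2) ^ c :=
                  Real.rpow_le_rpow hw'0.le hw' (by linarith)
              _ = w ^ c / 2 ^ c := Real.div_rpow hw0.le (by norm_num) c
              _ ≤ w ^ c / 2 := by
                  gcongr
                  calc (2 : ℝ) = 2 ^ (1 : ℝ) := (Real.rpow_one 2).symm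
                    _ ≤ 2 ^ c := Real.rpow_le_rpow_of_exponent_le (by norm_num) hc
          have h₁ := one_div_le_one_div_of_le (Real.rpow_pos_of_pos hw'0 c) hc'
          have h₂ : 1 / (w ^ c / 2) = 2 * (1 / w ^ c) := by field_simp
          have h₃ : A * L.length * (2 / ε ^ c - 1 / ((b' - a') / a') ^ c) ≤
              A * L.length * (2 / ε ^ c - 2 * (1 / w ^ c)) :=
            mul_le_mul_of_nonneg_left (by linarith) hAn
          linarith
      refine (Det.loop_step (τ₂ := 5 + (B - A * L.length * (1 / w ^ c)))
        (by simpa [RExpr.val, k₂, h1, ha, hb] using hba)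
        ((Det.refineBody (r := (a + b) / 2) (hD _ hη0 hη1) hI hE hL hn h hpos (by linarith)
          (by linarith) hη (by simp [midpoint, RExpr.val, Store.setReg, ha, hb])).mono le_rfl
          fun s' hs' => ?_)).mono ?_ fun _ h => h
      · rcases hs' with hs' | hs' | ⟨α, hs'⟩
        · refine hnext hs' ?_
          rw [div_le_iff₀ ha0]
          linarith
        · refine hnext hs' ?_
          rw [div_le_iff₀ (by linarith)]
          nlinarith
        · have hα : 0 < α := hs'.2.2.2.1
          refine hnext hs' ?_
          rw [div_le_iff₀ hα]
          have : w / (2 * W) ≤ w / 2 := by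
            gcongr
            linarith
          nlinarith
      · simp only [RExpr.cost]
        push_cast
        linarith
    · refine (Det.loop_exit ?_ ⟨hb ▸ hvb, ?_⟩).mono ?_ fun _ h => h
      · simpa [RExpr.val, k₂, h1, ha, hb] using hba
      · simp only [RExpr.cost]
        push_cast
        linarith
      · rw [hb]
        exact (not_lt.1 hba).trans (by gcongr)

/-! ### The program -/

def program (d : ℕ) (φe acc thr : RExpr) : Cmd :=
  .seq (.set 2 (.reg 0)) (.seq (countLoop 10 0 (copyBody d)) (.seq (mainLoop d φe)
    (.seq (refineLoop acc thr) (.set 0 (.reg 6)))))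

/-- The accuracy `φ` of the main loop is separated from the requested accuracy `ψ`: they coincide in
the first part of the theorem, while in the second part the main loop works with `3 / 2` throughout.
The final search enters only through `hfinal`. -/
theorem approximates_program {φe acc thr : RExpr} {φ ψ C T : ℝ}
    (hφe : ∀ s : Store Ctx, s.reg 1 = ψ → φe.val s.reg = φ) (hφ : 1 ≤ φ) (hC : 0 ≤ C)
    (hD : HasDecider N O φ C) (hP : HasPrune N O C) (hI : N.Inst P Γ) (hpos : 0 < N.f P Γ)
    (hE : Enumerates L P)
    (hfinal : ∀ s a b, Between N P (inputStore ψ L Γ) a b s → b ≤ 120 * (d + 1) * φ * a →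
      Det O (refineLoop acc thr) s T
        fun s' => N.f P Γ ≤ s'.reg 6 ∧ s'.reg 6 ≤ ψ * N.f P Γ) :
    Approximates (program d φe acc thr) O ψ L Γ (N.f P Γ)
      ((12 * (2 * roundCost d φe + 3 * C + 11) + 2 * ((copyBody d).cost + 12) + 11) * L.length +
        T) := by
  set s₀ : Store Ctx := inputStore ψ L Γ with hs₀
  have hlen := hE.length_eq
  have h2 : 1 < L.length := hlen ▸ Problem.one_lt_size hI hpos
  have h2' : (1 : ℝ) ≤ L.length := by exact_mod_cast h2.le
  suffices h : Bd O (fun s => N.f P Γ ≤ s.reg 0 ∧ s.reg 0 ≤ ψ * N.f P Γ)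
      ([program d φe acc thr], s₀) ((12 * (2 * roundCost d φe + 3 * C + 11) +
        2 * ((copyBody d).cost + 12) + 11) * L.length + T) from ⟨h.2.1, h.2.2⟩
  have hset : (Cmd.set 2 (.reg 0)).ev s₀ = s₀.setReg 2 L.length := by
    simp [Cmd.ev, RExpr.val, hs₀, inputStore]
  obtain ⟨s₁, ⟨hs₁, hH₁⟩, hb₁⟩ := Det.copy (O := O) (s := s₀.setReg 2 L.length) (L := L)
    (by simp [hs₀, inputStore, Store.setReg])
    (by simpa [hs₀, inputStore, Store.setReg] using holds_pointTable L)
  obtain ⟨s₂, rfl, hb₂⟩ := Det.of_simple (O := O) (c := .set 2 (.reg 0)) (s := s₀)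
    (Q := fun s' => s' = s₀.setReg 2 L.length) trivial hset
  have hr₁ : ∀ x < 10, x ≠ 2 → s₁.reg x = s₀.reg x := fun x hx hx2 =>
    (hs₁.1 x hx).trans (Function.update_of_ne hx2 _ _)
  have hcur : Current N (N.f P Γ) s₀ s₁ L P := by
    refine ⟨⟨hr₁ 0 (by norm_num) (by norm_num), hr₁ 1 (by norm_num) (by norm_num),
      hs₁.2.1 0 (by simp), by rw [hs₁.2.2]; rfl⟩, ?_, ?_, hH₁, hE, ?_⟩
    · rw [hr₁ 7 (by norm_num) (by norm_num)]
      simp [hs₀, inputStore]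
    · rw [hs₁.1 2 (by norm_num)]
      simp [Store.setReg]
    · rw [hs₁.2.2]
      exact Good.init hI hpos
  have hloop := Bd.mainLoop (O := O) (s₀ := s₀) (s := s₁) (φe := φe) (φ := φ)
    (K := [.seq (refineLoop acc thr) (.set 0 (.reg 6))])
    (R := fun s => N.f P Γ ≤ s.reg 0 ∧ s.reg 0 ≤ ψ * N.f P Γ) (F := 1 + T + 2 + 0)
    (fun s hs => hφe s (by rw [hs, hs₀]; simp [inputStore])) hφ hC hD hP ?_ hcur (stamp := 0) ?_ ?_
  · have h₁ := Bd.of_step (c := .seq (mainLoop d φe) (.seq (refineLoop acc thr) (.set 0 (.reg 6))))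
      (K := []) (s := s₁) (O := O) (by rw [step]) hloop
    have h₂ := hb₁ _ _ _ h₁
    have h₃ := Bd.of_step (c := .seq (countLoop 10 0 (copyBody d)) (.seq (mainLoop d φe)
      (.seq (refineLoop acc thr) (.set 0 (.reg 6))))) (K := []) (O := O) (by rw [step]) h₂
    have h₄ := hb₂ _ _ _ h₃
    have h₅ := Bd.of_step (c := program d φe acc thr) (K := []) (O := O) (s := s₀)
      (by rw [program, step]) h₄
    refine h₅.mono ?_
    simp only [stepTime, program, Cmd.cost, RExpr.cost]
    push_cast
    have : (0 : ℝ) ≤ (copyBody d).cost := Nat.cast_nonneg _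
    nlinarith
  · rintro s' ⟨hk, -, h5, hv, hv', h6⟩
    have hdet := Det.seq_of (hfinal s' _ _ ⟨hk, rfl, rfl, h5, hv, hv'⟩ h6)
      (c₂ := .set 0 (.reg 6)) (τ₂ := 2) (Q := fun s => N.f P Γ ≤ s.reg 0 ∧ s.reg 0 ≤ ψ * N.f P Γ)
      fun s₁ hs₁ => (Det.of_simple (c := .set 0 (.reg 6)) trivial
        (by simpa [Cmd.ev, Store.setReg, RExpr.val] using hs₁)).mono
          (by norm_num [Cmd.cost, RExpr.cost]) fun _ h => h
    obtain ⟨t, ht, hb⟩ := hdet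
    exact hb _ _ _ (Bd.halted ht)
  · rw [hr₁ 3 (by norm_num) (by norm_num)]
    simp [hs₀, inputStore]
  -- At the start the stamp is zero and all tables from `2` on are empty.
  · intro a ha z _ l
    rw [hs₁.2.1 a (by simp; omega)]
    have ha0 : a ≠ 0 := by omega
    simp [hs₀, inputStore, Store.setReg, ha0]

end Final

end NiceDistance

end


theorem mainTheorem1 (d : ℕ) :
    (∃ prog : NiceDistance.Cmd, ∀ C : ℝ, ∃ K : ℝ,
      ∀ (Ctx : Type u) (N : NiceDistance.Problem d Ctx) (O : NiceDistance.Procedures d Ctx)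
        (φ : ℝ), 3 / 2 ≤ φ →
        NiceDistance.HasDecider N O φ C → NiceDistance.HasPrune N O C →
        ∀ (P : NiceDistance.WSet d) (Γ : Ctx) (L : List (NiceDistance.Pt d × ℕ)),
          N.Inst P Γ → 0 < N.f P Γ → NiceDistance.Enumerates L P →
          NiceDistance.Approximates prog O φ L Γ (N.f P Γ) (K * NiceDistance.size P)) ∧
    (∃ prog : NiceDistance.Cmd, ∀ C c : ℝ, 1 ≤ c → ∃ K : ℝ,
      ∀ (Ctx : Type u) (N : NiceDistance.Problem d Ctx) (O : NiceDistance.Procedures d Ctx),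
        (∀ ε : ℝ, 0 < ε → ε < 1 → NiceDistance.HasDecider N O (1 + ε) (C / ε ^ c)) →
        NiceDistance.HasPrune N O C →
        ∀ ε : ℝ, 0 < ε → ε < 1 →
        ∀ (P : NiceDistance.WSet d) (Γ : Ctx) (L : List (NiceDistance.Pt d × ℕ)),
          N.Inst P Γ → 0 < N.f P Γ → NiceDistance.Enumerates L P →
          NiceDistance.Approximates prog O (1 + ε) L Γ (N.f P Γ)
            (K * (NiceDistance.size P / ε ^ c))) := by
  open NiceDistance in
  constructor
  -- The ratio left over after division by `φ` depends only on `d`, hence so does the number `k` of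
  -- queries.
  · obtain ⟨k, hk⟩ := pow_unbounded_of_one_lt (120 * ((d : ℝ) + 1)) (by norm_num : (1 : ℝ) < 3 / 2)
    set thr : RExpr := .mul (.const (3 / 2)) (.reg 5)
    refine ⟨program d (.reg 1) (.reg 1) thr, fun C => ?_⟩
    -- Nothing is assumed about the sign of `C`, so the bound is formed with `|C|`.
    refine ⟨12 * (2 * roundCost d (.reg 1) + 3 * |C| + 11) + 2 * ((copyBody d).cost + 12) + 11 +
      (5 + k * (refineCost (.reg 1) thr + 5 + |C|)), fun Ctx N O φ hφ hD hP P Γ L hI hpos hE => ?_⟩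
    have hlen := hE.length_eq
    have h2 : 1 < L.length := hlen ▸ Problem.one_lt_size hI hpos
    have h2' : (1 : ℝ) ≤ L.length := by exact_mod_cast h2.le
    have hD' := hD.mono (le_abs_self C)
    have happ := approximates_program (φe := .reg 1) (acc := .reg 1) (thr := thr) (ψ := φ)
      (fun s hs => hs) (by linarith) (abs_nonneg C) hD' (hP.mono (le_abs_self C)) hI hpos hE
      fun s a b hs hab => Det.refineLoop_const hφ hD' (abs_nonneg C) hI hE
        (by simpa [inputStore] using holds_pointTable L) (by simp [inputStore])
        (by simp [inputStore]) hpos k hs (hab.trans ?_)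
    · refine ⟨happ.1.trans (ENNReal.ofReal_le_ofReal ?_), happ.2⟩
      rw [← hlen]
      have h₁ : (0 : ℝ) ≤ k * (refineCost (.reg 1) thr + 5) := by positivity
      nlinarith
    · have ha : 0 < a := hs.2.2.2.1
      have : φ * (120 * ((d : ℝ) + 1)) ≤ φ * (3 / 2) ^ k := by
        have : 0 ≤ φ := by linarith
        gcongr
      nlinarith
  -- The main loop runs with `φ = 3 / 2` and ends with ratio at most `120 (d + 1) * 3 / 2`, so `W`
  -- bounds the relative width at the start of the final search and keeps all accuracies below `2`.
  · set W : ℕ := 180 * (d + 1) with hW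
    refine ⟨program d (.const (3 / 2)) (nextAcc W) midpoint, fun C c hc => ?_⟩
    -- The time constant of the decider for `ε = 1 / 2`, which the main loop uses.
    set C' : ℝ := |C| / (1 / 2) ^ c with hC'
    have hhalf : (0 : ℝ) < (1 / 2) ^ c := Real.rpow_pos_of_pos (by norm_num) c
    have hhalf' : (1 / 2 : ℝ) ^ c ≤ 1 := Real.rpow_le_one (by norm_num) (by norm_num) (by linarith)
    have hCC' : |C| ≤ C' := le_div_self (abs_nonneg C) hhalf hhalf'
    have hC'0 : 0 ≤ C' := (abs_nonneg C).trans hCC'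
    set A : ℝ := (refineCost (nextAcc W) midpoint + 5) * (W : ℝ) ^ c + |C| * (2 * W : ℝ) ^ c
      with hA
    have hA0 : 0 ≤ A := by positivity
    refine ⟨12 * (2 * roundCost d (.const (3 / 2)) + 3 * C' + 11) + 2 * ((copyBody d).cost + 12) +
      11 + (5 + 2 * A), fun Ctx N O hD hP ε hε hε1 P Γ L hI hpos hE => ?_⟩
    have hlen := hE.length_eq
    have h2 : 1 < L.length := hlen ▸ Problem.one_lt_size hI hpos
    have h2' : (1 : ℝ) ≤ L.length := by exact_mod_cast h2.le
    have hεc : 0 < ε ^ c := Real.rpow_pos_of_pos hε c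
    have hεc1 : ε ^ c ≤ 1 := Real.rpow_le_one hε.le hε1.le (by linarith)
    have hD' : ∀ η : ℝ, 0 < η → η < 1 → HasDecider N O (1 + η) (|C| / η ^ c) :=
      fun η hη hη1 => (hD η hη hη1).mono (by
        have := Real.rpow_pos_of_pos hη c
        gcongr
        exact le_abs_self C)
    have hD₁ : HasDecider N O (3 / 2) C' := by
      have := hD' (1 / 2) (by norm_num) (by norm_num)
      norm_num at this ⊢
      simpa [hC'] using this
    have happ := approximates_program (φe := .const (3 / 2)) (acc := nextAcc W) (thr := midpoint)
      (ψ := 1 + ε) (T := 5 + 2 * A * (L.length / ε ^ c)) (fun s _ => by simp [RExpr.val])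
      (by norm_num) hC'0 hD₁ (hP.mono ((le_abs_self C).trans hCC')) hI hpos hE
      fun s a b hs hab => by
        have ha : 0 < a := hs.2.2.2.1
        -- This number of halvings depends on `ε` and on the interval. It only makes the induction
        -- terminate and does not enter the time bound.
        obtain ⟨k, hk⟩ := pow_unbounded_of_one_lt ((b - a) / a / ε) (by norm_num : (1 : ℝ) < 2)
        refine Det.refineLoop_acc (W := W) (by omega) hε hc (abs_nonneg C) hD' hI hE
          (by simpa [inputStore] using holds_pointTable L) (by simp [inputStore])
          (by simp [inputStore]) hpos (by omega) k hs hA ?_ ?_ (by positivity) fun hw => ?_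
        · rw [div_le_iff₀ ha, hW]
          push_cast
          linarith
        · rw [div_lt_iff₀ hε] at hk
          linarith
        · have hw0 : 0 < (b - a) / a := hε.trans hw
          have h₁ : 0 ≤ 1 / ((b - a) / a) ^ c := by positivity
          calc A * L.length * (2 / ε ^ c - 1 / ((b - a) / a) ^ c) ≤
                A * L.length * (2 / ε ^ c) :=
                mul_le_mul_of_nonneg_left (by linarith) (by positivity)
            _ = _ := by ring
    refine ⟨happ.1.trans (ENNReal.ofReal_le_ofReal ?_), happ.2⟩
    rw [← hlen]
    have h₁ : (L.length : ℝ) ≤ L.length / ε ^ c := le_div_self (by positivity) hεc hεc1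
    set B : ℝ := 12 * (2 * roundCost d (.const (3 / 2)) + 3 * C' + 11) +
      2 * ((copyBody d).cost + 12) + 11 with hB
    have hB0 : 0 ≤ B := by positivity
    have h₂ : B * L.length ≤ B * (L.length / ε ^ c) := by gcongr
    linarith
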